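/- Let $(\tilde M,g,J)$ be a six-dimensional strict nearly Kähler manifold, i.e. a smooth Riemannian manifold with a smooth compatible almost complex structure $J$ such that $G=\tilde\nabla J$, $G(X,Y)=(\tilde\nabla_XJ)Y$, is skew-symmetric and non-degenerate ($\tilde\nabla$ is the Levi-Civita connection). Assume that it is of constant type one: $$g(G(X,Y),G(Z,W))=g(X,Z)g(Y,W)-g(X,W)g(Y,Z)+g(JX,Z)g(Y,JW)-g(JX,W)g(Y,JZ).$$ Let $M$ be a non-empty isometrically immersed hypersurface of $\tilde M$ with Levi-Civita connection $\nabla$, smooth unit normal vector field $N$, shape operator $S$ ($\tilde\nabla_XN=-SX$) and second fundamental form $h(X,Y)=g(SX,Y)$. Put $\xi=-JN$, $\eta=g(\xi,\cdot)$ and $$\phi_1=J-\eta\otimes N,\qquad \phi_2=\xi\,\lrcorner\,G=G(\xi,\cdot),\qquad \phi_3=N\,\lrcorner\,G=G(N,\cdot),$$ which are $(1,1)$-tensors on $M$, and let $\phi=a\phi_1+b\phi_2+c\phi_3$ with $a,b,c\in C^\infty(M)$ and $a^2+b^2+c^2=1$. Then $(\xi,\phi)$ is an almost contact metric structure on $M$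 (that is, $\xi$ is a unit vector field, $\phi$ is a smooth $(1,1)$-tensor, $g(\phi X,\phi Y)=g(X,Y)-\eta(X)\eta(Y)$ and $\phi^2=-\mathrm{Id}+\eta\otimes\xi$), and the following hold. 1. $(M,g,\xi,\phi)$ is Sasakian, i.e. $(\nabla_X\phi)Y=\eta(Y)X-g(X,Y)\xi$, if and only if $S=0$ and $\phi=\phi_3$. 2. $(M,g,\xi,\phi)$ is never co-Kähler, i.e. $\nabla\phi$ is not identically zero. 3. If $(M,g,\xi,\phi)$ is nearly Sasakian, i.e. $(\nabla_X\phi)Y+(\nabla_Y\phi)X=\eta(Y)X+\eta(X)Y-2g(X,Y)\xi$, then $M$ is $\eta$-quasi-umbilical, i.e. $h=\alpha g+\beta\,\eta\otimes\eta$ for some $\alpha,\beta\in C^\infty(M)$, and, if $M$ is connected, it belongs to one of the following families: (a) $S=\mathrm{Id}+(\lambda-1)\eta\otimes\xi$ with $\lambda\in\mathbb R$, and $\phi=\phi_1$; (b) $S=\lambda\,\mathrm{Id}$ with $\lambda\in\mathbb R$, and $\phi=\phi_3$; (c) $S=\sec(t)\,\mathrm{Id}$ and $\phi=\cos t\,\phi_1+\sin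 t\,\phi_2$, with $t\in\mathbb R$, $\cos t\neq0$; (d) $S=\frac{1-c}{a}\mathrm{Id}+\frac1c\,\xi(b)\,\eta\otimes\xi$, where $a$ and $c$ vanish nowhere, $a$ is constant, and $X(b)=X(c)=0$ for any $X\in\ker\eta$. 4. If $(M,g,\xi,\phi)$ is nearly cosymplectic, i.e. $(\nabla_X\phi)Y+(\nabla_Y\phi)X=0$, then $M$ is $\eta$-quasi-umbilical and, if $M$ is connected, it belongs to one of the following families: (a) $S=\lambda\,\mathrm{Id}$ with $\lambda\in\mathbb R$, and $\phi=\phi_2$ or $\phi=-\phi_2$; (b) $S=\lambda\,\eta\otimes\xi$ with $\lambda\in\mathbb R$, and $\phi=\phi_1$; (c) $S=0$ and $\phi=\cos t\,\phi_1+\sin t\,\phi_2$ with $t\in\mathbb R$; (d) $S=-\frac{c}{a}\mathrm{Id}+\frac1c\,\xi(b)\,\eta\otimes\xi$, where $a$ and $c$ vanish nowhere, $a$ is constant, and $X(b)=X(c)=0$ for any $X\in\ker\eta$. -/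

import Mathlib

open Bundle FiberBundle
open scoped Manifold ContDiff

noncomputable section

/-! ### Tensor fields of type (1,1) and the Levi-Civita connection -/

section Manifolds

variable {E : Type*} [NormedAddCommGroup E] [NormedSpace ℝ E]
  {H : Type*} [TopologicalSpace H] {I : ModelWithCorners ℝ E H}
  {M : Type*} [TopologicalSpace M] [ChartedSpace H M] [IsManifold I ∞ M]

/-- A field `A` of endomorphisms of the tangent spaces is a smooth `(1,1)`-tensor field: it is a
smooth section of the bundle `Hom(TM, TM)`. -/
def IsSmoothEndo (A : ∀ x : M, TangentSpace I x →L[ℝ] TangentSpace I x) : Prop :=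
  ContMDiff I (I.prod 𝓘(ℝ, E →L[ℝ] E)) ∞
    (fun x ↦ TotalSpace.mk' (E →L[ℝ] E)
      (E := fun x : M ↦ TangentSpace I x →L[ℝ] TangentSpace I x) x (A x))

/-- `X` is a smooth vector field. -/
def IsSmoothVectorField (X : ∀ x : M, TangentSpace I x) : Prop :=
  ContMDiff I I.tangent ∞ (fun x ↦ (⟨x, X x⟩ : TangentBundle I M))

/-- A smooth `(1,1)`-tensor field applied to a vector field that is differentiable at `x` is
differentiable at `x`. -/
theorem IsSmoothEndo.mdifferentiableAt_apply
    {A : ∀ x : M, TangentSpace I x →L[ℝ] TangentSpace I x} (hA : IsSmoothEndo A)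
    {Y : ∀ x : M, TangentSpace I x} {x : M}
    (hY : MDifferentiableAt I I.tangent (fun y ↦ (⟨y, Y y⟩ : TangentBundle I M)) x) :
    MDifferentiableAt I I.tangent (fun y ↦ (⟨y, A y (Y y)⟩ : TangentBundle I M)) x :=
  MDifferentiableAt.clm_bundle_apply ((hA x).mdifferentiableAt (by simp)) hY

/-- The vector `∇_X (A Y) - A (∇_X Y)` at `x`, for vector fields `X` and `Y`. -/
def covDerivEndoAux (D : CovariantDerivative I E (TangentSpace I : M → Type _))
    (A : ∀ x : M, TangentSpace I x →L[ℝ] TangentSpace I x) (x : M)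
    (X Y : ∀ x : M, TangentSpace I x) : TangentSpace I x :=
  D (fun y ↦ A y (Y y)) x (X x) - A x (D Y x (X x))

theorem tensorialAt_covDerivEndoAux_left
    (D : CovariantDerivative I E (TangentSpace I : M → Type _))
    (A : ∀ x : M, TangentSpace I x →L[ℝ] TangentSpace I x) (x : M)
    (Y : ∀ x : M, TangentSpace I x) :
    TensorialAt I E (fun X ↦ covDerivEndoAux D A x X Y) x where
  smul hf hX := by
    simp only [covDerivEndoAux, Pi.smul_apply', map_smul, smul_sub]
  add hX hX' := by
    simp only [covDerivEndoAux, Pi.add_apply, map_add]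
    abel

theorem tensorialAt_covDerivEndoAux_right
    (D : CovariantDerivative I E (TangentSpace I : M → Type _))
    {A : ∀ x : M, TangentSpace I x →L[ℝ] TangentSpace I x} (hA : IsSmoothEndo A) (x : M)
    (X : ∀ x : M, TangentSpace I x) :
    TensorialAt I E (fun Y ↦ covDerivEndoAux D A x X Y) x where
  smul {f σ} hf hσ := by
    have h1 : (fun y ↦ A y ((f • σ) y)) = f • (fun y ↦ A y (σ y)) := by
      funext y
      simp
    simp only [covDerivEndoAux]
    rw [h1, D.isCovariantDerivativeOn.leibniz (hA.mdifferentiableAt_apply hσ) hf,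
      D.isCovariantDerivativeOn.leibniz hσ hf]
    simp
    module
  add {σ σ'} hσ hσ' := by
    have h1 : (fun y ↦ A y ((σ + σ') y)) = (fun y ↦ A y (σ y)) + (fun y ↦ A y (σ' y)) := by
      funext y
      simp
    simp only [covDerivEndoAux]
    rw [h1, D.isCovariantDerivativeOn.add (hA.mdifferentiableAt_apply hσ)
        (hA.mdifferentiableAt_apply hσ'), D.isCovariantDerivativeOn.add hσ hσ']
    simp
    abel

variable [FiniteDimensional ℝ E]

/-- The covariant derivative `∇A` of a smooth `(1,1)`-tensor field `A`, as a tensor: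
`covDerivEndo D hA x u v` is `(∇_u A) v = ∇_u (A Y) - A (∇_u Y)`, where `Y` is any vector field
that is differentiable at `x` with `Y x = v`. -/
def covDerivEndo (D : CovariantDerivative I E (TangentSpace I : M → Type _))
    {A : ∀ x : M, TangentSpace I x →L[ℝ] TangentSpace I x} (hA : IsSmoothEndo A) (x : M) :
    TangentSpace I x →L[ℝ] TangentSpace I x →L[ℝ] TangentSpace I x :=
  TensorialAt.mkHom₂ (covDerivEndoAux D A x) x
    (fun Y _ ↦ tensorialAt_covDerivEndoAux_left D A x Y)
    (fun X _ ↦ tensorialAt_covDerivEndoAux_right D hA x X)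

theorem covDerivEndo_apply (D : CovariantDerivative I E (TangentSpace I : M → Type _))
    {A : ∀ x : M, TangentSpace I x →L[ℝ] TangentSpace I x} (hA : IsSmoothEndo A) (x : M)
    (u : TangentSpace I x) {Y : ∀ x : M, TangentSpace I x}
    (hY : MDifferentiableAt I I.tangent (fun y ↦ (⟨y, Y y⟩ : TangentBundle I M)) x) :
    covDerivEndo D hA x u (Y x) = D (fun y ↦ A y (Y y)) x u - A x (D Y x u) := by
  have h := TensorialAt.mkHom₂_apply
    (fun Y _ ↦ tensorialAt_covDerivEndoAux_left D A x Y)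
    (fun X _ ↦ tensorialAt_covDerivEndoAux_right D hA x X)
    (σ := extend E u) (mdifferentiableAt_extend I E u) hY
  simpa [covDerivEndo, covDerivEndoAux] using h

variable [RiemannianBundle (fun x : M ↦ TangentSpace I x)]
  [IsContMDiffRiemannianBundle I ∞ E (fun x : M ↦ TangentSpace I x)]

/-- `D` is the Levi-Civita connection of the Riemannian manifold `M`: the (unique) smooth
connection on `TM` which is compatible with the metric and torsion-free. -/
structure IsLeviCivita (D : CovariantDerivative I E (TangentSpace I : M → Type _)) : Prop where
  smooth : CovariantDerivative.ContMDiffCovariantDerivative D ∞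
  metric : CovariantDerivative.IsMetricCompatible (V := fun x : M ↦ TangentSpace I x) (F := E) D
  torsion_free : D.torsion = 0

/-! ### Nearly Kähler manifolds -/

/-- `J` is a smooth almost complex structure compatible with the Riemannian metric. -/
structure IsAlmostHermitian (J : ∀ x : M, TangentSpace I x →L[ℝ] TangentSpace I x) : Prop where
  smooth : IsSmoothEndo J
  sq : ∀ x (u : TangentSpace I x), J x (J x u) = -u
  inner_map : ∀ x (u v : TangentSpace I x), inner ℝ (J x u) (J x v) = inner ℝ u v

/-- The tensor `G = ∇J` of an almost Hermitian manifold: `G x u v = (∇_u J) v`. -/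
def nablaJ (D : CovariantDerivative I E (TangentSpace I : M → Type _))
    {J : ∀ x : M, TangentSpace I x →L[ℝ] TangentSpace I x} (hJ : IsAlmostHermitian J) (x : M) :
    TangentSpace I x →L[ℝ] TangentSpace I x →L[ℝ] TangentSpace I x :=
  covDerivEndo D hJ.smooth x

/-- Strict nearly Kähler: `G = ∇J` is skew-symmetric and non-degenerate. -/
structure IsStrictNearlyKahler (D : CovariantDerivative I E (TangentSpace I : M → Type _))
    {J : ∀ x : M, TangentSpace I x →L[ℝ] TangentSpace I x} (hJ : IsAlmostHermitian J) :
    Prop where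
  skew : ∀ x (u v : TangentSpace I x), nablaJ D hJ x u v = -nablaJ D hJ x v u
  nondegenerate : ∀ x (u : TangentSpace I x), (∀ v, nablaJ D hJ x u v = 0) → u = 0

/-- The almost Hermitian manifold is of constant type `α`. -/
def HasConstantType (D : CovariantDerivative I E (TangentSpace I : M → Type _))
    {J : ∀ x : M, TangentSpace I x →L[ℝ] TangentSpace I x} (hJ : IsAlmostHermitian J)
    (α : ℝ) : Prop :=
  ∀ x (u v w z : TangentSpace I x),
    inner ℝ (nablaJ D hJ x u v) (nablaJ D hJ x w z) =
      α * (inner ℝ u w * inner ℝ v z - inner ℝ u z * inner ℝ v w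
        + inner ℝ (J x u) w * inner ℝ v (J x z) - inner ℝ (J x u) z * inner ℝ v (J x w))

/-! ### Almost contact metric structures -/

/-- The one-form `η` dual to a vector field `ξ`. -/
def dualForm (ξ : ∀ x : M, TangentSpace I x) (x : M) : TangentSpace I x →L[ℝ] ℝ :=
  innerSL ℝ (ξ x)

/-- `(ξ, φ)` is an almost contact metric structure on the Riemannian manifold `M`. -/
structure IsAlmostContactMetric (ξ : ∀ x : M, TangentSpace I x)
    (φ : ∀ x : M, TangentSpace I x →L[ℝ] TangentSpace I x) : Prop where
  smooth_reeb : IsSmoothVectorField ξ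
  smooth_tensor : IsSmoothEndo φ
  norm_reeb : ∀ x, ‖ξ x‖ = 1
  inner_map : ∀ x (u v : TangentSpace I x),
    inner ℝ (φ x u) (φ x v) = inner ℝ u v - dualForm ξ x u * dualForm ξ x v
  sq : ∀ x (u : TangentSpace I x), φ x (φ x u) = -u + dualForm ξ x u • ξ x

/-- Sasakian: `(∇_X φ) Y = η(Y) X - g(X, Y) ξ`. -/
structure IsSasakian (D : CovariantDerivative I E (TangentSpace I : M → Type _))
    (ξ : ∀ x : M, TangentSpace I x) (φ : ∀ x : M, TangentSpace I x →L[ℝ] TangentSpace I x) :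
    Prop extends IsAlmostContactMetric ξ φ where
  nabla_eq : ∀ x (u v : TangentSpace I x),
    covDerivEndo D smooth_tensor x u v = dualForm ξ x v • u - (inner ℝ u v : ℝ) • ξ x

/-- co-Kähler: `∇φ = 0`. -/
structure IsCoKahler (D : CovariantDerivative I E (TangentSpace I : M → Type _))
    (ξ : ∀ x : M, TangentSpace I x) (φ : ∀ x : M, TangentSpace I x →L[ℝ] TangentSpace I x) :
    Prop extends IsAlmostContactMetric ξ φ where
  nabla_eq : ∀ x (u v : TangentSpace I x), covDerivEndo D smooth_tensor x u v = 0

/-- Nearly Sasakian: `(∇_X φ) Y + (∇_Y φ) X = η(Y) X + η(X) Y - 2 g(X, Y) ξ`. -/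
structure IsNearlySasakian (D : CovariantDerivative I E (TangentSpace I : M → Type _))
    (ξ : ∀ x : M, TangentSpace I x) (φ : ∀ x : M, TangentSpace I x →L[ℝ] TangentSpace I x) :
    Prop extends IsAlmostContactMetric ξ φ where
  nabla_eq : ∀ x (u v : TangentSpace I x),
    covDerivEndo D smooth_tensor x u v + covDerivEndo D smooth_tensor x v u =
      dualForm ξ x v • u + dualForm ξ x u • v - (2 * inner ℝ u v : ℝ) • ξ x

/-- Nearly cosymplectic: `(∇_X φ) Y + (∇_Y φ) X = 0`. -/
structure IsNearlyCosymplectic (D : CovariantDerivative I E (TangentSpace I : M → Type _))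
    (ξ : ∀ x : M, TangentSpace I x) (φ : ∀ x : M, TangentSpace I x →L[ℝ] TangentSpace I x) :
    Prop extends IsAlmostContactMetric ξ φ where
  nabla_eq : ∀ x (u v : TangentSpace I x),
    covDerivEndo D smooth_tensor x u v + covDerivEndo D smooth_tensor x v u = 0

/-- For a hypersurface `M` with shape operator `S` (and second fundamental form
`h(X, Y) = g(S X, Y)`) and a one-form `θ` on `M`: `M` is `θ`-quasi-umbilical, that is,
`h = α g + β θ ⊗ θ` for some smooth functions `α`, `β`. -/
def IsQuasiUmbilical (S : ∀ x : M, TangentSpace I x →L[ℝ] TangentSpace I x)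
    (θ : ∀ x : M, TangentSpace I x →L[ℝ] ℝ) : Prop :=
  ∃ α β : M → ℝ, ContMDiff I 𝓘(ℝ, ℝ) ∞ α ∧ ContMDiff I 𝓘(ℝ, ℝ) ∞ β ∧
    ∀ x (u v : TangentSpace I x),
      inner ℝ (S x u) v = α x * inner ℝ u v + β x * (θ x u * θ x v)

end Manifolds

/-! ### Isometrically immersed hypersurfaces -/

section Hypersurfaces

variable {E : Type*} [NormedAddCommGroup E] [NormedSpace ℝ E]
  {H : Type*} [TopologicalSpace H] {I : ModelWithCorners ℝ E H}
  {M : Type*} [TopologicalSpace M] [ChartedSpace H M] [IsManifold I ∞ M]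
  {E' : Type*} [NormedAddCommGroup E'] [NormedSpace ℝ E']
  {H' : Type*} [TopologicalSpace H'] {I' : ModelWithCorners ℝ E' H'}
  {M' : Type*} [TopologicalSpace M'] [ChartedSpace H' M'] [IsManifold I' ∞ M']

/-- The derivative of a vector field `V` along a map `f : M → M'` with respect to the pull-back to
`f^* TM'` of the connection `D`. In the local frame `e_i` of `TM'` given by the trivialization at
`f x`, with `V = ∑ V^i (e_i ∘ f)`, it is
`u ↦ ∑ (dV^i(u) e_i + V^i(x) ∇_{df(u)} e_i)`. -/
def covAlong (D : CovariantDerivative I' E' (TangentSpace I' : M' → Type _)) (f : M → M')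
    (V : ∀ x : M, TangentSpace I' (f x)) (x : M) :
    TangentSpace I x →L[ℝ] TangentSpace I' (f x) :=
  D (extend E' (V x)) (f x) ∘L mfderiv I I' f x +
    (trivializationAt E' (fun y : M' ↦ TangentSpace I' y) (f x)).symmL ℝ (f x) ∘L
      mvfderiv I (fun y ↦ (trivializationAt E' (fun y : M' ↦ TangentSpace I' y) (f x)
        ⟨f y, V y⟩).2) x

variable [FiniteDimensional ℝ E] [FiniteDimensional ℝ E']
  [RiemannianBundle (fun x : M ↦ TangentSpace I x)]
  [RiemannianBundle (fun x : M' ↦ TangentSpace I' x)]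

instance instFiniteDimensionalTangentSpace (x : M) : FiniteDimensional ℝ (TangentSpace I x) :=
  inferInstanceAs (FiniteDimensional ℝ E)

instance instCompleteSpaceTangentSpace (x : M) : CompleteSpace (TangentSpace I x) :=
  FiniteDimensional.complete ℝ _

variable (I I') in
/-- `f` is a smooth isometric immersion. -/
structure IsIsometricImmersion (f : M → M') : Prop where
  smooth : ContMDiff I I' ∞ f
  inner_map : ∀ x (u v : TangentSpace I x),
    inner ℝ (mfderiv I I' f x u) (mfderiv I I' f x v) = inner ℝ u v

variable (I I') in
/-- `N` is a smooth unit normal vector field along `f : M → M'`. -/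
structure IsUnitNormal (f : M → M') (N : ∀ x : M, TangentSpace I' (f x)) : Prop where
  smooth : ContMDiff I I'.tangent ∞ (fun x ↦ (⟨f x, N x⟩ : TangentBundle I' M'))
  norm_eq : ∀ x, ‖N x‖ = 1
  orthogonal : ∀ x (u : TangentSpace I x), inner ℝ (mfderiv I I' f x u) (N x) = 0

variable (I I') in
/-- The tangential part `T_{f x} M' → T_x M`: the adjoint of `df`. For an isometric immersion
it is the orthogonal projection onto `df (T_x M)` followed by the inverse of `df`. -/
def tangentialPart (f : M → M') (x : M) :
    TangentSpace I' (f x) →L[ℝ] TangentSpace I x :=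
  ContinuousLinearMap.adjoint (mfderiv I I' f x)

variable (I) in
/-- The shape operator `S`, determined by the Weingarten formula `∇'_X N = -S X`. -/
def shapeOperator (D : CovariantDerivative I' E' (TangentSpace I' : M' → Type _)) (f : M → M')
    (N : ∀ x : M, TangentSpace I' (f x)) (x : M) : TangentSpace I x →L[ℝ] TangentSpace I x :=
  -(tangentialPart I I' f x ∘L covAlong D f N x)

variable (I) in
/-- The vector field `ξ = -J N` on the hypersurface. -/
def reebField (J : ∀ x : M', TangentSpace I' x →L[ℝ] TangentSpace I' x) (f : M → M')
    (N : ∀ x : M, TangentSpace I' (f x)) (x : M) : TangentSpace I x :=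
  tangentialPart I I' f x (-(J (f x) (N x)))

variable (I) in
/-- `φ₁ = J - η ⊗ N`, where `η` is dual to `ξ`. -/
def phiOne (J : ∀ x : M', TangentSpace I' x →L[ℝ] TangentSpace I' x) (f : M → M')
    (N : ∀ x : M, TangentSpace I' (f x)) (x : M) : TangentSpace I x →L[ℝ] TangentSpace I x :=
  tangentialPart I I' f x ∘L
    (J (f x) ∘L mfderiv I I' f x - (dualForm (reebField I J f N) x).smulRight (N x))

variable [IsContMDiffRiemannianBundle I' ∞ E' (fun x : M' ↦ TangentSpace I' x)]

variable (I) in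
/-- `φ₂ = ξ ⌟ G`, that is, `φ₂ X = G(ξ, X)`, where `G = ∇J`. -/
def phiTwo (D : CovariantDerivative I' E' (TangentSpace I' : M' → Type _))
    {J : ∀ x : M', TangentSpace I' x →L[ℝ] TangentSpace I' x} (hJ : IsAlmostHermitian J)
    (f : M → M') (N : ∀ x : M, TangentSpace I' (f x)) (x : M) :
    TangentSpace I x →L[ℝ] TangentSpace I x :=
  tangentialPart I I' f x ∘L
    nablaJ D hJ (f x) (mfderiv I I' f x (reebField I J f N x)) ∘L mfderiv I I' f x

variable (I) in
/-- `φ₃ = N ⌟ G`, that is, `φ₃ X = G(N, X)`, where `G = ∇J`. -/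
def phiThree (D : CovariantDerivative I' E' (TangentSpace I' : M' → Type _))
    {J : ∀ x : M', TangentSpace I' x →L[ℝ] TangentSpace I' x} (hJ : IsAlmostHermitian J)
    (f : M → M') (N : ∀ x : M, TangentSpace I' (f x)) (x : M) :
    TangentSpace I x →L[ℝ] TangentSpace I x :=
  tangentialPart I I' f x ∘L nablaJ D hJ (f x) (N x) ∘L mfderiv I I' f x

end Hypersurfaces

end

/-!
The proof reduces everything to equations on the hypersurface `M` and then uses that an exact
two-form is closed.

*The ambient tensor `G`.* At each point `J` and `G = ∇J` satisfy the algebra recorded in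
`IsNearlyKahlerAlgebra`. In dimension six this determines `G` on the orthogonal complement of a
complex line, and it determines `∇G`: differentiating the algebraic identities of `G`, and the
equation `d(dω) = 0` for the fundamental form `ω` (`dω = 3 g(G(·, ·), ·)`), leave room for only one
tensor (`IsNearlyKahlerAlgebra.deriv_eq`, `covDerivBilin_nablaJ`).

*The hypersurface.* With the Gauss and Weingarten formulas this gives the structure equations
(`IsNearlyKahlerHypersurface`): on the complement of `ξ` the three tensors `φ₁`, `φ₂`, `φ₃` multiply
like imaginary quaternions, `∇_u ξ = φ₃ u + φ₁ (S u)`, and `∇φ₁`, `∇φ₂`, `∇φ₃` are explicit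
expressions in `S`. The ambient manifold is not needed any further.

*Pointwise consequences.* Let `φ = a φ₁ + b φ₂ + c φ₃` be nearly Sasakian (`ε = 1`) or nearly
cosymplectic (`ε = 0`). Comparing quaternionic components, and using that `S` is symmetric, one
finds that `S` acts as `σ` on `ξ^⊥` and as `μ` on `ξ`, that `a σ = ε - c`, and that `da = 0`,
`db = c (μ - σ) η`, `dc = -b (μ - σ) η` (`IsContactTriple.shape_of_nearly`). In the Sasakian and
co-Kähler cases two more components of the equation give `a = c σ` and `b = 0`, which leaves
`σ = 0`, `c = 1`, `μ = 0` in the former case and nothing in the latter.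

*Closedness.* The two-form `g(∇ξ · , ·) = g((φ₃ + σ φ₁) · , ·)` is half of `dη`, hence closed. By
the structure equations its exterior derivative is the cyclic sum of
`(σ - μ) η ⊗ g(φ₂ · , ·) + dσ ⊗ g(φ₁ · , ·)`, so that `μ = σ` and `dσ = 0`
(`IsNearlyKahlerHypersurface.eigenvalue_eq_and_mvfderiv_eq_zero`). Thus `S = σ Id` with `σ`, `a`,
`b`, `c` locally constant, which is more than the four families ask for: in the family with `a` and
`c` nowhere zero the coefficient `ξ(b) / c` vanishes, and the family with `S - σ Id` a multiple of
`η ⊗ ξ` and `φ = φ₁` is contained in the family `φ = cos t φ₁ + sin t φ₂`. The classification is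
then the discussion of `a σ = ε - c`, `a² + b² + c² = 1`.
-/

noncomputable section

set_option linter.unusedSectionVars false

/-! ### Commutators of vector fields acting on functions -/

section Commutator

open Set VectorField Topology

variable {E : Type*} [NormedAddCommGroup E] [NormedSpace ℝ E]
  {H : Type*} [TopologicalSpace H] {I : ModelWithCorners ℝ E H}
  {M : Type*} [TopologicalSpace M] [ChartedSpace H M]
  {F : Type*} [NormedAddCommGroup F] [NormedSpace ℝ F]

/-- The coordinate expression, in the chart at `x`, of a vector field. -/
def chartField (x : M) (Y : ∀ y : M, TangentSpace I y) (z : E) : E :=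
  mpullbackWithin 𝓘(ℝ, E) I (extChartAt I x).symm Y (range I) z

theorem mvfderiv_eq_fderiv (g : E → F) (z w : E) :
    mvfderiv 𝓘(ℝ, E) g z w = fderiv ℝ g z w := by
  change (mfderiv 𝓘(ℝ, E) 𝓘(ℝ, F) g z) w = _
  rw [mfderiv_eq_fderiv]
  rfl

theorem mvfderiv_comp_apply_eq {E' : Type*} [NormedAddCommGroup E'] [NormedSpace ℝ E']
    {H' : Type*} [TopologicalSpace H'] {I' : ModelWithCorners ℝ E' H'}
    {M' : Type*} [TopologicalSpace M'] [ChartedSpace H' M'] {f : M → M'} {g : M' → F} {x : M}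
    {y : M'} (hg : MDifferentiableAt I' 𝓘(ℝ, F) g y) (hf : MDifferentiableAt I I' f x)
    (hy : f x = y) (v : TangentSpace I x) :
    mvfderiv I (g ∘ f) x v = mvfderiv I' g (f x) (mfderiv I I' f x v) := by
  subst hy
  change (mfderiv I 𝓘(ℝ, F) (g ∘ f) x) v = (mfderiv I' 𝓘(ℝ, F) g (f x)) (mfderiv I I' f x v)
  rw [mfderiv_comp x hg hf]
  rfl

theorem mvfderiv_congr {g h : M → F} {x : M} (hgh : g =ᶠ[𝓝 x] h) :
    mvfderiv I g x = mvfderiv I h x := by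
  ext v
  change (mfderiv I 𝓘(ℝ, F) g x) v = (mfderiv I 𝓘(ℝ, F) h x) v
  have := hgh.mfderiv_eq (I := I) (I' := 𝓘(ℝ, F))
  exact congrArg (fun L : E →L[ℝ] F ↦ L v) this

variable [I.Boundaryless] [IsManifold I ∞ M]

/-- The derivative of `g` along `Y`, read in the chart at `x`. -/
theorem mvfderiv_apply_eventuallyEq_chart {g : M → F} {x : M}
    (hg : ContMDiffAt I 𝓘(ℝ, F) 2 g x) (Y : ∀ y : M, TangentSpace I y) :
    (fun y ↦ mvfderiv I g y (Y y)) =ᶠ[𝓝 x]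
      (fun z ↦ fderiv ℝ (g ∘ (extChartAt I x).symm) z (chartField x Y z)) ∘ extChartAt I x := by
  have : IsManifold I 2 M := IsManifold.of_le (n := ∞) (by norm_cast)
  have h1 : ∀ᶠ y in 𝓝 x, ContMDiffAt I 𝓘(ℝ, F) 2 g y :=
    (contMDiffAt_iff_contMDiffAt_nhds (by simp)).1 hg
  filter_upwards [h1, (isOpen_extChartAt_source (I := I) x).mem_nhds (mem_extChartAt_source x)]
    with y hy hys
  have hyt := (extChartAt I x).map_source hys
  have hinv := (extChartAt I x).left_inv hys
  have hsd : MDifferentiableAt 𝓘(ℝ, E) I (extChartAt I x).symm (extChartAt I x y) := by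
    have := mdifferentiableWithinAt_extChartAt_symm (I := I) hyt
    rwa [I.range_eq_univ, mdifferentiableWithinAt_univ] at this
  have hi := isInvertible_mfderivWithin_extChartAt_symm (I := I) hyt
  rw [I.range_eq_univ, mfderivWithin_univ] at hi
  obtain ⟨e, he⟩ := hi
  have h2 := fun w : E ↦ mvfderiv_comp_apply_eq (E := E) (I := 𝓘(ℝ, E)) (I' := I)
    (hy.mdifferentiableAt (by simp)) hsd hinv w
  have h3 : ∀ w : E, (mfderiv 𝓘(ℝ, E) I (extChartAt I x).symm (extChartAt I x y)).inverse
      (Y ((extChartAt I x).symm (extChartAt I x y))) = w →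
      mfderiv 𝓘(ℝ, E) I (extChartAt I x).symm (extChartAt I x y) w =
        Y ((extChartAt I x).symm (extChartAt I x y)) := by
    intro w hw
    rw [← hw, ← he, ContinuousLinearMap.inverse_equiv]
    exact e.apply_symm_apply _
  have h4 := h3 (chartField x Y (extChartAt I x y)) (by
    unfold chartField
    rw [mpullbackWithin_apply, I.range_eq_univ, mfderivWithin_univ])
  rw [Function.comp_apply, ← mvfderiv_eq_fderiv]
  refine Eq.trans ?_ (h2 _).symm
  rw [h4, hinv]

omit [I.Boundaryless] in
theorem chartField_self (x : M) (Z : ∀ y : M, TangentSpace I y) :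
    chartField x Z (extChartAt I x x) = Z x := by
  unfold chartField
  rw [mpullbackWithin_apply]
  refine (mfderivWithin_extChartAt_symm_inverse_apply (I := I) (x := x) _).trans ?_
  rw [extChartAt_to_inv]

variable [CompleteSpace E]

theorem differentiableAt_chartField {x : M} {Z : ∀ y : M, TangentSpace I y}
    (hZ : MDifferentiableAt I I.tangent (fun y ↦ (⟨y, Z y⟩ : TangentBundle I M)) x) :
    DifferentiableAt ℝ (chartField x Z) (extChartAt I x x) := by
  have : IsManifold I 2 M := IsManifold.of_le (n := ∞) (by norm_cast)
  have := MDifferentiableWithinAt.differentiableWithinAt_mpullbackWithin_vectorField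
    (mdifferentiableWithinAt_univ.2 hZ)
  rw [preimage_univ, univ_inter] at this
  exact this.differentiableAt (by simp [I.range_eq_univ])

/-- The Lie bracket is the commutator of derivations: `X (Y g) - Y (X g) = [X, Y] g`. -/
theorem mvfderiv_mvfderiv_sub {g : M → F} {x : M}
    (hg : ContMDiffAt I 𝓘(ℝ, F) 2 g x) {X Y : ∀ y : M, TangentSpace I y}
    (hX : MDifferentiableAt I I.tangent (fun y ↦ (⟨y, X y⟩ : TangentBundle I M)) x)
    (hY : MDifferentiableAt I I.tangent (fun y ↦ (⟨y, Y y⟩ : TangentBundle I M)) x) :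
    mvfderiv I (fun y ↦ mvfderiv I g y (Y y)) x (X x) -
      mvfderiv I (fun y ↦ mvfderiv I g y (X y)) x (Y x) =
        mvfderiv I g x (mlieBracket I X Y x) := by
  have : IsManifold I 2 M := IsManifold.of_le (n := ∞) (by norm_cast)
  set φ := extChartAt I x with hφ
  set G := g ∘ φ.symm with hG
  have hGc : ContDiffAt ℝ 2 G (φ x) := by
    have := (contMDiffAt_iff.1 hg).2
    rw [I.range_eq_univ, contDiffWithinAt_univ] at this
    exact this
  have hG1 : DifferentiableAt ℝ (fderiv ℝ G) (φ x) :=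
    (hGc.fderiv_right (m := 1) (by norm_num)).differentiableAt (by simp)
  have hφd : MDifferentiableAt I 𝓘(ℝ, E) φ x := mdifferentiableAt_extChartAt (by simp)
  have hφi : ∀ v : TangentSpace I x, mfderiv I 𝓘(ℝ, E) φ x v = (v : E) := by
    intro v; rw [mfderiv_extChartAt_self]; rfl
  -- the derivative in the direction `w` of the derivative along `Z`, in the chart
  have second : ∀ {Z : ∀ y : M, TangentSpace I y} (w : E),
      MDifferentiableAt I I.tangent (fun y ↦ (⟨y, Z y⟩ : TangentBundle I M)) x →
      mvfderiv I (fun y ↦ mvfderiv I g y (Z y)) x w =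
        fderiv ℝ (fderiv ℝ G) (φ x) w (chartField x Z (φ x)) +
        fderiv ℝ G (φ x) (fderiv ℝ (chartField x Z) (φ x) w) := by
    intro Z w hZ
    have hZ' := differentiableAt_chartField hZ
    have hd : DifferentiableAt ℝ (fun z ↦ fderiv ℝ G z (chartField x Z z)) (φ x) :=
      hG1.clm_apply hZ'
    rw [mvfderiv_congr (mvfderiv_apply_eventuallyEq_chart hg Z)]
    refine (mvfderiv_comp_apply_eq (I' := 𝓘(ℝ, E)) hd.mdifferentiableAt hφd rfl _).trans ?_
    have := mvfderiv_eq_fderiv (fun z ↦ fderiv ℝ G z (chartField x Z z)) (φ x)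
      (mfderiv I 𝓘(ℝ, E) φ x w)
    refine this.trans ?_
    have h : (mfderiv I 𝓘(ℝ, E) φ x w : E) = w := hφi w
    have h' := congrArg (fun L : E →L[ℝ] F ↦ L w) (fderiv_clm_apply hG1 hZ')
    refine (congrArg (fderiv ℝ (fun z ↦ fderiv ℝ G z (chartField x Z z)) (φ x)) h).trans ?_
    exact h'.trans (add_comm _ _)
  have hsymm := hGc.isSymmSndFDerivAt (by simp) (X x) (Y x)
  have hbr : mlieBracket I X Y x =
      fderiv ℝ (chartField x Y) (φ x) (chartField x X (φ x)) -
      fderiv ℝ (chartField x X) (φ x) (chartField x Y (φ x)) := by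
    have h1 : lieBracketWithin ℝ (mpullbackWithin 𝓘(ℝ, E) I (extChartAt I x).symm X (range I))
        (mpullbackWithin 𝓘(ℝ, E) I (extChartAt I x).symm Y (range I)) (range I) =
          lieBracket ℝ (chartField x X) (chartField x Y) :=
      (congrArg (lieBracketWithin ℝ (chartField x X) (chartField x Y)) I.range_eq_univ).trans
        lieBracketWithin_univ
    unfold mlieBracket
    rw [mlieBracketWithin_apply, preimage_univ, univ_inter, h1]
    have : ∀ v : E, (mfderiv I 𝓘(ℝ, E) φ x).inverse v = v := by
      intro v
      rw [hφ, mfderiv_extChartAt_self]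
      exact congrArg (fun L : E →L[ℝ] E ↦ L v) ContinuousLinearMap.inverse_id
    exact this _
  have hlast : ∀ v : TangentSpace I x, mvfderiv I g x v = fderiv ℝ G (φ x) v := by
    intro v
    have := (mvfderiv_apply_eventuallyEq_chart hg (extend E v)).eq_of_nhds
    rw [Function.comp_apply, chartField_self, extend_apply_self] at this
    exact this
  rw [second (X x) hY, second (Y x) hX, hlast, hbr, chartField_self, chartField_self]
  have e := map_sub (fderiv ℝ G (φ x)) (fderiv ℝ (chartField x Y) (φ x) (X x))
    (fderiv ℝ (chartField x X) (φ x) (Y x))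
  refine Eq.trans ?_ e.symm
  have hs : fderiv ℝ (fderiv ℝ G) (φ x) (X x) (Y x) = fderiv ℝ (fderiv ℝ G) (φ x) (Y x) (X x) :=
    hsymm
  rw [hs]
  abel

end Commutator

/-! ### Coordinate fields -/

section CoordinateFields

open Set VectorField Topology

variable {E : Type*} [NormedAddCommGroup E] [NormedSpace ℝ E]
  {H : Type*} [TopologicalSpace H] {I : ModelWithCorners ℝ E H}
  {M : Type*} [TopologicalSpace M] [ChartedSpace H M] [IsManifold I ∞ M]
  {F : Type*} [NormedAddCommGroup F] [NormedSpace ℝ F]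

/-- The coordinates of a tangent vector in the trivialization at `x` are the derivative of the
chart at `x`. -/
theorem trivializationAt_snd_eq_mvfderiv {x y : M} (hy : y ∈ (chartAt H x).source)
    (v : TangentSpace I y) :
    (trivializationAt E (fun y : M ↦ TangentSpace I y) x ⟨y, v⟩).2 =
      mvfderiv I (extChartAt I x) y v := by
  have h := TangentBundle.continuousLinearMapAt_trivializationAt (I := I) (𝕜 := ℝ) hy
  have h2 := congrArg (fun L : E →L[ℝ] E ↦ L v) h
  refine Eq.trans ?_ h2
  exact (Trivialization.continuousLinearMapAt_apply_of_mem ℝ _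
    (by simpa using hy) v).symm

theorem trivializationAt_snd_extend {x y : M} (hy : y ∈ (chartAt H x).source)
    (v : TangentSpace I x) :
    (trivializationAt E (fun y : M ↦ TangentSpace I y) x ⟨y, extend E v y⟩).2 =
      (trivializationAt E (fun y : M ↦ TangentSpace I y) x ⟨x, v⟩).2 := by
  have hy' : y ∈ (trivializationAt E (fun y : M ↦ TangentSpace I y) x).baseSet := by simpa using hy
  simp [extend, Trivialization.apply_mk_symm _ hy']

theorem extend_add {x y : M} (hy : y ∈ (chartAt H x).source) (v w : TangentSpace I x) :
    extend E (v + w) y = extend E v y + extend E w y := by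
  set t := trivializationAt E (fun y : M ↦ TangentSpace I y) x with ht
  have hx : x ∈ t.baseSet := mem_baseSet_trivializationAt' x
  have hy' : y ∈ t.baseSet := by simpa [ht] using hy
  simp only [extend, ← ht]
  have h := map_add (t.continuousLinearMapAt ℝ x) v w
  simp only [Trivialization.continuousLinearMapAt_apply_of_mem ℝ t hx] at h
  rw [h]
  have h2 := map_add (t.symmₗ ℝ y) (t ⟨x, v⟩).2 (t ⟨x, w⟩).2
  rwa [Trivialization.coe_symmₗ _ hy'] at h2

theorem extend_smul {x y : M} (hy : y ∈ (chartAt H x).source) (r : ℝ) (v : TangentSpace I x) :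
    extend E (r • v) y = r • extend E v y := by
  set t := trivializationAt E (fun y : M ↦ TangentSpace I y) x with ht
  have hx : x ∈ t.baseSet := mem_baseSet_trivializationAt' x
  have hy' : y ∈ t.baseSet := by simpa [ht] using hy
  simp only [extend, ← ht]
  have h := map_smul (t.continuousLinearMapAt ℝ x) r v
  simp only [Trivialization.continuousLinearMapAt_apply_of_mem ℝ t hx] at h
  rw [h]
  have h2 := map_smul (t.symmₗ ℝ y) r (t ⟨x, v⟩).2
  rwa [Trivialization.coe_symmₗ _ hy'] at h2

theorem eventually_mdifferentiableAt_extend (x : M) (v : TangentSpace I x) :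
    ∀ᶠ y in 𝓝 x, MDifferentiableAt I I.tangent
      (fun y ↦ (⟨y, extend E v y⟩ : TangentBundle I M)) y := by
  obtain ⟨s, hs, h⟩ := exists_contMDiffOn_extend (k := 1) I E v
  filter_upwards [eventually_mem_nhds_iff.2 hs] with y hy
  exact (h.contMDiffAt hy).mdifferentiableAt (by simp)

/-- A tangent vector extends to a globally smooth vector field, which is a coordinate field
near the base point. -/
theorem exists_isSmoothVectorField_eventuallyEq [FiniteDimensional ℝ E] [T2Space M] {x : M}
    (v : TangentSpace I x) :
    ∃ X : ∀ y : M, TangentSpace I y, IsSmoothVectorField X ∧ ∀ᶠ y in 𝓝 x, X y = extend E v y := by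
  obtain ⟨s, hs, h⟩ := exists_contMDiffOn_extend (k := ∞) I E v
  obtain ⟨u, hus, hu, hxu⟩ := mem_nhds_iff.1 hs
  obtain ⟨f, -, hf⟩ := (SmoothBumpFunction.nhds_basis_tsupport (I := I) x).mem_iff.1
    (hu.mem_nhds hxu)
  refine ⟨fun y ↦ f y • extend E v y, ?_, ?_⟩
  · exact ContMDiffOn.smul_section_of_tsupport (f.contMDiff.contMDiffOn (s := u)) hu hf
      (h.mono hus)
  · filter_upwards [f.eventuallyEq_one] with y hy
    simp [hy]

theorem exists_isSmoothVectorField_apply_eq [FiniteDimensional ℝ E] [T2Space M] {x : M}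
    (v : TangentSpace I x) :
    ∃ X : ∀ y : M, TangentSpace I y, IsSmoothVectorField X ∧ X x = v := by
  obtain ⟨X, hX, h⟩ := exists_isSmoothVectorField_eventuallyEq v
  exact ⟨X, hX, by rw [h.self_of_nhds, extend_apply_self]⟩

theorem IsSmoothVectorField.mdifferentiableAt {X : ∀ y : M, TangentSpace I y}
    (hX : IsSmoothVectorField X) (x : M) :
    MDifferentiableAt I I.tangent (fun y ↦ (⟨y, X y⟩ : TangentBundle I M)) x :=
  (hX x).mdifferentiableAt (by simp)

variable [I.Boundaryless] [CompleteSpace E]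

/-- Coordinate fields commute. -/
theorem eventually_mlieBracket_extend (x : M) (v w : TangentSpace I x) :
    ∀ᶠ y in 𝓝 x, mlieBracket I (extend E v) (extend E w) y = 0 := by
  have hsrc : ∀ᶠ y in 𝓝 x, y ∈ (chartAt H x).source := chart_source_mem_nhds H x
  have hc : ∀ u : TangentSpace I x, ∀ᶠ y in 𝓝 x,
      mvfderiv I (extChartAt I x) y (extend E u y) = mvfderiv I (extChartAt I x) x u := by
    intro u
    filter_upwards [hsrc] with y hy
    rw [← trivializationAt_snd_eq_mvfderiv hy, trivializationAt_snd_extend hy,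
      trivializationAt_snd_eq_mvfderiv (mem_chart_source H x)]
  filter_upwards [(hc v).eventually_nhds, (hc w).eventually_nhds, hsrc,
    eventually_mdifferentiableAt_extend x v, eventually_mdifferentiableAt_extend x w]
    with y hv hw hy hvd hwd
  have hg : ContMDiffAt I 𝓘(ℝ, E) 2 (extChartAt I x) y :=
    (contMDiffAt_extChartAt' (n := ∞) hy).of_le (by norm_cast)
  have h := mvfderiv_mvfderiv_sub hg hvd hwd
  have hconst : ∀ (e : E) (u : TangentSpace I y), mvfderiv I (fun _ : M ↦ e) y u = 0 := by
    intro e u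
    have := mvfderiv_const (I := I) e (x := y)
    rw [this]; rfl
  rw [mvfderiv_congr hv, mvfderiv_congr hw, hconst, hconst, sub_zero] at h
  -- the coordinate functions have constant derivatives along both fields, so the bracket kills them
  have hinj : Function.Injective (mfderiv I 𝓘(ℝ, E) (extChartAt I x) y) := by
    obtain ⟨e, he⟩ := isInvertible_mfderiv_extChartAt (I := I) (x := x) (y := y)
      (by simpa using hy)
    rw [← he]
    exact e.injective
  apply hinj
  rw [map_zero]
  exact h.symm

variable [FiniteDimensional ℝ E]
  [RiemannianBundle (fun x : M ↦ TangentSpace I x)]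
  [IsContMDiffRiemannianBundle I ∞ E (fun x : M ↦ TangentSpace I x)]
  {D : CovariantDerivative I E (TangentSpace I : M → Type _)}

omit [I.Boundaryless] in
theorem IsLeviCivita.sub_eq_mlieBracket (hD : IsLeviCivita D) {X Y : ∀ y : M, TangentSpace I y}
    {x : M} (hX : MDifferentiableAt I I.tangent (fun y ↦ (⟨y, X y⟩ : TangentBundle I M)) x)
    (hY : MDifferentiableAt I I.tangent (fun y ↦ (⟨y, Y y⟩ : TangentBundle I M)) x) :
    D Y x (X x) - D X x (Y x) = mlieBracket I X Y x := by
  have : IsManifold I 2 M := IsManifold.of_le (n := ∞) (by norm_cast)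
  exact D.torsion_eq_zero_iff.1 hD.torsion_free hX hY

/-- The Christoffel symbols of the Levi-Civita connection are symmetric. -/
theorem IsLeviCivita.eventually_extend_comm (hD : IsLeviCivita D) (x : M)
    (v w : TangentSpace I x) :
    ∀ᶠ y in 𝓝 x, D (extend E w) y (extend E v y) = D (extend E v) y (extend E w y) := by
  filter_upwards [eventually_mlieBracket_extend x v w, eventually_mdifferentiableAt_extend x v,
    eventually_mdifferentiableAt_extend x w] with y h hv hw
  have := hD.sub_eq_mlieBracket hv hw
  rw [h] at this
  exact sub_eq_zero.1 this

omit [I.Boundaryless] [CompleteSpace E] in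
theorem IsLeviCivita.mvfderiv_inner (hD : IsLeviCivita D) {X Y : ∀ y : M, TangentSpace I y}
    {x : M} (hX : MDifferentiableAt I I.tangent (fun y ↦ (⟨y, X y⟩ : TangentBundle I M)) x)
    (hY : MDifferentiableAt I I.tangent (fun y ↦ (⟨y, Y y⟩ : TangentBundle I M)) x)
    (u : TangentSpace I x) :
    mvfderiv I (fun y ↦ (inner ℝ (X y) (Y y) : ℝ)) x u =
      inner ℝ (D X x u) (Y x) + inner ℝ (X x) (D Y x u) := by
  have h := CovariantDerivative.IsMetricCompatible.mvfderiv_inner_eq hD.metric (extend E u) hX hY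
  simpa using h

end CoordinateFields

/-! ### Vector fields along a map -/

section Along

open Set VectorField Topology

variable {E : Type*} [NormedAddCommGroup E] [NormedSpace ℝ E]
  {H : Type*} [TopologicalSpace H] {I : ModelWithCorners ℝ E H}
  {M : Type*} [TopologicalSpace M] [ChartedSpace H M]
  {E' : Type*} [NormedAddCommGroup E'] [NormedSpace ℝ E']
  {H' : Type*} [TopologicalSpace H'] {I' : ModelWithCorners ℝ E' H'}
  {M' : Type*} [TopologicalSpace M'] [ChartedSpace H' M'] [IsManifold I' ∞ M']
  {f : M → M'} {x : M}

variable (I I') in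
/-- The vector field `V` along `f` is differentiable at `x`. -/
def MDiffAlongAt (f : M → M') (V : ∀ y : M, TangentSpace I' (f y)) (x : M) : Prop :=
  MDifferentiableAt I I'.tangent (fun y ↦ (⟨f y, V y⟩ : TangentBundle I' M')) x

theorem trivializationAt_snd_add {p z : M'} (hz : z ∈ (chartAt H' p).source)
    (v w : TangentSpace I' z) :
    (trivializationAt E' (fun y : M' ↦ TangentSpace I' y) p ⟨z, v + w⟩).2 =
      (trivializationAt E' (fun y : M' ↦ TangentSpace I' y) p ⟨z, v⟩).2 +
      (trivializationAt E' (fun y : M' ↦ TangentSpace I' y) p ⟨z, w⟩).2 := by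
  have hz' : z ∈ (trivializationAt E' (fun y : M' ↦ TangentSpace I' y) p).baseSet := by
    simpa using hz
  have h := map_add
    ((trivializationAt E' (fun y : M' ↦ TangentSpace I' y) p).continuousLinearMapAt ℝ z) v w
  simpa only [Trivialization.continuousLinearMapAt_apply_of_mem ℝ _ hz'] using h

theorem trivializationAt_snd_smul {p z : M'} (hz : z ∈ (chartAt H' p).source) (r : ℝ)
    (v : TangentSpace I' z) :
    (trivializationAt E' (fun y : M' ↦ TangentSpace I' y) p ⟨z, r • v⟩).2 =
      r • (trivializationAt E' (fun y : M' ↦ TangentSpace I' y) p ⟨z, v⟩).2 := by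
  have hz' : z ∈ (trivializationAt E' (fun y : M' ↦ TangentSpace I' y) p).baseSet := by
    simpa using hz
  have h := map_smul
    ((trivializationAt E' (fun y : M' ↦ TangentSpace I' y) p).continuousLinearMapAt ℝ z) r v
  simpa only [Trivialization.continuousLinearMapAt_apply_of_mem ℝ _ hz'] using h

theorem symmL_trivializationAt_snd {p z : M'} (hz : z ∈ (chartAt H' p).source)
    (v : TangentSpace I' z) :
    (trivializationAt E' (fun y : M' ↦ TangentSpace I' y) p).symmL ℝ z
      (trivializationAt E' (fun y : M' ↦ TangentSpace I' y) p ⟨z, v⟩).2 = v := by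
  have hz' : z ∈ (trivializationAt E' (fun y : M' ↦ TangentSpace I' y) p).baseSet := by
    simpa using hz
  have h := (trivializationAt E' (fun y : M' ↦ TangentSpace I' y) p).symmL_continuousLinearMapAt
    (R := ℝ) hz' v
  rwa [Trivialization.continuousLinearMapAt_apply_of_mem ℝ _ hz'] at h

theorem mdiffAlongAt_iff {V : ∀ y : M, TangentSpace I' (f y)} :
    MDiffAlongAt I I' f V x ↔ MDifferentiableAt I I' f x ∧
      MDifferentiableAt I 𝓘(ℝ, E')
        (fun y ↦ (trivializationAt E' (fun y : M' ↦ TangentSpace I' y) (f x) ⟨f y, V y⟩).2) x :=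
  mdifferentiableAt_totalSpace I' _

omit [IsManifold I' ∞ M'] in
theorem eventually_mem_chart_source (hf : MDifferentiableAt I I' f x) :
    ∀ᶠ y in 𝓝 x, f y ∈ (chartAt H' (f x)).source :=
  hf.continuousAt.eventually (chart_source_mem_nhds H' (f x))

theorem MDiffAlongAt.add {V W : ∀ y : M, TangentSpace I' (f y)} (hV : MDiffAlongAt I I' f V x)
    (hW : MDiffAlongAt I I' f W x) : MDiffAlongAt I I' f (fun y ↦ V y + W y) x := by
  rw [mdiffAlongAt_iff] at hV hW ⊢
  refine ⟨hV.1, (hV.2.add hW.2).congr_of_eventuallyEq ?_⟩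
  filter_upwards [eventually_mem_chart_source hV.1] with y hy
  exact trivializationAt_snd_add hy _ _

theorem MDiffAlongAt.smul {g : M → ℝ} {V : ∀ y : M, TangentSpace I' (f y)}
    (hg : MDifferentiableAt I 𝓘(ℝ, ℝ) g x)
    (hV : MDiffAlongAt I I' f V x) : MDiffAlongAt I I' f (fun y ↦ g y • V y) x := by
  rw [mdiffAlongAt_iff] at hV ⊢
  refine ⟨hV.1, (hg.smul hV.2).congr_of_eventuallyEq ?_⟩
  filter_upwards [eventually_mem_chart_source hV.1] with y hy
  exact trivializationAt_snd_smul hy _ _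

theorem MDiffAlongAt.of_comp {Z : ∀ z : M', TangentSpace I' z}
    (hf : MDifferentiableAt I I' f x)
    (hZ : MDifferentiableAt I' I'.tangent (fun z ↦ (⟨z, Z z⟩ : TangentBundle I' M')) (f x)) :
    MDiffAlongAt I I' f (fun y ↦ Z (f y)) x :=
  MDifferentiableAt.comp x hZ hf

/-- Every differentiable vector field along `f` is, near `x`, a combination with differentiable
coefficients of restrictions to `f` of vector fields on the target. -/
theorem MDiffAlongAt.induction [FiniteDimensional ℝ E']
    {P : (∀ y : M, TangentSpace I' (f y)) → Prop}
    (congr : ∀ V W : ∀ y : M, TangentSpace I' (f y), MDiffAlongAt I I' f V x →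
      (∀ᶠ y in 𝓝 x, V y = W y) → P V → P W)
    (add : ∀ V W : ∀ y : M, TangentSpace I' (f y), MDiffAlongAt I I' f V x →
      MDiffAlongAt I I' f W x → P V → P W → P (fun y ↦ V y + W y))
    (smul : ∀ (g : M → ℝ) (V : ∀ y : M, TangentSpace I' (f y)),
      MDifferentiableAt I 𝓘(ℝ, ℝ) g x → MDiffAlongAt I I' f V x → P V → P (fun y ↦ g y • V y))
    (restrict : ∀ Z : ∀ z : M', TangentSpace I' z,
      MDifferentiableAt I' I'.tangent (fun z ↦ (⟨z, Z z⟩ : TangentBundle I' M')) (f x) →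
      P (fun y ↦ Z (f y)))
    {V : ∀ y : M, TangentSpace I' (f y)} (hV : MDiffAlongAt I I' f V x) : P V := by
  classical
  have hV0 := hV
  rw [mdiffAlongAt_iff] at hV
  obtain ⟨hf, hW⟩ := hV
  let t := trivializationAt E' (fun y : M' ↦ TangentSpace I' y) (f x)
  let b := Module.finBasis ℝ E'
  let e : ∀ i, TangentSpace I' (f x) := fun i ↦ t.symmL ℝ (f x) (b i)
  let c : Fin (Module.finrank ℝ E') → M → ℝ := fun i y ↦ b.repr (t ⟨f y, V y⟩).2 i
  have hc : ∀ i, MDifferentiableAt I 𝓘(ℝ, ℝ) (c i) x := by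
    intro i
    have hl : MDifferentiableAt 𝓘(ℝ, E') 𝓘(ℝ, ℝ) (b.coord i).toContinuousLinearMap
        (t ⟨f x, V x⟩).2 := (b.coord i).toContinuousLinearMap.differentiableAt.mdifferentiableAt
    exact hl.comp x hW
  have hterm : ∀ i, MDiffAlongAt I I' f (fun y ↦ c i y • extend E' (e i) (f y)) x := fun i ↦
    (MDiffAlongAt.of_comp hf (mdifferentiableAt_extend I' E' (e i))).smul (hc i)
  have hzero : P (fun y ↦ (0 : TangentSpace I' (f y))) :=
    restrict (fun z ↦ 0) ((contMDiff_zeroSection ℝ (F := E') (E := fun y : M' ↦ TangentSpace I' y)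
      (IB := I') (n := ∞)).contMDiffAt.mdifferentiableAt (by simp))
  have hzd : MDiffAlongAt I I' f (fun y ↦ (0 : TangentSpace I' (f y))) x :=
    MDiffAlongAt.of_comp (Z := fun z ↦ 0) hf
      ((contMDiff_zeroSection ℝ (F := E') (E := fun y : M' ↦ TangentSpace I' y)
        (IB := I') (n := ∞)).contMDiffAt.mdifferentiableAt (by simp))
  have hsum : ∀ s : Finset (Fin (Module.finrank ℝ E')),
      MDiffAlongAt I I' f (fun y ↦ ∑ i ∈ s, c i y • extend E' (e i) (f y)) x ∧
        P (fun y ↦ ∑ i ∈ s, c i y • extend E' (e i) (f y)) := by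
    intro s
    induction s using Finset.induction_on with
    | empty => simpa using ⟨hzd, hzero⟩
    | insert i s hi ih =>
      simp only [Finset.sum_insert hi]
      exact ⟨(hterm i).add ih.1, add _ _ (hterm i) ih.1
        (smul _ _ (hc i) (MDiffAlongAt.of_comp hf (mdifferentiableAt_extend I' E' (e i)))
          (restrict _ (mdifferentiableAt_extend I' E' (e i)))) ih.2⟩
  refine congr _ _ (hsum Finset.univ).1 ?_ (hsum Finset.univ).2
  filter_upwards [eventually_mem_chart_source hf] with y hy
  have hx' : f x ∈ t.baseSet := mem_baseSet_trivializationAt' (f x)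
  have hy' : f y ∈ t.baseSet := by simpa [t] using hy
  have he : ∀ i, extend E' (e i) (f y) = t.symmL ℝ (f y) (b i) := by
    intro i
    simp only [extend, e]
    change t.symm (f y) (t ⟨f x, t.symmL ℝ (f x) (b i)⟩).2 = _
    rw [Trivialization.symmL_apply _ hx', Trivialization.apply_mk_symm _ hx',
      Trivialization.symmL_apply _ hy']
  simp only [he, ← map_smul, ← map_sum]
  rw [show ∑ i, c i y • b i = (t ⟨f y, V y⟩).2 from b.sum_repr _]
  exact symmL_trivializationAt_snd hy _

/-! ### The pull-back connection -/

variable [FiniteDimensional ℝ E'] (D : CovariantDerivative I' E' (TangentSpace I' : M' → Type _))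

omit [FiniteDimensional ℝ E'] in
theorem covAlong_congr {V W : ∀ y : M, TangentSpace I' (f y)} (h : ∀ᶠ y in 𝓝 x, V y = W y) :
    covAlong (I := I) D f V x = covAlong D f W x := by
  unfold covAlong
  rw [h.self_of_nhds]
  congr 2
  apply mvfderiv_congr
  filter_upwards [h] with y hy
  rw [hy]

omit [FiniteDimensional ℝ E'] in
theorem cov_extend_add (p : M') (v w : TangentSpace I' p) :
    D (extend E' (v + w)) p = D (extend E' v) p + D (extend E' w) p := by
  rw [← D.isCovariantDerivativeOn.add (mdifferentiableAt_extend I' E' v)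
    (mdifferentiableAt_extend I' E' w)]
  refine D.isCovariantDerivativeOnUniv.congr_of_eventuallyEq (mdifferentiableAt_extend I' E' _)
    (mdifferentiableAt_add_section (mdifferentiableAt_extend I' E' v)
      (mdifferentiableAt_extend I' E' w)) Filter.univ_mem ?_
  filter_upwards [chart_source_mem_nhds H' p] with y hy
  exact extend_add hy v w

omit [FiniteDimensional ℝ E'] in
theorem cov_extend_smul (p : M') (r : ℝ) (v : TangentSpace I' p) :
    D (extend E' (r • v)) p = r • D (extend E' v) p := by
  rw [← D.isCovariantDerivativeOn.smul_const r (mdifferentiableAt_extend I' E' v)]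
  refine D.isCovariantDerivativeOnUniv.congr_of_eventuallyEq (mdifferentiableAt_extend I' E' _)
    (mdifferentiableAt_const.smul_section (mdifferentiableAt_extend I' E' v)) Filter.univ_mem ?_
  filter_upwards [chart_source_mem_nhds H' p] with y hy
  exact extend_smul hy r v

omit [FiniteDimensional ℝ E'] in
theorem covAlong_add {V W : ∀ y : M, TangentSpace I' (f y)} (hV : MDiffAlongAt I I' f V x)
    (hW : MDiffAlongAt I I' f W x) :
    covAlong (I := I) D f (fun y ↦ V y + W y) x = covAlong D f V x + covAlong D f W x := by
  rw [mdiffAlongAt_iff] at hV hW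
  unfold covAlong
  have h : mvfderiv I (fun y ↦ (trivializationAt E' (fun y : M' ↦ TangentSpace I' y) (f x)
      ⟨f y, V y + W y⟩).2) x =
      mvfderiv I (fun y ↦ (trivializationAt E' (fun y : M' ↦ TangentSpace I' y) (f x)
        ⟨f y, V y⟩).2) x +
      mvfderiv I (fun y ↦ (trivializationAt E' (fun y : M' ↦ TangentSpace I' y) (f x)
        ⟨f y, W y⟩).2) x := by
    rw [← mvfderiv_add hV.2 hW.2]
    apply mvfderiv_congr
    filter_upwards [eventually_mem_chart_source hV.1] with y hy
    exact trivializationAt_snd_add hy _ _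
  rw [h, cov_extend_add]
  ext u
  simp
  abel

omit [FiniteDimensional ℝ E'] in
theorem covAlong_smul {g : M → ℝ} {V : ∀ y : M, TangentSpace I' (f y)}
    (hg : MDifferentiableAt I 𝓘(ℝ, ℝ) g x) (hV : MDiffAlongAt I I' f V x)
    (u : TangentSpace I x) :
    covAlong D f (fun y ↦ g y • V y) x u = g x • covAlong D f V x u + mvfderiv I g x u • V x := by
  rw [mdiffAlongAt_iff] at hV
  unfold covAlong
  have h : mvfderiv I (fun y ↦ (trivializationAt E' (fun y : M' ↦ TangentSpace I' y) (f x)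
      ⟨f y, g y • V y⟩).2) x =
      g x • mvfderiv I (fun y ↦ (trivializationAt E' (fun y : M' ↦ TangentSpace I' y) (f x)
        ⟨f y, V y⟩).2) x +
      (mvfderiv I g x).smulRight ((trivializationAt E' (fun y : M' ↦ TangentSpace I' y) (f x)
        ⟨f x, V x⟩).2) := by
    rw [← mvfderiv_smul hg hV.2]
    apply mvfderiv_congr
    filter_upwards [eventually_mem_chart_source hV.1] with y hy
    exact trivializationAt_snd_smul hy _ _
  rw [h, cov_extend_smul]
  have h2 := symmL_trivializationAt_snd (mem_chart_source H' (f x)) (V x)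
  simp only [add_apply, ContinuousLinearMap.comp_apply,
    smul_apply, ContinuousLinearMap.smulRight_apply, map_add, map_smul, h2]
  module

omit [FiniteDimensional ℝ E'] in
/-- The difference between `∇Z` and the derivative of the coordinates of `Z` is tensorial in `Z`. -/
theorem tensorialAt_cov_sub_mvfderiv (p : M') :
    TensorialAt I' E' (fun Z : ∀ z : M', TangentSpace I' z ↦ D Z p -
      (trivializationAt E' (fun y : M' ↦ TangentSpace I' y) p).symmL ℝ p ∘L
        mvfderiv I' (fun z ↦ (trivializationAt E' (fun y : M' ↦ TangentSpace I' y) p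
          ⟨z, Z z⟩).2) p) p where
  smul {g Z} hg hZ := by
    have h : mvfderiv I' (fun z ↦ (trivializationAt E' (fun y : M' ↦ TangentSpace I' y) p
        ⟨z, (g • Z) z⟩).2) p =
        g p • mvfderiv I' (fun z ↦ (trivializationAt E' (fun y : M' ↦ TangentSpace I' y) p
          ⟨z, Z z⟩).2) p +
        (mvfderiv I' g p).smulRight ((trivializationAt E' (fun y : M' ↦ TangentSpace I' y) p
          ⟨p, Z p⟩).2) := by
      rw [← mvfderiv_smul hg ((mdifferentiableAt_section I' Z).1 hZ)]
      apply mvfderiv_congr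
      filter_upwards [chart_source_mem_nhds H' p] with y hy
      exact trivializationAt_snd_smul hy _ _
    have h2 := symmL_trivializationAt_snd (mem_chart_source H' p) (Z p)
    rw [h, D.isCovariantDerivativeOn.leibniz hZ hg]
    ext u
    simp only [sub_apply, add_apply, ContinuousLinearMap.comp_apply,
      smul_apply, ContinuousLinearMap.smulRight_apply, map_add, map_smul, h2]
    module
  add {Z Z'} hZ hZ' := by
    have h : mvfderiv I' (fun z ↦ (trivializationAt E' (fun y : M' ↦ TangentSpace I' y) p
        ⟨z, (Z + Z') z⟩).2) p =
        mvfderiv I' (fun z ↦ (trivializationAt E' (fun y : M' ↦ TangentSpace I' y) p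
          ⟨z, Z z⟩).2) p +
        mvfderiv I' (fun z ↦ (trivializationAt E' (fun y : M' ↦ TangentSpace I' y) p
          ⟨z, Z' z⟩).2) p := by
      rw [← mvfderiv_add ((mdifferentiableAt_section I' Z).1 hZ)
        ((mdifferentiableAt_section I' Z').1 hZ')]
      apply mvfderiv_congr
      filter_upwards [chart_source_mem_nhds H' p] with y hy
      exact trivializationAt_snd_add hy _ _
    rw [h, D.isCovariantDerivativeOn.add hZ hZ']
    ext u
    simp only [sub_apply, add_apply, ContinuousLinearMap.comp_apply, map_add]
    abel

/-- On the restriction to `f` of a vector field on the target, the pull-back connection is the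
connection of the target, so that the local frame in the definition of `covAlong` is immaterial. -/
theorem covAlong_comp {Z : ∀ z : M', TangentSpace I' z} (hf : MDifferentiableAt I I' f x)
    (hZ : MDifferentiableAt I' I'.tangent (fun z ↦ (⟨z, Z z⟩ : TangentBundle I' M')) (f x))
    (u : TangentSpace I x) :
    covAlong D f (fun y ↦ Z (f y)) x u = D Z (f x) (mfderiv I I' f x u) := by
  have h := (tensorialAt_cov_sub_mvfderiv D (f x)).pointwise hZ
    (mdifferentiableAt_extend I' E' (Z (f x))) (by simp)
  have h0 : mvfderiv I' (fun z ↦ (trivializationAt E' (fun y : M' ↦ TangentSpace I' y) (f x)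
      ⟨z, extend E' (Z (f x)) z⟩).2) (f x) = 0 := by
    rw [mvfderiv_congr (h := fun _ ↦ (trivializationAt E' (fun y : M' ↦ TangentSpace I' y) (f x)
      ⟨f x, Z (f x)⟩).2)]
    · exact mvfderiv_const _
    · filter_upwards [chart_source_mem_nhds H' (f x)] with y hy
      exact trivializationAt_snd_extend hy _
  beta_reduce at h
  rw [h0, ContinuousLinearMap.comp_zero, sub_zero, sub_eq_iff_eq_add] at h
  have hc := mvfderiv_comp_apply_eq (I := I) (I' := I')
    ((mdifferentiableAt_section I' Z).1 hZ) hf rfl u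
  unfold covAlong
  rw [h]
  simp only [add_apply, ContinuousLinearMap.comp_apply]
  rw [← hc]
  rfl

/-! ### Product rules for the pull-back connection -/

variable {D} [RiemannianBundle (fun x : M' ↦ TangentSpace I' x)]
  [IsContMDiffRiemannianBundle I' ∞ E' (fun x : M' ↦ TangentSpace I' x)]

omit [FiniteDimensional ℝ E'] in
theorem MDiffAlongAt.inner {V W : ∀ y : M, TangentSpace I' (f y)} (hV : MDiffAlongAt I I' f V x)
    (hW : MDiffAlongAt I I' f W x) :
    MDifferentiableAt I 𝓘(ℝ, ℝ) (fun y ↦ (inner ℝ (V y) (W y) : ℝ)) x :=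
  MDifferentiableAt.inner_bundle (F := E') hV hW

/-- The pull-back of a metric connection is metric. -/
theorem mvfderiv_inner_along (hD : IsLeviCivita D) {V W : ∀ y : M, TangentSpace I' (f y)}
    (hV : MDiffAlongAt I I' f V x) (hW : MDiffAlongAt I I' f W x) (u : TangentSpace I x) :
    mvfderiv I (fun y ↦ (inner ℝ (V y) (W y) : ℝ)) x u =
      inner ℝ (covAlong D f V x u) (W x) + inner ℝ (V x) (covAlong D f W x u) := by
  have hf := (mdiffAlongAt_iff.1 hV).1
  revert V
  refine fun {V} hV ↦ MDiffAlongAt.induction (P := fun V ↦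
    mvfderiv I (fun y ↦ (inner ℝ (V y) (W y) : ℝ)) x u =
      inner ℝ (covAlong D f V x u) (W x) + inner ℝ (V x) (covAlong D f W x u)) ?_ ?_ ?_ ?_ hV
  · intro V V' hV h hP
    rw [← covAlong_congr D h, ← h.self_of_nhds, ← hP]
    refine congrArg (fun L : TangentSpace I x →L[ℝ] ℝ ↦ L u) (mvfderiv_congr ?_)
    filter_upwards [h] with y hy
    rw [hy]
  · intro V V' hV hV' h h'
    rw [covAlong_add D hV hV']
    simp only [inner_add_left, add_apply]
    have := mvfderiv_fun_add (hV.inner hW) (hV'.inner hW)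
    rw [this, add_apply, h, h']
    ring
  · intro g V hg hV h
    rw [covAlong_smul D hg hV]
    simp only [inner_add_left, inner_smul_left, RCLike.conj_to_real]
    have := mvfderiv_fun_mul hg (hV.inner hW)
    rw [this, add_apply, smul_apply, smul_apply, h]
    simp only [smul_eq_mul]
    ring
  · intro Z hZ
    refine MDiffAlongAt.induction (P := fun W ↦
      mvfderiv I (fun y ↦ (inner ℝ (Z (f y)) (W y) : ℝ)) x u =
        inner ℝ (covAlong D f (fun y ↦ Z (f y)) x u) (W x) +
          inner ℝ (Z (f x)) (covAlong D f W x u)) ?_ ?_ ?_ ?_ hW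
    · intro V V' hV h hP
      rw [← covAlong_congr D h, ← h.self_of_nhds, ← hP]
      refine congrArg (fun L : TangentSpace I x →L[ℝ] ℝ ↦ L u) (mvfderiv_congr ?_)
      filter_upwards [h] with y hy
      rw [hy]
    · intro V V' hV hV' h h'
      rw [covAlong_add D hV hV']
      simp only [inner_add_right, add_apply]
      have := mvfderiv_fun_add ((MDiffAlongAt.of_comp hf hZ).inner hV)
        ((MDiffAlongAt.of_comp hf hZ).inner hV')
      rw [this, add_apply, h, h']
      ring
    · intro g V hg hV h
      rw [covAlong_smul D hg hV]
      simp only [inner_add_right, inner_smul_right]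
      have := mvfderiv_fun_mul hg ((MDiffAlongAt.of_comp hf hZ).inner hV)
      rw [this, add_apply, smul_apply, smul_apply, h]
      simp only [smul_eq_mul]
      ring
    · intro Z' hZ'
      rw [covAlong_comp D hf hZ, covAlong_comp D hf hZ', ← hD.mvfderiv_inner hZ hZ']
      exact mvfderiv_comp_apply_eq (I := I) (I' := I')
        (MDiffAlongAt.inner (I := I') (f := fun z : M' ↦ z) hZ hZ') hf rfl u

omit [FiniteDimensional ℝ E'] [RiemannianBundle (fun x : M' ↦ TangentSpace I' x)]
  [IsContMDiffRiemannianBundle I' ∞ E' (fun x : M' ↦ TangentSpace I' x)] in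
theorem MDiffAlongAt.apply_endo
    {A : ∀ z : M', TangentSpace I' z →L[ℝ] TangentSpace I' z} (hA : IsSmoothEndo A)
    {V : ∀ y : M, TangentSpace I' (f y)} (hV : MDiffAlongAt I I' f V x) :
    MDiffAlongAt I I' f (fun y ↦ A (f y) (V y)) x :=
  MDifferentiableAt.clm_bundle_apply (F₁ := E') (F₂ := E')
    (((hA (f x)).mdifferentiableAt (by simp)).comp x (mdiffAlongAt_iff.1 hV).1) hV

omit [RiemannianBundle (fun x : M' ↦ TangentSpace I' x)]
  [IsContMDiffRiemannianBundle I' ∞ E' (fun x : M' ↦ TangentSpace I' x)] in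
theorem covAlong_apply_endo
    {A : ∀ z : M', TangentSpace I' z →L[ℝ] TangentSpace I' z} (hA : IsSmoothEndo A)
    {V : ∀ y : M, TangentSpace I' (f y)} (hV : MDiffAlongAt I I' f V x) (u : TangentSpace I x) :
    covAlong D f (fun y ↦ A (f y) (V y)) x u =
      covDerivEndo D hA (f x) (mfderiv I I' f x u) (V x) + A (f x) (covAlong D f V x u) := by
  have hf := (mdiffAlongAt_iff.1 hV).1
  refine MDiffAlongAt.induction (P := fun V ↦ covAlong D f (fun y ↦ A (f y) (V y)) x u =
      covDerivEndo D hA (f x) (mfderiv I I' f x u) (V x) + A (f x) (covAlong D f V x u))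
      ?_ ?_ ?_ ?_ hV
  · intro V V' hV h hP
    rw [← covAlong_congr D h, ← h.self_of_nhds, ← hP]
    refine congrArg (fun L : TangentSpace I x →L[ℝ] TangentSpace I' (f x) ↦ L u)
      (covAlong_congr D ?_)
    filter_upwards [h] with y hy
    rw [hy]
  · intro V V' hV hV' h h'
    simp only [map_add]
    rw [covAlong_add D hV hV', covAlong_add D (hV.apply_endo hA) (hV'.apply_endo hA), add_apply,
      add_apply, h, h', map_add]
    abel
  · intro g V hg hV h
    simp only [map_smul]
    rw [covAlong_smul D hg hV, covAlong_smul D hg (hV.apply_endo hA), h, map_add, map_smul,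
      map_smul]
    module
  · intro Z hZ
    rw [covAlong_comp D hf hZ, covDerivEndo_apply D hA (f x) _ hZ,
      covAlong_comp D (Z := fun z ↦ A z (Z z)) hf (hA.mdifferentiableAt_apply hZ)]
    abel

/-- A field `B` of bilinear maps on the tangent spaces is a smooth `(1,2)`-tensor field. -/
def IsSmoothBilin
    (B : ∀ z : M', TangentSpace I' z →L[ℝ] TangentSpace I' z →L[ℝ] TangentSpace I' z) : Prop :=
  ContMDiff I' (I'.prod 𝓘(ℝ, E' →L[ℝ] E' →L[ℝ] E')) ∞
    (fun z ↦ TotalSpace.mk' (E' →L[ℝ] E' →L[ℝ] E')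
      (E := fun z : M' ↦ TangentSpace I' z →L[ℝ] TangentSpace I' z →L[ℝ] TangentSpace I' z)
      z (B z))

omit [FiniteDimensional ℝ E'] [RiemannianBundle (fun x : M' ↦ TangentSpace I' x)]
  [IsContMDiffRiemannianBundle I' ∞ E' (fun x : M' ↦ TangentSpace I' x)] in
theorem MDiffAlongAt.apply_bilin
    {B : ∀ z : M', TangentSpace I' z →L[ℝ] TangentSpace I' z →L[ℝ] TangentSpace I' z}
    (hB : IsSmoothBilin B) {V W : ∀ y : M, TangentSpace I' (f y)} (hV : MDiffAlongAt I I' f V x)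
    (hW : MDiffAlongAt I I' f W x) :
    MDiffAlongAt I I' f (fun y ↦ B (f y) (V y) (W y)) x :=
  MDifferentiableAt.clm_bundle_apply₂ (F₁ := E') (F₂ := E') (F₃ := E')
    (((hB (f x)).mdifferentiableAt (by simp)).comp x (mdiffAlongAt_iff.1 hV).1) hV hW

omit [RiemannianBundle (fun x : M' ↦ TangentSpace I' x)]
  [IsContMDiffRiemannianBundle I' ∞ E' (fun x : M' ↦ TangentSpace I' x)] in
/-- The product rule for `B(V, W)`, where `B' = ∇B` at the point `f x`. -/
theorem covAlong_apply_bilin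
    {B : ∀ z : M', TangentSpace I' z →L[ℝ] TangentSpace I' z →L[ℝ] TangentSpace I' z}
    (hB : IsSmoothBilin B)
    {B' : TangentSpace I' (f x) →
      TangentSpace I' (f x) →L[ℝ] TangentSpace I' (f x) →L[ℝ] TangentSpace I' (f x)}
    (hB' : ∀ Y Z : ∀ z : M', TangentSpace I' z,
      MDifferentiableAt I' I'.tangent (fun z ↦ (⟨z, Y z⟩ : TangentBundle I' M')) (f x) →
      MDifferentiableAt I' I'.tangent (fun z ↦ (⟨z, Z z⟩ : TangentBundle I' M')) (f x) →
      ∀ w, D (fun z ↦ B z (Y z) (Z z)) (f x) w = B' w (Y (f x)) (Z (f x)) +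
        B (f x) (D Y (f x) w) (Z (f x)) + B (f x) (Y (f x)) (D Z (f x) w))
    {V W : ∀ y : M, TangentSpace I' (f y)} (hV : MDiffAlongAt I I' f V x)
    (hW : MDiffAlongAt I I' f W x) (u : TangentSpace I x) :
    covAlong D f (fun y ↦ B (f y) (V y) (W y)) x u =
      B' (mfderiv I I' f x u) (V x) (W x) + B (f x) (covAlong D f V x u) (W x) +
        B (f x) (V x) (covAlong D f W x u) := by
  have hf := (mdiffAlongAt_iff.1 hV).1
  revert V
  refine fun {V} hV ↦ MDiffAlongAt.induction (P := fun V ↦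
    covAlong D f (fun y ↦ B (f y) (V y) (W y)) x u =
      B' (mfderiv I I' f x u) (V x) (W x) + B (f x) (covAlong D f V x u) (W x) +
        B (f x) (V x) (covAlong D f W x u)) ?_ ?_ ?_ ?_ hV
  · intro V V' hV h hP
    rw [← covAlong_congr D h, ← h.self_of_nhds, ← hP]
    refine congrArg (fun L : TangentSpace I x →L[ℝ] TangentSpace I' (f x) ↦ L u)
      (covAlong_congr D ?_)
    filter_upwards [h] with y hy
    rw [hy]
  · intro V V' hV hV' h h'
    simp only [map_add, add_apply]
    rw [covAlong_add D hV hV', covAlong_add D (hV.apply_bilin hB hW) (hV'.apply_bilin hB hW),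
      add_apply, add_apply, h, h', map_add, add_apply]
    abel
  · intro g V hg hV h
    simp only [map_smul, smul_apply]
    rw [covAlong_smul D hg hV, covAlong_smul D hg (hV.apply_bilin hB hW), h, map_add, map_smul,
      map_smul]
    simp only [add_apply, smul_apply]
    module
  · intro Y hY
    refine MDiffAlongAt.induction (P := fun W ↦
      covAlong D f (fun y ↦ B (f y) (Y (f y)) (W y)) x u =
        B' (mfderiv I I' f x u) (Y (f x)) (W x) +
          B (f x) (covAlong D f (fun y ↦ Y (f y)) x u) (W x) +
          B (f x) (Y (f x)) (covAlong D f W x u)) ?_ ?_ ?_ ?_ hW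
    · intro V V' hV h hP
      rw [← covAlong_congr D h, ← h.self_of_nhds, ← hP]
      refine congrArg (fun L : TangentSpace I x →L[ℝ] TangentSpace I' (f x) ↦ L u)
        (covAlong_congr D ?_)
      filter_upwards [h] with y hy
      rw [hy]
    · intro V V' hV hV' h h'
      have hY' := MDiffAlongAt.of_comp (I := I) hf hY
      simp only [map_add]
      rw [covAlong_add D hV hV', covAlong_add D (hY'.apply_bilin hB hV)
        (hY'.apply_bilin hB hV'), add_apply, add_apply, h, h', map_add]
      abel
    · intro g V hg hV h
      have hY' := MDiffAlongAt.of_comp (I := I) hf hY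
      simp only [map_smul]
      rw [covAlong_smul D hg hV, covAlong_smul D hg (hY'.apply_bilin hB hV), h, map_add, map_smul,
        map_smul]
      module
    · intro Z hZ
      have hBd : MDifferentiableAt I' I'.tangent
          (fun z ↦ (⟨z, B z (Y z) (Z z)⟩ : TangentBundle I' M')) (f x) :=
        MDifferentiableAt.clm_bundle_apply₂ (F₁ := E') (F₂ := E') (F₃ := E')
          ((hB (f x)).mdifferentiableAt (by simp)) hY hZ
      rw [covAlong_comp D hf hY, covAlong_comp D hf hZ,
        covAlong_comp D (Z := fun z ↦ B z (Y z) (Z z)) hf hBd, hB' Y Z hY hZ]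

/-! ### Symmetry of the pull-back connection -/

variable [IsManifold I ∞ M] [FiniteDimensional ℝ E]
  [I.Boundaryless] [I'.Boundaryless]

omit [FiniteDimensional ℝ E'] [RiemannianBundle (fun x : M' ↦ TangentSpace I' x)]
  [IsContMDiffRiemannianBundle I' ∞ E' (fun x : M' ↦ TangentSpace I' x)]
  [FiniteDimensional ℝ E] [I.Boundaryless] [I'.Boundaryless] in
theorem mdiffAlongAt_mfderiv (hf : ContMDiff I I' ∞ f) {Y : ∀ y : M, TangentSpace I y}
    (hY : MDifferentiableAt I I.tangent (fun y ↦ (⟨y, Y y⟩ : TangentBundle I M)) x) :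
    MDiffAlongAt I I' f (fun y ↦ mfderiv I I' f y (Y y)) x := by
  have h : ContMDiff I.tangent I'.tangent ∞ (tangentMap I I' f) :=
    hf.contMDiff_tangentMap (by simp)
  exact MDifferentiableAt.comp x ((h _).mdifferentiableAt (by simp)) hY

/-- The pull-back of a torsion-free connection satisfies `∇_X df(Y) - ∇_Y df(X) = df([X, Y])`. -/
theorem covAlong_mfderiv_sub (hD : IsLeviCivita D) (hf : ContMDiff I I' ∞ f)
    {X Y : ∀ y : M, TangentSpace I y}
    (hX : MDifferentiableAt I I.tangent (fun y ↦ (⟨y, X y⟩ : TangentBundle I M)) x)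
    (hY : MDifferentiableAt I I.tangent (fun y ↦ (⟨y, Y y⟩ : TangentBundle I M)) x) :
    covAlong D f (fun y ↦ mfderiv I I' f y (Y y)) x (X x) -
      covAlong D f (fun y ↦ mfderiv I I' f y (X y)) x (Y x) =
        mfderiv I I' f x (mlieBracket I X Y x) := by
  have : CompleteSpace E := FiniteDimensional.complete ℝ E
  have : CompleteSpace E' := FiniteDimensional.complete ℝ E'
  have hfd : ∀ y, MDifferentiableAt I I' f y := fun y ↦ (hf y).mdifferentiableAt (by simp)
  set g : M → E' := extChartAt I' (f x) ∘ f with hg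
  have hchart : ∀ z ∈ (chartAt H' (f x)).source,
      ContMDiffAt I' 𝓘(ℝ, E') 2 (extChartAt I' (f x)) z :=
    fun z hz ↦ (contMDiffAt_extChartAt' (n := ∞) hz).of_le (by norm_cast)
  have hgc : ContMDiffAt I 𝓘(ℝ, E') 2 g x :=
    ContMDiffAt.comp x (hchart _ (mem_chart_source H' (f x))) ((hf x).of_le (by norm_cast))
  have key : ∀ (y : M) (_ : f y ∈ (chartAt H' (f x)).source) (v : TangentSpace I y),
      (trivializationAt E' (fun y : M' ↦ TangentSpace I' y) (f x) ⟨f y, mfderiv I I' f y v⟩).2 =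
        mvfderiv I g y v := by
    intro y hy v
    rw [trivializationAt_snd_eq_mvfderiv hy]
    exact (mvfderiv_comp_apply_eq ((hchart _ hy).mdifferentiableAt (by simp)) (hfd y) rfl v).symm
  have hder : ∀ Z : ∀ y : M, TangentSpace I y,
      mvfderiv I (fun y ↦ (trivializationAt E' (fun y : M' ↦ TangentSpace I' y) (f x)
        ⟨f y, mfderiv I I' f y (Z y)⟩).2) x = mvfderiv I (fun y ↦ mvfderiv I g y (Z y)) x := by
    intro Z
    apply mvfderiv_congr
    filter_upwards [eventually_mem_chart_source (hfd x)] with y hy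
    exact key y hy (Z y)
  have hcom := (hD.eventually_extend_comm (f x) (mfderiv I I' f x (X x))
    (mfderiv I I' f x (Y x))).self_of_nhds
  rw [extend_apply_self, extend_apply_self] at hcom
  unfold covAlong
  simp only [add_apply, ContinuousLinearMap.comp_apply]
  rw [hder, hder, hcom, add_sub_add_left_eq_sub, ← map_sub, mvfderiv_mvfderiv_sub hgc hX hY,
    ← key x (mem_chart_source H' (f x))]
  exact symmL_trivializationAt_snd (mem_chart_source H' (f x)) _

end Along

/-! ### Algebra of nearly Kähler tensors of constant type one -/

section Algebra

variable {V : Type*} [NormedAddCommGroup V] [InnerProductSpace ℝ V]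

local notation "⟪" x ", " y "⟫" => inner ℝ x y

theorem eq_zero_of_eq_neg {x : V} (hx : x = -x) : x = 0 := by
  have h2 : (2 : ℝ) • x = 0 := by
    rw [two_smul]
    exact eq_neg_iff_add_eq_zero.1 hx
  exact (smul_eq_zero.1 h2).resolve_left two_ne_zero

/-- The pointwise algebra of a nearly Kähler structure of constant type one: an orthogonal complex
structure `J` and the tensor `G = ∇J`. -/
structure IsNearlyKahlerAlgebra (J : V →L[ℝ] V) (G : V →L[ℝ] V →L[ℝ] V) : Prop where
  sq : ∀ u, J (J u) = -u
  inner_map : ∀ u v, ⟪J u, J v⟫ = ⟪u, v⟫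
  skew : ∀ u v, G u v = -G v u
  inner_skew : ∀ u v w, ⟪G u v, w⟫ = -⟪v, G u w⟫
  map_J : ∀ u v, G u (J v) = -J (G u v)
  type_one : ∀ u v w z, ⟪G u v, G w z⟫ = ⟪u, w⟫ * ⟪v, z⟫ - ⟪u, z⟫ * ⟪v, w⟫ +
    ⟪J u, w⟫ * ⟪v, J z⟫ - ⟪J u, z⟫ * ⟪v, J w⟫

namespace IsNearlyKahlerAlgebra

variable {J : V →L[ℝ] V} {G : V →L[ℝ] V →L[ℝ] V} (h : IsNearlyKahlerAlgebra J G)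
include h

theorem J_skew (u v : V) : ⟪J u, v⟫ = -⟪u, J v⟫ := by
  have := h.inner_map u (J v)
  rw [h.sq, inner_neg_right] at this
  linarith

theorem inner_J_self (u : V) : ⟪J u, u⟫ = 0 := by
  have := h.J_skew u u
  rw [real_inner_comm] at this
  linarith [real_inner_comm u (J u)]

theorem self (u : V) : G u u = 0 := by
  exact eq_zero_of_eq_neg (h.skew u u)

theorem self_J (u : V) : G u (J u) = 0 := by rw [h.map_J, h.self, map_zero, neg_zero]

theorem map_J_left (u v : V) : G (J u) v = -J (G u v) := by
  rw [h.skew, h.map_J, h.skew v u, map_neg, neg_neg]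

theorem inner_self (u v : V) : ⟪G u v, u⟫ = 0 := by
  rw [h.inner_skew, h.self, inner_zero_right, neg_zero]

theorem inner_self_right (u v : V) : ⟪G u v, v⟫ = 0 := by
  rw [h.skew, inner_neg_left, h.inner_self, neg_zero]

theorem inner_J_left (u v : V) : ⟪G u v, J u⟫ = 0 := by
  rw [h.inner_skew, h.self_J, inner_zero_right, neg_zero]

theorem inner_J_right (u v : V) : ⟪G u v, J v⟫ = 0 := by
  rw [h.skew, inner_neg_left, h.inner_J_left, neg_zero]

theorem inner_cyclic (u v w : V) : ⟪G u v, w⟫ = ⟪G v w, u⟫ := by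
  rw [h.skew, inner_neg_left, h.inner_skew, neg_neg, real_inner_comm]

theorem J_ne_zero {u : V} (hu : u ≠ 0) : J u ≠ 0 := by
  intro h0
  have := h.sq u
  rw [h0, map_zero] at this
  exact hu (neg_eq_zero.1 this.symm)

theorem G_ne_zero {e v : V} (he : e ≠ 0) (hv : v ≠ 0) (hev : ⟪e, v⟫ = 0) (hJev : ⟪J e, v⟫ = 0) :
    G e v ≠ 0 := by
  intro h0
  have h1 := h.type_one e v e v
  rw [h0, inner_zero_left, real_inner_comm e v, hev, h.inner_J_self, hJev] at h1
  have h2 := real_inner_self_pos.2 he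
  have h3 := real_inner_self_pos.2 hv
  nlinarith [mul_pos h2 h3]

/-- In dimension six, `e, Je, v, Jv, G(e,v), JG(e,v)` span, if `e` and `v` are orthogonal over
the complex numbers. -/
theorem eq_zero_of_orthogonal (hdim : Module.finrank ℝ V = 6) {e v u : V} (he : e ≠ 0) (hv : v ≠ 0)
    (hev : ⟪e, v⟫ = 0) (hJev : ⟪J e, v⟫ = 0) (h1 : ⟪u, e⟫ = 0) (h2 : ⟪u, J e⟫ = 0)
    (h3 : ⟪u, v⟫ = 0) (h4 : ⟪u, J v⟫ = 0) (h5 : ⟪u, G e v⟫ = 0) (h6 : ⟪u, J (G e v)⟫ = 0) :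
    u = 0 := by
  by_contra hu
  have hk := h.G_ne_zero he hv hev hJev
  set k := G e v with hkdef
  have a1 : ⟪e, J e⟫ = 0 := by rw [real_inner_comm, h.inner_J_self]
  have a2 : ⟪e, J v⟫ = 0 := by linarith [h.J_skew e v]
  have a3 : ⟪e, k⟫ = 0 := by rw [real_inner_comm, h.inner_self]
  have a4 : ⟪J e, k⟫ = 0 := by rw [real_inner_comm, h.inner_J_left]
  have a5 : ⟪e, J k⟫ = 0 := by linarith [h.J_skew e k]
  have a6 : ⟪J e, J v⟫ = 0 := by rw [h.inner_map, hev]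
  have a7 : ⟪J e, J k⟫ = 0 := by rw [h.inner_map, a3]
  have a8 : ⟪v, J v⟫ = 0 := by rw [real_inner_comm, h.inner_J_self]
  have a9 : ⟪v, k⟫ = 0 := by rw [real_inner_comm, h.inner_self_right]
  have a10 : ⟪J v, k⟫ = 0 := by rw [real_inner_comm, h.inner_J_right]
  have a11 : ⟪v, J k⟫ = 0 := by linarith [h.J_skew v k]
  have a12 : ⟪J v, J k⟫ = 0 := by rw [h.inner_map, a9]
  have a13 : ⟪k, J k⟫ = 0 := by rw [real_inner_comm, h.inner_J_self]
  let w : Fin 7 → V := ![u, e, J e, v, J v, k, J k]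
  have hne : ∀ i, w i ≠ 0 := by
    intro i
    fin_cases i
    exacts [hu, he, h.J_ne_zero he, hv, h.J_ne_zero hv, hk, h.J_ne_zero hk]
  have hlt : ∀ i j, i < j → ⟪w i, w j⟫ = 0 := by
    intro i j hij
    fin_cases i <;> fin_cases j <;> first | (exact absurd hij (by decide)) | assumption
  have horth : Pairwise fun i j ↦ ⟪w i, w j⟫ = 0 := by
    intro i j hij
    rcases lt_or_gt_of_ne hij with hlt' | hlt'
    · exact hlt i j hlt'
    · rw [real_inner_comm]; exact hlt j i hlt'
  have hli := linearIndependent_of_ne_zero_of_inner_eq_zero hne horth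
  have : FiniteDimensional ℝ V := Module.finite_of_finrank_pos (by omega)
  have := hli.fintype_card_le_finrank
  simp [hdim] at this

/-- `G(x, y)` for `x` and `y` orthogonal to the complex line spanned by the unit vector `e`. -/
theorem G_apply_of_orthogonal (hdim : Module.finrank ℝ V = 6) {e x y : V} (he : ‖e‖ = 1)
    (hx : ⟪e, x⟫ = 0) (hx' : ⟪J e, x⟫ = 0) (hy : ⟪e, y⟫ = 0) (hy' : ⟪J e, y⟫ = 0) :
    G x y = ⟪G e x, y⟫ • e + ⟪G (J e) x, y⟫ • J e := by
  rcases eq_or_ne x 0 with rfl | hx0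
  · simp
  have he0 : e ≠ 0 := by rintro rfl; simp at he
  have hee : ⟪e, e⟫ = 1 := by rw [real_inner_self_eq_norm_sq, he]; norm_num
  have hJJ : ⟪J e, J e⟫ = 1 := by rw [h.inner_map, hee]
  have hJe : ⟪J e, e⟫ = 0 := h.inner_J_self e
  have hJe' : ⟪e, J e⟫ = 0 := by rw [real_inner_comm, hJe]
  have a2 : ⟪e, J x⟫ = 0 := by linarith [h.J_skew e x]
  have a6 : ⟪J e, J x⟫ = 0 := by rw [h.inner_map, hx]
  have hp : ∀ z, ⟪G x y, z⟫ = ⟪G z x, y⟫ := by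
    intro z
    rw [h.inner_skew, h.skew x z, inner_neg_right, neg_neg, real_inner_comm]
  -- the difference of the two sides is orthogonal to a basis `e, Je, x, Jx, G(e, x), JG(e, x)`
  rw [← sub_eq_zero]
  have hye : ⟪y, e⟫ = 0 := by rw [real_inner_comm, hy]
  have hyJe : ⟪y, J e⟫ = 0 := by rw [real_inner_comm, hy']
  have hxe : ⟪x, e⟫ = 0 := by rw [real_inner_comm, hx]
  have hJxe : ⟪J x, e⟫ = 0 := by rw [real_inner_comm, a2]
  have t5 : ⟪G x y, G e x⟫ = 0 := by
    rw [h.type_one, hxe, hye, hJxe, h.inner_J_self]; ring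
  have t6 : ⟪G x y, J (G e x)⟫ = 0 := by
    have : J (G e x) = -G e (J x) := by rw [h.map_J, neg_neg]
    rw [this, inner_neg_right, h.type_one, hxe, hye, hJxe, hyJe]; ring
  have s1 : ⟪e, G e x⟫ = 0 := by rw [real_inner_comm, h.inner_self]
  have s2 : ⟪J e, G e x⟫ = 0 := by rw [real_inner_comm, h.inner_J_left]
  have s3 : ⟪e, J (G e x)⟫ = 0 := by linarith [h.J_skew e (G e x)]
  have s4 : ⟪J e, J (G e x)⟫ = 0 := by rw [h.inner_map, s1]
  apply h.eq_zero_of_orthogonal hdim he0 hx0 hx hx' <;>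
    simp only [inner_sub_left, inner_add_left, inner_smul_left, RCLike.conj_to_real]
  · rw [hee, hJe, hp]; ring
  · rw [hJe', hJJ, hp]; ring
  · rw [hx, hx', h.inner_self]; ring
  · rw [a2, a6, h.inner_J_left]; ring
  · rw [s1, s2, t5]; ring
  · rw [s3, s4, t6]; ring

/-- The constancy of the type, read as a formula for the composition `G_x ∘ G_y`. -/
theorem G_G (x y z : V) :
    G x (G y z) = -(⟪x, y⟫ • z) + ⟪x, z⟫ • y + ⟪x, J y⟫ • J z - ⟪x, J z⟫ • J y := by
  refine ext_inner_right ℝ fun w ↦ ?_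
  rw [h.inner_skew, real_inner_comm, h.type_one]
  simp only [inner_add_left, inner_sub_left, inner_neg_left, inner_smul_left, RCLike.conj_to_real]
  have e1 : ⟪J x, y⟫ = -⟪x, J y⟫ := h.J_skew x y
  have e2 : ⟪J x, z⟫ = -⟪x, J z⟫ := h.J_skew x z
  rw [e1, e2, real_inner_comm w z, real_inner_comm w y, real_inner_comm w (J z),
    real_inner_comm w (J y)]
  ring

/-- A tensor `U` with the symmetries that the difference of `∇G` and its expected value has
vanishes. The identity `closed`, for `e, Je, v, G(e, v)`, gives the last of the components that show
`U(e, e, v) = 0`; hence `U` is alternating, and `closed` then says that `U = 0`. -/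
theorem eq_zero_of_symmetries (hdim : Module.finrank ℝ V = 6) (U : V →ₗ[ℝ] V →ₗ[ℝ] V →ₗ[ℝ] V)
    (skew : ∀ w x y, U w x y = -U w y x)
    (inner_skew : ∀ w x y z, ⟪U w x y, z⟫ = -⟪y, U w x z⟫)
    (map_J : ∀ w x y, U w x (J y) = -J (U w x y))
    (type : ∀ w x y, ⟪U w x y, G x y⟫ = 0)
    (closed : ∀ w x y z, ⟪U w x y, z⟫ - ⟪U x w y, z⟫ + ⟪U y w x, z⟫ - ⟪U z w x, y⟫ = 0)
    (w x y : V) : U w x y = 0 := by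
  have self : ∀ w x, U w x x = 0 := fun w x ↦ eq_zero_of_eq_neg (skew w x x)
  have selfJ : ∀ w x, U w x (J x) = 0 := fun w x ↦ by rw [map_J, self, map_zero, neg_zero]
  have step : ∀ e v, ⟪e, v⟫ = 0 → ⟪J e, v⟫ = 0 → U e e v = 0 := by
    intro e v hev hJev
    rcases eq_or_ne e 0 with rfl | he
    · simp
    rcases eq_or_ne v 0 with rfl | hv
    · simp
    have hkey := closed e (J e) v (G e v)
    rw [type (J e) e v, selfJ, selfJ, skew e (J e) v, map_J, skew e v e] at hkey
    simp only [map_neg, neg_neg, inner_zero_left, inner_neg_left, h.J_skew, sub_zero,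
      add_zero] at hkey
    apply h.eq_zero_of_orthogonal hdim he hv hev hJev
    · rw [inner_skew, self, inner_zero_right, neg_zero]
    · rw [inner_skew, selfJ, inner_zero_right, neg_zero]
    · rw [skew, inner_neg_left, inner_skew, self, inner_zero_right, neg_zero, neg_zero]
    · rw [skew, inner_neg_left, inner_skew, selfJ, inner_zero_right, neg_zero, neg_zero]
    · exact type e e v
    · linarith
  have diag : ∀ e v, U e e v = 0 := by
    intro e v
    rcases eq_or_ne e 0 with rfl | he
    · simp
    have hee : ⟪e, e⟫ ≠ 0 := (real_inner_self_pos.2 he).ne'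
    have hJe : ⟪J e, e⟫ = 0 := h.inner_J_self e
    have hJe' : ⟪e, J e⟫ = 0 := by rw [real_inner_comm, hJe]
    have hs := step e (v - (⟪e, v⟫ / ⟪e, e⟫) • e - (⟪J e, v⟫ / ⟪e, e⟫) • J e)
      (by simp only [inner_sub_right, inner_smul_right, hJe']; field_simp; ring)
      (by simp only [inner_sub_right, inner_smul_right, hJe, h.inner_map]; field_simp; ring)
    simpa [self, selfJ] using hs
  -- polarize
  have alt : ∀ w x y, U w x y = -U x w y := by
    intro w x y
    have := diag (w + x) y
    simp only [map_add, LinearMap.add_apply, diag, zero_add, add_zero] at this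
    rw [eq_neg_iff_add_eq_zero, add_comm]
    exact this
  refine ext_inner_right ℝ fun z ↦ ?_
  have c := closed w x y z
  rw [alt x w y, skew y w x, alt y x w, skew x y w, alt x w y, alt z w x, skew w z x,
    inner_neg_left, inner_neg_left, inner_neg_left, inner_neg_left] at c
  simp only [inner_neg_left, neg_neg] at c
  have e1 := inner_skew w x z y
  rw [real_inner_comm (U w x y) z] at e1
  rw [inner_zero_left]
  linarith

/-- The covariant derivative of `G` on a six-dimensional strict nearly Kähler manifold of constant
type one is determined by its algebraic symmetries: the product rule applied to the identities
for `G`, and the identity `d²ω = 0` for the fundamental form `ω`. -/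
theorem deriv_eq (hdim : Module.finrank ℝ V = 6) (T : V →ₗ[ℝ] V →ₗ[ℝ] V →ₗ[ℝ] V)
    (skew : ∀ w x y, T w x y = -T w y x)
    (inner_skew : ∀ w x y z, ⟪T w x y, z⟫ = -⟪y, T w x z⟫)
    (map_J : ∀ w x y, T w x (J y) + J (T w x y) = -G x (G w y) - G w (G x y))
    (type : ∀ w x y, ⟪T w x y, G x y⟫ = -(⟪J x, y⟫ * ⟪G w x, y⟫))
    (closed : ∀ w x y z, ⟪T w x y, z⟫ - ⟪T x w y, z⟫ + ⟪T y w x, z⟫ - ⟪T z w x, y⟫ = 0)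
    (w x y : V) : T w x y = ⟪x, J y⟫ • w + ⟪w, y⟫ • J x - ⟪w, x⟫ • J y := by
  -- the expected value of `T`; the difference satisfies the homogeneous identities
  let T₀ : V →ₗ[ℝ] V →ₗ[ℝ] V →ₗ[ℝ] V := LinearMap.mk₂ ℝ
    (fun w x ↦ ((innerSL ℝ x ∘L J).smulRight w + (innerSL ℝ w).smulRight (J x) -
      ⟪w, x⟫ • J : V →L[ℝ] V).toLinearMap)
    (by intros; ext; simp [inner_add_left, add_smul]; module)
    (by intros; ext; simp [inner_smul_left, mul_smul, smul_sub]; module)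
    (by intros; ext; simp [inner_add_right, add_smul]; module)
    (by intros; ext; simp [inner_smul_right, mul_smul, smul_sub]; module)
  have hT₀ : ∀ w x y, T₀ w x y = ⟪x, J y⟫ • w + ⟪w, y⟫ • J x - ⟪w, x⟫ • J y := by
    intro w x y; simp [T₀]
  have hx := h.eq_zero_of_symmetries hdim (T - T₀) ?_ ?_ ?_ ?_ ?_ w x y
  · rw [LinearMap.sub_apply, LinearMap.sub_apply, LinearMap.sub_apply, sub_eq_zero] at hx
    rw [hx, hT₀]
  · intro w x y
    simp only [LinearMap.sub_apply, hT₀]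
    rw [skew w x y, show ⟪x, J y⟫ = -⟪y, J x⟫ by rw [← h.J_skew, real_inner_comm]]
    module
  · intro w x y z
    simp only [LinearMap.sub_apply, hT₀, inner_sub_left, inner_sub_right, inner_add_left,
      inner_add_right, inner_smul_left, inner_smul_right, RCLike.conj_to_real]
    rw [inner_skew w x y z, h.J_skew x z, h.J_skew y z, real_inner_comm w y,
      show ⟪y, J x⟫ = -⟪x, J y⟫ by rw [← h.J_skew, real_inner_comm]]
    ring
  · intro w x y
    simp only [LinearMap.sub_apply, hT₀, map_sub, map_add, map_smul, h.sq]
    have := map_J w x y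
    rw [h.G_G, h.G_G] at this
    rw [eq_sub_of_add_eq this, inner_neg_right, show ⟪w, J x⟫ = -⟪x, J w⟫ by
      rw [← h.J_skew, real_inner_comm], real_inner_comm x w]
    module
  · intro w x y
    simp only [LinearMap.sub_apply, hT₀, inner_sub_left, inner_add_left, inner_smul_left,
      RCLike.conj_to_real]
    have e1 : ⟪J x, G x y⟫ = 0 := by rw [real_inner_comm, h.inner_J_left]
    have e2 : ⟪J y, G x y⟫ = 0 := by rw [real_inner_comm, h.inner_J_right]
    have e3 : ⟪w, G x y⟫ = ⟪G w x, y⟫ := by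
      rw [real_inner_comm, h.inner_skew, h.skew x w, inner_neg_right, neg_neg, real_inner_comm]
    rw [type, e1, e2, e3, h.J_skew x y]
    ring
  · intro w x y z
    have c := closed w x y z
    simp only [LinearMap.sub_apply, hT₀, inner_sub_left, inner_add_left, inner_smul_left,
      RCLike.conj_to_real, h.J_skew]
    rw [show ⟪w, J x⟫ = -⟪x, J w⟫ by rw [← h.J_skew, real_inner_comm],
      show ⟪w, J y⟫ = -⟪y, J w⟫ by rw [← h.J_skew, real_inner_comm],
      show ⟪x, J y⟫ = -⟪y, J x⟫ by rw [← h.J_skew, real_inner_comm],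
      real_inner_comm x w, real_inner_comm y w, real_inner_comm y x, real_inner_comm z y,
      real_inner_comm z x, real_inner_comm z w]
    linear_combination c

end IsNearlyKahlerAlgebra

end Algebra

/-! ### Smoothness of sections -/

section SmoothSections

open Set VectorField Topology

variable {E : Type*} [NormedAddCommGroup E] [NormedSpace ℝ E] [FiniteDimensional ℝ E]
  {H : Type*} [TopologicalSpace H] {I : ModelWithCorners ℝ E H}
  {M : Type*} [TopologicalSpace M] [ChartedSpace H M]

omit [FiniteDimensional ℝ E] in
/-- A map into the space of linear maps on a finite-dimensional space is smooth if its values on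
vectors are. -/
theorem contMDiffAt_clm_of_apply {F G : Type*} [NormedAddCommGroup F] [NormedSpace ℝ F]
    [FiniteDimensional ℝ F] [NormedAddCommGroup G] [NormedSpace ℝ G] {n : WithTop ℕ∞}
    {g : M → F →L[ℝ] G} {x : M}
    (h : ∀ v, ContMDiffAt I 𝓘(ℝ, G) n (fun y ↦ g y v) x) :
    ContMDiffAt I 𝓘(ℝ, F →L[ℝ] G) n g x := by
  let b := Module.finBasis ℝ F
  have hsum : g = fun y ↦ ∑ i, ContinuousLinearMap.smulRightL ℝ F G
      (b.coord i).toContinuousLinearMap (g y (b i)) := by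
    funext y
    ext v
    conv_lhs => rw [← b.sum_repr v, map_sum]
    simp
  rw [hsum]
  refine ContMDiffAt.sum fun i _ ↦ ?_
  exact (ContinuousLinearMap.smulRightL ℝ F G
    (b.coord i).toContinuousLinearMap).contDiff.contMDiff.contMDiffAt.comp x (h (b i))

variable [IsManifold I ∞ M]

omit [FiniteDimensional ℝ E] in
theorem extend_symmL {x y : M} (hy : y ∈ (chartAt H x).source) (e : E) :
    extend E ((trivializationAt E (fun y : M ↦ TangentSpace I y) x).symmL ℝ x e) y =
      (trivializationAt E (fun y : M ↦ TangentSpace I y) x).symmL ℝ y e := by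
  set t := trivializationAt E (fun y : M ↦ TangentSpace I y) x with ht
  have hx : x ∈ t.baseSet := mem_baseSet_trivializationAt' x
  have hy' : y ∈ t.baseSet := by simpa [ht] using hy
  simp only [extend, ← ht]
  change t.symm y (t ⟨x, t.symmL ℝ x e⟩).2 = _
  rw [Trivialization.symmL_apply _ hx, Trivialization.apply_mk_symm _ hx,
    Trivialization.symmL_apply _ hy']

/-- A field of linear maps on the tangent bundle is smooth if its values on coordinate fields
are. -/
theorem contMDiffAt_hom_of_extend {F : Type*} [NormedAddCommGroup F] [NormedSpace ℝ F]
    {W : M → Type*} [TopologicalSpace (TotalSpace F W)] [∀ x, AddCommGroup (W x)]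
    [∀ x, Module ℝ (W x)] [∀ x, TopologicalSpace (W x)] [∀ x, IsTopologicalAddGroup (W x)]
    [∀ x, ContinuousSMul ℝ (W x)] [FiberBundle F W] [VectorBundle ℝ F W]
    {A : ∀ x : M, TangentSpace I x →L[ℝ] W x} {x : M}
    (h : ∀ v : TangentSpace I x, ContMDiffAt I (I.prod 𝓘(ℝ, F)) ∞
      (fun y ↦ TotalSpace.mk' F y (A y (extend E v y))) x) :
    ContMDiffAt I (I.prod 𝓘(ℝ, E →L[ℝ] F)) ∞
      (fun y ↦ TotalSpace.mk' (E →L[ℝ] F) (E := fun y : M ↦ TangentSpace I y →L[ℝ] W y)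
        y (A y)) x := by
  rw [contMDiffAt_hom_bundle]
  refine ⟨contMDiffAt_id, contMDiffAt_clm_of_apply fun e ↦ ?_⟩
  have he := h ((trivializationAt E (fun y : M ↦ TangentSpace I y) x).symmL ℝ x e)
  rw [contMDiffAt_section] at he
  refine he.congr_of_eventuallyEq ?_
  have hW : ∀ᶠ y in 𝓝 x, y ∈ (trivializationAt F W x).baseSet :=
    (trivializationAt F W x).open_baseSet.mem_nhds (mem_baseSet_trivializationAt' x)
  filter_upwards [chart_source_mem_nhds H x, hW] with y hy hy'
  rw [extend_symmL hy]
  exact Trivialization.continuousLinearMapAt_apply_of_mem ℝ _ hy' _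

/-- A field of linear maps on the tangent bundle is smooth if it maps smooth vector fields to smooth
sections. -/
theorem contMDiff_hom_of_apply [T2Space M] {F : Type*} [NormedAddCommGroup F] [NormedSpace ℝ F]
    {W : M → Type*} [TopologicalSpace (TotalSpace F W)] [∀ x, AddCommGroup (W x)]
    [∀ x, Module ℝ (W x)] [∀ x, TopologicalSpace (W x)] [∀ x, IsTopologicalAddGroup (W x)]
    [∀ x, ContinuousSMul ℝ (W x)] [FiberBundle F W] [VectorBundle ℝ F W]
    {A : ∀ x : M, TangentSpace I x →L[ℝ] W x}
    (h : ∀ X : ∀ y : M, TangentSpace I y, IsSmoothVectorField X →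
      ContMDiff I (I.prod 𝓘(ℝ, F)) ∞ (fun y ↦ TotalSpace.mk' F y (A y (X y)))) :
    ContMDiff I (I.prod 𝓘(ℝ, E →L[ℝ] F)) ∞
      (fun y ↦ TotalSpace.mk' (E →L[ℝ] F) (E := fun y : M ↦ TangentSpace I y →L[ℝ] W y)
        y (A y)) := by
  intro x
  refine contMDiffAt_hom_of_extend fun v ↦ ?_
  obtain ⟨X, hX, hv⟩ := exists_isSmoothVectorField_eventuallyEq v
  refine (h X hX x).congr_of_eventuallyEq ?_
  filter_upwards [hv] with y hy
  rw [hy]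

theorem isSmoothEndo_of_apply [T2Space M]
    {A : ∀ x : M, TangentSpace I x →L[ℝ] TangentSpace I x}
    (h : ∀ X : ∀ y : M, TangentSpace I y, IsSmoothVectorField X →
      IsSmoothVectorField fun y ↦ A y (X y)) : IsSmoothEndo A :=
  contMDiff_hom_of_apply h

theorem isSmoothBilin_of_apply [T2Space M]
    {B : ∀ x : M, TangentSpace I x →L[ℝ] TangentSpace I x →L[ℝ] TangentSpace I x}
    (h : ∀ X Y : ∀ y : M, TangentSpace I y, IsSmoothVectorField X → IsSmoothVectorField Y →
      IsSmoothVectorField fun y ↦ B y (X y) (Y y)) : IsSmoothBilin B :=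
  contMDiff_hom_of_apply fun X hX ↦ contMDiff_hom_of_apply fun Y hY ↦ h X Y hX hY

variable [RiemannianBundle (fun x : M ↦ TangentSpace I x)]
  [IsContMDiffRiemannianBundle I ∞ E (fun x : M ↦ TangentSpace I x)]

/-- A vector field is smooth if its inner products with smooth vector fields are. -/
theorem isSmoothVectorField_of_inner [T2Space M] {W : ∀ x : M, TangentSpace I x}
    (h : ∀ Y : ∀ y : M, TangentSpace I y, IsSmoothVectorField Y →
      ContMDiff I 𝓘(ℝ, ℝ) ∞ fun y ↦ (inner ℝ (W y) (Y y) : ℝ)) : IsSmoothVectorField W := by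
  intro x
  have : CompleteSpace E := FiniteDimensional.complete ℝ E
  let t := trivializationAt E (fun y : M ↦ TangentSpace I y) x
  have hext : ∀ v : TangentSpace I x, ContMDiffAt I I.tangent ∞
      (fun y ↦ (⟨y, extend E v y⟩ : TangentBundle I M)) x := by
    intro v
    obtain ⟨s, hs, h⟩ := exists_contMDiffOn_extend (k := ∞) I E v
    exact h.contMDiffAt hs
  -- the Gram operator of the metric in the local frame
  let Γ : M → E →L[ℝ] E →L[ℝ] ℝ := fun y ↦
    ContinuousLinearMap.bilinearComp (innerSL ℝ (E := TangentSpace I y)) (t.symmL ℝ y) (t.symmL ℝ y)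
  let ℓ : M → E →L[ℝ] ℝ := fun y ↦ innerSL ℝ (W y) ∘L t.symmL ℝ y
  have hΓ : ContMDiffAt I 𝓘(ℝ, E →L[ℝ] E →L[ℝ] ℝ) ∞ Γ x := by
    refine contMDiffAt_clm_of_apply fun e ↦ contMDiffAt_clm_of_apply fun e' ↦ ?_
    have := ContMDiffAt.inner_bundle (F := E) (E := fun x : M ↦ TangentSpace I x)
      (hext (t.symmL ℝ x e)) (hext (t.symmL ℝ x e'))
    refine this.congr_of_eventuallyEq ?_
    filter_upwards [chart_source_mem_nhds H x] with y hy
    rw [extend_symmL hy, extend_symmL hy]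
    rfl
  have hℓ : ContMDiffAt I 𝓘(ℝ, E →L[ℝ] ℝ) ∞ ℓ x := by
    refine contMDiffAt_clm_of_apply fun e ↦ ?_
    obtain ⟨Y, hY, hv⟩ := exists_isSmoothVectorField_eventuallyEq (t.symmL ℝ x e)
    refine (h Y hY x).congr_of_eventuallyEq ?_
    filter_upwards [hv, chart_source_mem_nhds H x] with y hy hy'
    rw [hy, extend_symmL hy']
    rfl
  have hinv : ∀ y, y ∈ (chartAt H x).source → (Γ y).IsInvertible := by
    intro y hy
    have hy' : y ∈ t.baseSet := by simpa [t] using hy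
    have hinj : Function.Injective (Γ y).toLinearMap := by
      rw [← LinearMap.ker_eq_bot, LinearMap.ker_eq_bot']
      intro e he
      have h1 : (inner ℝ (t.symmL ℝ y e) (t.symmL ℝ y e) : ℝ) = 0 :=
        congrArg (fun L : E →L[ℝ] ℝ ↦ L e) he
      have h2 : t.symmL ℝ y e = 0 := inner_self_eq_zero.1 h1
      have h3 := t.continuousLinearMapAt_symmL (R := ℝ) hy' e
      rw [h2, map_zero] at h3
      exact h3.symm
    have hfr : Module.finrank ℝ E = Module.finrank ℝ (E →L[ℝ] ℝ) := by
      rw [← LinearMap.toContinuousLinearMap.finrank_eq]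
      exact (Subspace.dual_finrank_eq (K := ℝ) (V := E)).symm
    let e := LinearEquiv.ofInjectiveOfFinrankEq (Γ y).toLinearMap hinj hfr
    exact ⟨e.toContinuousLinearEquiv, by ext; rfl⟩
  refine (contMDiffAt_section x).2 ?_
  have key : ContMDiffAt I 𝓘(ℝ, E) ∞ (fun y ↦ (Γ y).inverse (ℓ y)) x := by
    obtain ⟨e, he⟩ := hinv x (mem_chart_source H x)
    have h1 : ContMDiffAt 𝓘(ℝ, E →L[ℝ] E →L[ℝ] ℝ) 𝓘(ℝ, (E →L[ℝ] ℝ) →L[ℝ] E) ∞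
        ContinuousLinearMap.inverse (Γ x) := by
      rw [← he]
      exact (contDiffAt_map_inverse e).contMDiffAt
    exact (h1.comp x hΓ).clm_apply hℓ
  refine key.congr_of_eventuallyEq ?_
  filter_upwards [chart_source_mem_nhds H x] with y hy
  obtain ⟨e, he⟩ := hinv y hy
  have : ℓ y = e (t ⟨y, W y⟩).2 := by
    have h1 : e (t ⟨y, W y⟩).2 = Γ y (t ⟨y, W y⟩).2 := congrArg (fun L ↦ L (t ⟨y, W y⟩).2) he
    rw [h1]
    ext v
    change (inner ℝ (W y) (t.symmL ℝ y v) : ℝ) =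
      inner ℝ (t.symmL ℝ y (t ⟨y, W y⟩).2) (t.symmL ℝ y v)
    rw [symmL_trivializationAt_snd hy]
  rw [this, ← he, ContinuousLinearMap.inverse_equiv]
  exact (e.symm_apply_apply _).symm

end SmoothSections

/-! ### Commuting vector fields and covariant derivatives of tensors -/

section Tensors

open Set VectorField Topology

variable {E : Type*} [NormedAddCommGroup E] [NormedSpace ℝ E]
  {H : Type*} [TopologicalSpace H] {I : ModelWithCorners ℝ E H}
  {M : Type*} [TopologicalSpace M] [ChartedSpace H M] [IsManifold I ∞ M]

theorem IsSmoothEndo.apply {A : ∀ x : M, TangentSpace I x →L[ℝ] TangentSpace I x}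
    (hA : IsSmoothEndo A) {X : ∀ x : M, TangentSpace I x} (hX : IsSmoothVectorField X) :
    IsSmoothVectorField fun y ↦ A y (X y) :=
  ContMDiff.clm_bundle_apply (F₁ := E) (F₂ := E) hA hX

theorem IsSmoothBilin.apply
    {B : ∀ x : M, TangentSpace I x →L[ℝ] TangentSpace I x →L[ℝ] TangentSpace I x}
    (hB : IsSmoothBilin B) {X Y : ∀ x : M, TangentSpace I x} (hX : IsSmoothVectorField X)
    (hY : IsSmoothVectorField Y) :
    IsSmoothVectorField fun y ↦ B y (X y) (Y y) :=
  ContMDiff.clm_bundle_apply₂ (F₁ := E) (F₂ := E) (F₃ := E) hB hX hY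

theorem IsSmoothVectorField.add {X Y : ∀ x : M, TangentSpace I x} (hX : IsSmoothVectorField X)
    (hY : IsSmoothVectorField Y) : IsSmoothVectorField fun y ↦ X y + Y y :=
  ContMDiff.add_section (F := E) hX hY

theorem IsSmoothVectorField.sub {X Y : ∀ x : M, TangentSpace I x} (hX : IsSmoothVectorField X)
    (hY : IsSmoothVectorField Y) : IsSmoothVectorField fun y ↦ X y - Y y :=
  ContMDiff.sub_section (F := E) hX hY

theorem IsSmoothVectorField.smul {g : M → ℝ} {X : ∀ x : M, TangentSpace I x}
    (hg : ContMDiff I 𝓘(ℝ, ℝ) ∞ g) (hX : IsSmoothVectorField X) :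
    IsSmoothVectorField fun y ↦ g y • X y :=
  ContMDiff.smul_section (F := E) hg hX

theorem mdifferentiableAt_bilin_apply
    {B : ∀ x : M, TangentSpace I x →L[ℝ] TangentSpace I x →L[ℝ] TangentSpace I x}
    (hB : IsSmoothBilin B) {x : M} {X Y : ∀ x : M, TangentSpace I x}
    (hX : MDifferentiableAt I I.tangent (fun y ↦ (⟨y, X y⟩ : TangentBundle I M)) x)
    (hY : MDifferentiableAt I I.tangent (fun y ↦ (⟨y, Y y⟩ : TangentBundle I M)) x) :
    MDifferentiableAt I I.tangent (fun y ↦ (⟨y, B y (X y) (Y y)⟩ : TangentBundle I M)) x :=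
  MDiffAlongAt.apply_bilin (f := fun y ↦ y) hB hX hY

variable (D : CovariantDerivative I E (TangentSpace I : M → Type _))

theorem cov_neg {x : M} {X : ∀ x : M, TangentSpace I x}
    (hX : MDifferentiableAt I I.tangent (fun y ↦ (⟨y, X y⟩ : TangentBundle I M)) x) :
    D (fun y ↦ -X y) x = -D X x := by
  have h := D.isCovariantDerivativeOn.smul_const (-1) hX
  rwa [neg_one_smul, neg_one_smul] at h

variable [FiniteDimensional ℝ E]

/-- Every tangent vector at `x` extends to a smooth vector field, in such a way that these fields
commute near `x`. -/
theorem exists_commuting_fields [T2Space M] [I.Boundaryless] (x : M) :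
    ∃ X : TangentSpace I x → ∀ y : M, TangentSpace I y,
      (∀ v, IsSmoothVectorField (X v)) ∧ (∀ v, X v x = v) ∧
        ∀ v w, ∀ᶠ y in 𝓝 x, mlieBracket I (X v) (X w) y = 0 := by
  have : CompleteSpace E := FiniteDimensional.complete ℝ E
  choose X hX h using fun v : TangentSpace I x ↦ exists_isSmoothVectorField_eventuallyEq v
  refine ⟨X, hX, fun v ↦ by rw [(h v).self_of_nhds, extend_apply_self], fun v w ↦ ?_⟩
  filter_upwards [Filter.EventuallyEq.mlieBracket_vectorField (h v) (h w),
    eventually_mlieBracket_extend x v w] with y h1 h2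
  rw [h1, h2]

/-- The vector `∇_w (B(Y, Z)) - B(∇_w Y, Z) - B(Y, ∇_w Z)` at `x`. -/
def covDerivBilinAux
    (B : ∀ x : M, TangentSpace I x →L[ℝ] TangentSpace I x →L[ℝ] TangentSpace I x) (x : M)
    (w : TangentSpace I x) (Y Z : ∀ x : M, TangentSpace I x) : TangentSpace I x :=
  D (fun y ↦ B y (Y y) (Z y)) x w - B x (D Y x w) (Z x) - B x (Y x) (D Z x w)

omit [FiniteDimensional ℝ E] in
theorem tensorialAt_covDerivBilinAux_left
    {B : ∀ x : M, TangentSpace I x →L[ℝ] TangentSpace I x →L[ℝ] TangentSpace I x}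
    (hB : IsSmoothBilin B) {x : M} (w : TangentSpace I x) {Z : ∀ x : M, TangentSpace I x}
    (hZ : MDifferentiableAt I I.tangent (fun y ↦ (⟨y, Z y⟩ : TangentBundle I M)) x) :
    TensorialAt I E (fun Y ↦ covDerivBilinAux D B x w Y Z) x where
  smul {f σ} hf hσ := by
    have h1 : (fun y ↦ B y ((f • σ) y) (Z y)) = f • (fun y ↦ B y (σ y) (Z y)) := by
      funext y
      simp
    simp only [covDerivBilinAux]
    rw [h1, D.isCovariantDerivativeOn.leibniz (mdifferentiableAt_bilin_apply hB hσ hZ) hf,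
      D.isCovariantDerivativeOn.leibniz hσ hf]
    simp
    module
  add {σ σ'} hσ hσ' := by
    have h1 : (fun y ↦ B y ((σ + σ') y) (Z y)) =
        (fun y ↦ B y (σ y) (Z y)) + (fun y ↦ B y (σ' y) (Z y)) := by
      funext y
      simp
    simp only [covDerivBilinAux]
    rw [h1, D.isCovariantDerivativeOn.add (mdifferentiableAt_bilin_apply hB hσ hZ)
        (mdifferentiableAt_bilin_apply hB hσ' hZ), D.isCovariantDerivativeOn.add hσ hσ']
    simp
    abel

omit [FiniteDimensional ℝ E] in
theorem tensorialAt_covDerivBilinAux_right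
    {B : ∀ x : M, TangentSpace I x →L[ℝ] TangentSpace I x →L[ℝ] TangentSpace I x}
    (hB : IsSmoothBilin B) {x : M} (w : TangentSpace I x) {Y : ∀ x : M, TangentSpace I x}
    (hY : MDifferentiableAt I I.tangent (fun y ↦ (⟨y, Y y⟩ : TangentBundle I M)) x) :
    TensorialAt I E (fun Z ↦ covDerivBilinAux D B x w Y Z) x where
  smul {f σ} hf hσ := by
    have h1 : (fun y ↦ B y (Y y) ((f • σ) y)) = f • (fun y ↦ B y (Y y) (σ y)) := by
      funext y
      simp
    simp only [covDerivBilinAux]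
    rw [h1, D.isCovariantDerivativeOn.leibniz (mdifferentiableAt_bilin_apply hB hY hσ) hf,
      D.isCovariantDerivativeOn.leibniz hσ hf]
    simp
    module
  add {σ σ'} hσ hσ' := by
    have h1 : (fun y ↦ B y (Y y) ((σ + σ') y)) =
        (fun y ↦ B y (Y y) (σ y)) + (fun y ↦ B y (Y y) (σ' y)) := by
      funext y
      simp
    simp only [covDerivBilinAux]
    rw [h1, D.isCovariantDerivativeOn.add (mdifferentiableAt_bilin_apply hB hY hσ)
        (mdifferentiableAt_bilin_apply hB hY hσ'), D.isCovariantDerivativeOn.add hσ hσ']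
    simp
    abel

/-- The covariant derivative `∇B` of a smooth `(1,2)`-tensor field `B`, as a tensor:
`covDerivBilin D hB x w y z` is `(∇_w B)(y, z)`. -/
def covDerivBilin
    {B : ∀ x : M, TangentSpace I x →L[ℝ] TangentSpace I x →L[ℝ] TangentSpace I x}
    (hB : IsSmoothBilin B) (x : M) (w : TangentSpace I x) :
    TangentSpace I x →L[ℝ] TangentSpace I x →L[ℝ] TangentSpace I x :=
  TensorialAt.mkHom₂ (covDerivBilinAux D B x w) x
    (fun _ hZ ↦ tensorialAt_covDerivBilinAux_left D hB w hZ)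
    (fun _ hY ↦ tensorialAt_covDerivBilinAux_right D hB w hY)

theorem covDerivBilin_apply_eq_extend
    {B : ∀ x : M, TangentSpace I x →L[ℝ] TangentSpace I x →L[ℝ] TangentSpace I x}
    (hB : IsSmoothBilin B) (x : M) (w y z : TangentSpace I x) :
    covDerivBilin D hB x w y z = D (fun p ↦ B p (extend E y p) (extend E z p)) x w -
      B x (D (extend E y) x w) z - B x y (D (extend E z) x w) := by
  have h : covDerivBilin D hB x w y z =
    covDerivBilinAux D B x w (extend E y) (extend E z) := rfl
  rw [h, covDerivBilinAux, extend_apply_self, extend_apply_self]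

theorem cov_bilin_apply
    {B : ∀ x : M, TangentSpace I x →L[ℝ] TangentSpace I x →L[ℝ] TangentSpace I x}
    (hB : IsSmoothBilin B) (x : M) {Y Z : ∀ x : M, TangentSpace I x}
    (hY : MDifferentiableAt I I.tangent (fun y ↦ (⟨y, Y y⟩ : TangentBundle I M)) x)
    (hZ : MDifferentiableAt I I.tangent (fun y ↦ (⟨y, Z y⟩ : TangentBundle I M)) x)
    (w : TangentSpace I x) :
    D (fun y ↦ B y (Y y) (Z y)) x w = covDerivBilin D hB x w (Y x) (Z x) +
      B x (D Y x w) (Z x) + B x (Y x) (D Z x w) := by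
  have h := TensorialAt.mkHom₂_apply
    (fun _ hZ ↦ tensorialAt_covDerivBilinAux_left D hB w hZ)
    (fun _ hY ↦ tensorialAt_covDerivBilinAux_right D hB w hY) hY hZ
  simp only [covDerivBilin]
  rw [h, covDerivBilinAux]
  abel

theorem cov_endo_apply {A : ∀ x : M, TangentSpace I x →L[ℝ] TangentSpace I x}
    (hA : IsSmoothEndo A) {x : M} {Y : ∀ x : M, TangentSpace I x}
    (hY : MDifferentiableAt I I.tangent (fun y ↦ (⟨y, Y y⟩ : TangentBundle I M)) x)
    (u : TangentSpace I x) :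
    D (fun y ↦ A y (Y y)) x u = covDerivEndo D hA x u (Y x) + A x (D Y x u) := by
  rw [covDerivEndo_apply D hA x u hY]
  abel

variable {D} [RiemannianBundle (fun x : M ↦ TangentSpace I x)]
  [IsContMDiffRiemannianBundle I ∞ E (fun x : M ↦ TangentSpace I x)]

omit [FiniteDimensional ℝ E] in
theorem IsSmoothVectorField.inner {X Y : ∀ x : M, TangentSpace I x}
    (hX : IsSmoothVectorField X) (hY : IsSmoothVectorField Y) :
    ContMDiff I 𝓘(ℝ, ℝ) ∞ fun y ↦ (inner ℝ (X y) (Y y) : ℝ) :=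
  ContMDiff.inner_bundle (F := E) (E := fun x : M ↦ TangentSpace I x) hX hY

theorem IsLeviCivita.isSmoothVectorField_cov (hD : IsLeviCivita D)
    {X Y : ∀ x : M, TangentSpace I x} (hX : IsSmoothVectorField X) (hY : IsSmoothVectorField Y) :
    IsSmoothVectorField fun y ↦ D Y y (X y) := by
  have h := hD.smooth.contMDiff.contMDiff (σ := Y) (contMDiffOn_univ.2 hY)
  exact ContMDiff.clm_bundle_apply (F₁ := E) (F₂ := E) (contMDiffOn_univ.1 h) hX

theorem isSmoothBilin_covDerivEndo [T2Space M] (hD : IsLeviCivita D)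
    {A : ∀ x : M, TangentSpace I x →L[ℝ] TangentSpace I x} (hA : IsSmoothEndo A) :
    IsSmoothBilin (covDerivEndo D hA) := by
  refine isSmoothBilin_of_apply fun X Y hX hY ↦ ?_
  have h : (fun y ↦ covDerivEndo D hA y (X y) (Y y)) =
      fun y ↦ D (fun z ↦ A z (Y z)) y (X y) - A y (D Y y (X y)) := by
    funext y
    exact covDerivEndo_apply D hA y (X y) (hY.mdifferentiableAt y)
  rw [h]
  exact (hD.isSmoothVectorField_cov hX (hA.apply hY)).sub
    (hA.apply (hD.isSmoothVectorField_cov hX hY))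

theorem inner_covDerivEndo_skew (hD : IsLeviCivita D)
    {A : ∀ x : M, TangentSpace I x →L[ℝ] TangentSpace I x} (hA : IsSmoothEndo A)
    (hskew : ∀ x (u v : TangentSpace I x), (inner ℝ (A x u) v : ℝ) = -inner ℝ u (A x v))
    (x : M) (u v w : TangentSpace I x) :
    (inner ℝ (covDerivEndo D hA x u v) w : ℝ) = -inner ℝ v (covDerivEndo D hA x u w) := by
  have hv := mdifferentiableAt_extend I E v
  have hw := mdifferentiableAt_extend I E w
  have h1 := hD.mvfderiv_inner (hA.mdifferentiableAt_apply hv) hw u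
  have h2 := hD.mvfderiv_inner hv (hA.mdifferentiableAt_apply hw) u
  have h3 : mvfderiv I (fun y ↦ (inner ℝ (A y (extend E v y)) (extend E w y) : ℝ)) x u =
      -mvfderiv I (fun y ↦ (inner ℝ (extend E v y) (A y (extend E w y)) : ℝ)) x u := by
    simp only [hskew]
    have := mvfderiv_neg (I := I) (x := x)
      (g := fun y ↦ (inner ℝ (extend E v y) (A y (extend E w y)) : ℝ))
    exact congrArg (fun L : TangentSpace I x →L[ℝ] ℝ ↦ L u) this
  rw [h1, h2, cov_endo_apply D hA hv, cov_endo_apply D hA hw] at h3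
  simp only [extend_apply_self, inner_add_left, inner_add_right, hskew] at h3
  linarith

/-- The exterior derivative of the two-form `g(A · , ·)`, for a skew-symmetric `A`, evaluated on
commuting vector fields. -/
theorem mvfderiv_inner_endo_cyclic (hD : IsLeviCivita D)
    {A : ∀ x : M, TangentSpace I x →L[ℝ] TangentSpace I x} (hA : IsSmoothEndo A)
    (hskew : ∀ x (u v : TangentSpace I x), (inner ℝ (A x u) v : ℝ) = -inner ℝ u (A x v))
    {X Y Z : ∀ x : M, TangentSpace I x} (hX : IsSmoothVectorField X) (hY : IsSmoothVectorField Y)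
    (hZ : IsSmoothVectorField Z) {x : M} (hXY : mlieBracket I X Y x = 0)
    (hYZ : mlieBracket I Y Z x = 0) (hZX : mlieBracket I Z X x = 0) :
    mvfderiv I (fun y ↦ (inner ℝ (A y (Y y)) (Z y) : ℝ)) x (X x) +
      mvfderiv I (fun y ↦ (inner ℝ (A y (Z y)) (X y) : ℝ)) x (Y x) +
      mvfderiv I (fun y ↦ (inner ℝ (A y (X y)) (Y y) : ℝ)) x (Z x) =
    inner ℝ (covDerivEndo D hA x (X x) (Y x)) (Z x) +
      inner ℝ (covDerivEndo D hA x (Y x) (Z x)) (X x) +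
      inner ℝ (covDerivEndo D hA x (Z x) (X x)) (Y x) := by
  have hX' := hX.mdifferentiableAt x
  have hY' := hY.mdifferentiableAt x
  have hZ' := hZ.mdifferentiableAt x
  have : CompleteSpace E := FiniteDimensional.complete ℝ E
  have h1 := hD.sub_eq_mlieBracket hX' hY'
  have h2 := hD.sub_eq_mlieBracket hY' hZ'
  have h3 := hD.sub_eq_mlieBracket hZ' hX'
  rw [hXY, sub_eq_zero] at h1
  rw [hYZ, sub_eq_zero] at h2
  rw [hZX, sub_eq_zero] at h3
  rw [hD.mvfderiv_inner (hA.mdifferentiableAt_apply hY') hZ',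
    hD.mvfderiv_inner (hA.mdifferentiableAt_apply hZ') hX',
    hD.mvfderiv_inner (hA.mdifferentiableAt_apply hX') hY',
    cov_endo_apply D hA hX', cov_endo_apply D hA hY', cov_endo_apply D hA hZ', h1, h2, h3]
  simp only [inner_add_left, hskew x (D _ _ _)]
  rw [real_inner_comm (D Z x (X x)), real_inner_comm (D X x (Y x)), real_inner_comm (D Y x (Z x))]
  ring

end Tensors

/-! ### The tensor `∇J` of a strict nearly Kähler manifold of constant type one -/

section NearlyKahler

open Set VectorField Topology

variable {E : Type*} [NormedAddCommGroup E] [NormedSpace ℝ E] [FiniteDimensional ℝ E]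
  {H : Type*} [TopologicalSpace H] {I : ModelWithCorners ℝ E H}
  {M : Type*} [TopologicalSpace M] [ChartedSpace H M] [IsManifold I ∞ M]
  [RiemannianBundle (fun x : M ↦ TangentSpace I x)]
  [IsContMDiffRiemannianBundle I ∞ E (fun x : M ↦ TangentSpace I x)]
  {D : CovariantDerivative I E (TangentSpace I : M → Type _)}
  {J : ∀ x : M, TangentSpace I x →L[ℝ] TangentSpace I x} {hJ : IsAlmostHermitian J}

omit [FiniteDimensional ℝ E] [IsContMDiffRiemannianBundle I ∞ E fun x : M ↦ TangentSpace I x] in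
theorem IsAlmostHermitian.skew (hJ : IsAlmostHermitian J) (x : M) (u v : TangentSpace I x) :
    (inner ℝ (J x u) v : ℝ) = -inner ℝ u (J x v) := by
  have := hJ.inner_map x u (J x v)
  rw [hJ.sq, inner_neg_right] at this
  linarith

/-- The identity `G(u, Jv) = -J G(u, v)` comes from differentiating `J² = -1`, and the skew-symmetry
of `G u` from that of `J`. -/
theorem isNearlyKahlerAlgebra (hD : IsLeviCivita D) (hNK : IsStrictNearlyKahler D hJ)
    (htype : HasConstantType D hJ 1) (x : M) :
    IsNearlyKahlerAlgebra (J x) (nablaJ D hJ x) where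
  sq := hJ.sq x
  inner_map := hJ.inner_map x
  skew := hNK.skew x
  inner_skew := inner_covDerivEndo_skew hD hJ.smooth hJ.skew x
  map_J u v := by
    have hv := mdifferentiableAt_extend I E v
    have h1 := cov_endo_apply D hJ.smooth (hJ.smooth.mdifferentiableAt_apply hv) u
    have h2 := cov_endo_apply D hJ.smooth hv u
    simp only [hJ.sq, extend_apply_self] at h1 h2
    rw [cov_neg D hv, neg_apply, h2, map_add, hJ.sq] at h1
    change covDerivEndo D hJ.smooth x u (J x v) = -J x (covDerivEndo D hJ.smooth x u v)
    rw [eq_neg_iff_add_eq_zero]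
    have h3 := sub_eq_zero.2 h1.symm
    rw [← h3]
    abel
  type_one u v w z := by
    have := htype x u v w z
    rwa [one_mul] at this

theorem isSmoothBilin_nablaJ [T2Space M] (hD : IsLeviCivita D) : IsSmoothBilin (nablaJ D hJ) :=
  isSmoothBilin_covDerivEndo hD hJ.smooth

/-- The covariant derivative of `G = ∇J` on a strict nearly Kähler manifold of dimension six and
of constant type one. By `IsNearlyKahlerAlgebra.deriv_eq` it suffices to differentiate the algebraic
identities for `G`, and to use that the three-form `3 g(G(·, ·), ·)` is closed, being the exterior
derivative of the fundamental form `g(J · , ·)`. -/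
theorem covDerivBilin_nablaJ [T2Space M] [I.Boundaryless] (hdim : Module.finrank ℝ E = 6)
    (hD : IsLeviCivita D) (hNK : IsStrictNearlyKahler D hJ) (htype : HasConstantType D hJ 1)
    (hG : IsSmoothBilin (nablaJ D hJ)) (x : M) (w y z : TangentSpace I x) :
    covDerivBilin D hG x w y z =
      (inner ℝ y (J x z) : ℝ) • w + (inner ℝ w z : ℝ) • J x y - (inner ℝ w y : ℝ) • J x z := by
  have halg := isNearlyKahlerAlgebra hD hNK htype
  have : CompleteSpace E := FiniteDimensional.complete ℝ E
  have hd : ∀ u : TangentSpace I x, MDifferentiableAt I I.tangent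
    (fun p ↦ (⟨p, extend E u p⟩ : TangentBundle I M)) x := mdifferentiableAt_extend I E
  have hprod : ∀ w u v : TangentSpace I x,
      D (fun p ↦ nablaJ D hJ p (extend E u p) (extend E v p)) x w = covDerivBilin D hG x w u v +
        nablaJ D hJ x (D (extend E u) x w) v + nablaJ D hJ x u (D (extend E v) x w) := by
    intro w u v
    have := cov_bilin_apply D hG x (hd u) (hd v) w
    simpa only [extend_apply_self] using this
  let T : TangentSpace I x →ₗ[ℝ] TangentSpace I x →ₗ[ℝ] TangentSpace I x →ₗ[ℝ] TangentSpace I x :=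
    LinearMap.mk₂ ℝ (fun w y ↦ (covDerivBilin D hG x w y).toLinearMap)
      (by
        intro w w' y
        ext z
        simp only [ContinuousLinearMap.coe_coe, LinearMap.add_apply, covDerivBilin_apply_eq_extend,
          map_add, add_apply]
        abel)
      (by
        intro r w y
        ext z
        simp only [ContinuousLinearMap.coe_coe, LinearMap.smul_apply,
          covDerivBilin_apply_eq_extend, map_smul, smul_apply, smul_sub])
      (by intros; ext; simp) (by intros; ext; simp)
  have hT : ∀ w y z, T w y z = covDerivBilin D hG x w y z := fun w y z ↦ rfl
  refine (halg x).deriv_eq hdim T ?_ ?_ ?_ ?_ ?_ w y z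
  -- `G` is skew-symmetric
  · intro w y z
    have h : D (fun p ↦ nablaJ D hJ p (extend E y p) (extend E z p)) x =
        -D (fun p ↦ nablaJ D hJ p (extend E z p) (extend E y p)) x := by
      rw [← cov_neg D (mdifferentiableAt_bilin_apply hG (hd z) (hd y))]
      congr 1
      funext p
      exact hNK.skew p _ _
    rw [hT, hT, covDerivBilin_apply_eq_extend, covDerivBilin_apply_eq_extend, h,
      hNK.skew x y, hNK.skew x _ z, neg_apply]
    abel
  -- `G u` is skew-adjoint
  · intro w y z v
    have h1 := hD.mvfderiv_inner (mdifferentiableAt_bilin_apply hG (hd y) (hd z)) (hd v) w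
    have h2 := hD.mvfderiv_inner (hd z) (mdifferentiableAt_bilin_apply hG (hd y) (hd v)) w
    simp only [(halg _).inner_skew _ (extend E z _)] at h1
    rw [mvfderiv_fun_neg, neg_apply, h2, hprod, hprod] at h1
    simp only [extend_apply_self, inner_add_left, inner_add_right, (halg x).inner_skew _ z,
      (halg x).inner_skew _ (D _ _ _)] at h1
    rw [hT, hT]
    linarith
  -- `G u` anticommutes with `J`
  · intro w y z
    have h1 := cov_endo_apply D hJ.smooth (mdifferentiableAt_bilin_apply hG (hd y) (hd z)) w
    have h2 := cov_bilin_apply D hG x (hd y) (hJ.smooth.mdifferentiableAt_apply (hd z)) w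
    have h3 := cov_endo_apply D hJ.smooth (hd z) w
    simp only [(halg _).map_J] at h2
    rw [cov_neg D (hJ.smooth.mdifferentiableAt_apply
      (mdifferentiableAt_bilin_apply hG (hd y) (hd z))), neg_apply, h1, hprod, h3] at h2
    simp only [extend_apply_self, map_add, (halg x).map_J] at h2
    change -(nablaJ D hJ x w (nablaJ D hJ x y z) + _) = _ + _ + (nablaJ D hJ x y
      (nablaJ D hJ x w z) + _) at h2
    rw [hT, hT, ← sub_eq_zero]
    rw [← sub_eq_zero] at h2
    rw [← neg_eq_zero, ← h2]
    abel
  -- the norm of `G(y, z)` is prescribed by the type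
  · intro w y z
    have hJy := hJ.smooth.mdifferentiableAt_apply (hd y)
    have hyz := mdifferentiableAt_bilin_apply hG (hd y) (hd z)
    have hin : ∀ {A B : ∀ p : M, TangentSpace I p},
        MDifferentiableAt I I.tangent (fun p ↦ (⟨p, A p⟩ : TangentBundle I M)) x →
        MDifferentiableAt I I.tangent (fun p ↦ (⟨p, B p⟩ : TangentBundle I M)) x →
        MDifferentiableAt I 𝓘(ℝ, ℝ) (fun p ↦ (inner ℝ (A p) (B p) : ℝ)) x :=
      fun hA hB ↦ MDiffAlongAt.inner (f := fun p ↦ p) hA hB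
    have hfun : (fun p ↦ (inner ℝ (nablaJ D hJ p (extend E y p) (extend E z p))
        (nablaJ D hJ p (extend E y p) (extend E z p)) : ℝ)) =
        fun p ↦ (inner ℝ (extend E y p) (extend E y p) * inner ℝ (extend E z p) (extend E z p) -
          inner ℝ (extend E y p) (extend E z p) * inner ℝ (extend E y p) (extend E z p) -
          inner ℝ (J p (extend E y p)) (extend E z p) *
            inner ℝ (J p (extend E y p)) (extend E z p) : ℝ) := by
      funext p
      rw [(halg p).type_one, (halg p).inner_J_self, real_inner_comm (extend E y p) (extend E z p),
        real_inner_comm (J p (extend E y p)) (extend E z p)]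
      ring
    have h1 := hD.mvfderiv_inner hyz hyz w
    rw [hfun] at h1
    let f₁ : M → ℝ := fun p ↦ inner ℝ (extend E y p) (extend E y p)
    let f₂ : M → ℝ := fun p ↦ inner ℝ (extend E z p) (extend E z p)
    let f₃ : M → ℝ := fun p ↦ inner ℝ (extend E y p) (extend E z p)
    let f₄ : M → ℝ := fun p ↦ inner ℝ (J p (extend E y p)) (extend E z p)
    have hf₁ : MDifferentiableAt I 𝓘(ℝ, ℝ) f₁ x := hin (hd y) (hd y)
    have hf₂ : MDifferentiableAt I 𝓘(ℝ, ℝ) f₂ x := hin (hd z) (hd z)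
    have hf₃ : MDifferentiableAt I 𝓘(ℝ, ℝ) f₃ x := hin (hd y) (hd z)
    have hf₄ : MDifferentiableAt I 𝓘(ℝ, ℝ) f₄ x := hin hJy (hd z)
    replace h1 : mvfderiv I (f₁ * f₂ - f₃ * f₃ - f₄ * f₄) x w = _ := h1
    rw [mvfderiv_sub ((hf₁.mul hf₂).sub (hf₃.mul hf₃)) (hf₄.mul hf₄),
      mvfderiv_sub (hf₁.mul hf₂) (hf₃.mul hf₃), mvfderiv_mul hf₁ hf₂, mvfderiv_mul hf₃ hf₃,
      mvfderiv_mul hf₄ hf₄] at h1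
    simp only [sub_apply, add_apply, smul_apply, smul_eq_mul, f₁, f₂, f₃, f₄] at h1
    rw [hD.mvfderiv_inner (hd y) (hd y), hD.mvfderiv_inner (hd z) (hd z),
      hD.mvfderiv_inner (hd y) (hd z), hD.mvfderiv_inner hJy (hd z),
      cov_endo_apply D hJ.smooth (hd y), hprod] at h1
    simp only [extend_apply_self, inner_add_left, inner_add_right] at h1
    have t₁ := (halg x).type_one (D (extend E y) x w) z y z
    have t₂ := (halg x).type_one y (D (extend E z) x w) y z
    rw [show (inner ℝ z (J x z) : ℝ) = 0 by rw [real_inner_comm, (halg x).inner_J_self]] at t₁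
    rw [(halg x).inner_J_self] at t₂
    have c₁ := real_inner_comm (nablaJ D hJ x y z) (covDerivBilin D hG x w y z)
    have c₂ := real_inner_comm (nablaJ D hJ x y z) (nablaJ D hJ x (D (extend E y) x w) z)
    have c₃ := real_inner_comm (nablaJ D hJ x y z) (nablaJ D hJ x y (D (extend E z) x w))
    rw [← c₁, ← c₂, ← c₃, t₁, t₂, real_inner_comm (D (extend E y) x w) y,
      real_inner_comm (D (extend E z) x w) z, real_inner_comm (D (extend E z) x w) y,
      real_inner_comm (D (extend E z) x w) (J x y), real_inner_comm (J x y) z,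
      real_inner_comm y z] at h1
    rw [hT]
    have h2 : covDerivEndo D hJ.smooth x w y = nablaJ D hJ x w y := rfl
    rw [h2] at h1
    linarith
  -- the exterior derivative of `3 g(G(·, ·), ·)` vanishes
  · intro w y z v
    obtain ⟨X, hX, hXv, hcomm⟩ := exists_commuting_fields (I := I) x
    let F : TangentSpace I x → TangentSpace I x → TangentSpace I x → M → ℝ := fun a b c p ↦
      mvfderiv I (fun q ↦ (inner ℝ (J q (X b q)) (X c q) : ℝ)) p (X a p)
    have hω : ∀ b c, ContMDiff I 𝓘(ℝ, ℝ) ∞ fun q ↦ (inner ℝ (J q (X b q)) (X c q) : ℝ) :=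
      fun b c ↦ (hJ.smooth.apply (hX b)).inner (hX c)
    have hF : ∀ a b c, MDifferentiableAt I 𝓘(ℝ, ℝ) (F a b c) x := by
      intro a b c
      have h : F a b c = fun p ↦ inner ℝ (D (fun q ↦ J q (X b q)) p (X a p)) (X c p) +
          inner ℝ (J p (X b p)) (D (X c) p (X a p)) := by
        funext p
        exact hD.mvfderiv_inner ((hJ.smooth.apply (hX b)).mdifferentiableAt p)
          ((hX c).mdifferentiableAt p) _
      rw [h]
      exact ((((hD.isSmoothVectorField_cov (hX a) (hJ.smooth.apply (hX b))).inner (hX c)).add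
        ((hJ.smooth.apply (hX b)).inner (hD.isSmoothVectorField_cov (hX a) (hX c)))) x
        ).mdifferentiableAt (by simp)
    -- the second derivatives of the coefficients of the fundamental form in commuting fields
    let K : TangentSpace I x → TangentSpace I x → TangentSpace I x → TangentSpace I x → ℝ :=
      fun d a b c ↦ mvfderiv I (F a b c) x d
    have hK₁ : ∀ d a b c, K d a b c = K a d b c := by
      intro d a b c
      have h := mvfderiv_mvfderiv_sub (((hω b c) x).of_le (by norm_cast))
        ((hX d).mdifferentiableAt x) ((hX a).mdifferentiableAt x)
      rw [(hcomm d a).self_of_nhds, map_zero, sub_eq_zero, hXv, hXv] at h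
      exact h
    have hK₂ : ∀ d a b c, K d a b c = -K d a c b := by
      intro d a b c
      have h : F a b c = fun p ↦ -F a c b p := by
        funext p
        have : (fun q ↦ (inner ℝ (J q (X b q)) (X c q) : ℝ)) =
            fun q ↦ -(inner ℝ (J q (X c q)) (X b q) : ℝ) := by
          funext q
          rw [hJ.skew, real_inner_comm]
        simp only [F]
        rw [this, mvfderiv_fun_neg, neg_apply]
      simp only [K]
      rw [h, mvfderiv_fun_neg, neg_apply]
    have hmd : ∀ a, MDifferentiableAt I I.tangent (fun p ↦ (⟨p, X a p⟩ : TangentBundle I M)) x :=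
      fun a ↦ (hX a).mdifferentiableAt x
    have hK : ∀ d a b c, 3 * mvfderiv I (fun p ↦
        (inner ℝ (nablaJ D hJ p (X a p) (X b p)) (X c p) : ℝ)) x d =
        K d a b c + K d b c a + K d c a b := by
      intro d a b c
      have h : ∀ᶠ p in 𝓝 x, (3 * inner ℝ (nablaJ D hJ p (X a p) (X b p)) (X c p) : ℝ) =
          F a b c p + F b c a p + F c a b p := by
        filter_upwards [hcomm a b, hcomm b c, hcomm c a] with p h1 h2 h3
        have h := mvfderiv_inner_endo_cyclic hD hJ.smooth hJ.skew (hX a) (hX b) (hX c) h1 h2 h3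
        refine Eq.trans ?_ h.symm
        change _ = inner ℝ (nablaJ D hJ p (X a p) (X b p)) (X c p) +
          inner ℝ (nablaJ D hJ p (X b p) (X c p)) (X a p) +
          inner ℝ (nablaJ D hJ p (X c p) (X a p)) (X b p)
        rw [(halg p).inner_cyclic (X b p) (X c p), (halg p).inner_cyclic (X c p) (X a p)]
        ring
      have h2 := congrArg (fun L : TangentSpace I x →L[ℝ] ℝ ↦ L d) (mvfderiv_congr (I := I) h)
      beta_reduce at h2
      rw [mvfderiv_fun_mul mdifferentiableAt_const
        ((((isSmoothBilin_nablaJ hD).apply (hX a) (hX b)).inner (hX c) x).mdifferentiableAt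
          (by simp)), mvfderiv_const] at h2
      replace h2 : _ = mvfderiv I (F a b c + F b c a + F c a b) x d := h2
      rw [mvfderiv_add ((hF a b c).add (hF b c a)) (hF c a b),
        mvfderiv_add (hF a b c) (hF b c a)] at h2
      simpa using h2
    have hcom : ∀ a b, D (X b) x a = D (X a) x b := by
      intro a b
      have h := hD.sub_eq_mlieBracket (hmd a) (hmd b)
      rwa [(hcomm a b).self_of_nhds, sub_eq_zero, hXv, hXv] at h
    have hexp : ∀ d a b c, mvfderiv I (fun p ↦
        (inner ℝ (nablaJ D hJ p (X a p) (X b p)) (X c p) : ℝ)) x d =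
        inner ℝ (T d a b) c + inner ℝ (nablaJ D hJ x (D (X a) x d) b) c +
        inner ℝ (nablaJ D hJ x (D (X b) x d) c) a + inner ℝ (nablaJ D hJ x (D (X c) x d) a) b := by
      intro d a b c
      rw [hD.mvfderiv_inner (((isSmoothBilin_nablaJ hD).apply (hX a) (hX b)).mdifferentiableAt x)
        (hmd c), cov_bilin_apply D hG x (hmd a) (hmd b), hXv, hXv, hXv, hT, inner_add_left,
        inner_add_left, (halg x).inner_cyclic a (D (X b) x d) c,
        (halg x).inner_cyclic (D (X c) x d) a b]
    have e1 := hK w y z v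
    have e2 := hK y w z v
    have e3 := hK z w y v
    have e4 := hK v w y z
    rw [hexp] at e1 e2 e3 e4
    have hΨ : ∀ a b c, (inner ℝ (nablaJ D hJ x a b) c : ℝ) = -inner ℝ (nablaJ D hJ x a c) b := by
      intro a b c
      rw [(halg x).inner_skew, real_inner_comm]
    rw [hcom w y, hcom w z, hcom w v, hΨ _ v y] at e1
    rw [hcom y z, hcom y v, hΨ _ w z] at e2
    rw [hcom z v] at e3
    linarith [hK₁ w y z v, hK₁ w z v y, hK₂ z w v y, hK₁ w v y z, hK₁ z y v w, hK₁ y v w z,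
      hK₂ v y w z, hK₁ z v w y]

end NearlyKahler

/-! ### Geometry of isometrically immersed hypersurfaces -/

section HypersurfaceGeometry

open Set VectorField Topology

variable {E : Type*} [NormedAddCommGroup E] [NormedSpace ℝ E] [FiniteDimensional ℝ E]
  {H : Type*} [TopologicalSpace H] {I : ModelWithCorners ℝ E H}
  {M : Type*} [TopologicalSpace M] [ChartedSpace H M] [IsManifold I ∞ M]
  {E' : Type*} [NormedAddCommGroup E'] [NormedSpace ℝ E'] [FiniteDimensional ℝ E']
  {H' : Type*} [TopologicalSpace H'] {I' : ModelWithCorners ℝ E' H'}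
  {M' : Type*} [TopologicalSpace M'] [ChartedSpace H' M'] [IsManifold I' ∞ M']
  [RiemannianBundle (fun x : M ↦ TangentSpace I x)]
  [RiemannianBundle (fun x : M' ↦ TangentSpace I' x)]
  {f : M → M'} {N : ∀ x : M, TangentSpace I' (f x)}

theorem inner_tangentialPart_left (f : M → M') (x : M) (v : TangentSpace I' (f x))
    (u : TangentSpace I x) :
    (inner ℝ (tangentialPart I I' f x v) u : ℝ) = inner ℝ v (mfderiv I I' f x u) :=
  ContinuousLinearMap.adjoint_inner_left _ _ _

theorem inner_tangentialPart_right (f : M → M') (x : M) (u : TangentSpace I x)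
    (v : TangentSpace I' (f x)) :
    (inner ℝ u (tangentialPart I I' f x v) : ℝ) = inner ℝ (mfderiv I I' f x u) v :=
  ContinuousLinearMap.adjoint_inner_right _ _ _

theorem tangentialPart_mfderiv (hf : IsIsometricImmersion I I' f) (x : M) (u : TangentSpace I x) :
    tangentialPart I I' f x (mfderiv I I' f x u) = u := by
  refine ext_inner_right ℝ fun v ↦ ?_
  rw [inner_tangentialPart_left, hf.inner_map]

theorem tangentialPart_normal (hN : IsUnitNormal I I' f N) (x : M) :
    tangentialPart I I' f x (N x) = 0 := by
  refine ext_inner_right ℝ fun v ↦ ?_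
  rw [inner_tangentialPart_left, real_inner_comm, hN.orthogonal, inner_zero_left]

theorem inner_normal_self (hN : IsUnitNormal I I' f N) (x : M) :
    (inner ℝ (N x) (N x) : ℝ) = 1 := by
  rw [real_inner_self_eq_norm_sq, hN.norm_eq, one_pow]

/-- The tangent space of the target splits into the tangent space of the hypersurface and the
normal line. -/
theorem mfderiv_tangentialPart_add (hdim : Module.finrank ℝ E' = Module.finrank ℝ E + 1)
    (hf : IsIsometricImmersion I I' f) (hN : IsUnitNormal I I' f N) (x : M)
    (v : TangentSpace I' (f x)) :
    mfderiv I I' f x (tangentialPart I I' f x v) + (inner ℝ v (N x) : ℝ) • N x = v := by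
  let L : TangentSpace I x × ℝ →ₗ[ℝ] TangentSpace I' (f x) :=
    LinearMap.coprod (mfderiv I I' f x).toLinearMap (LinearMap.toSpanSingleton ℝ _ (N x))
  have hL : ∀ u t, L (u, t) = mfderiv I I' f x u + t • N x := fun u t ↦ by simp [L]
  have h1 : ∀ u t, tangentialPart I I' f x (L (u, t)) = u := by
    intro u t
    rw [hL, map_add, map_smul, tangentialPart_normal hN, tangentialPart_mfderiv hf, smul_zero,
      add_zero]
  have h2 : ∀ u t, (inner ℝ (L (u, t)) (N x) : ℝ) = t := by
    intro u t
    rw [hL, inner_add_left, inner_smul_left, hN.orthogonal, inner_normal_self hN]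
    simp
  have hinj : Function.Injective L := by
    rintro ⟨u, t⟩ ⟨u', t'⟩ h
    exact Prod.ext (by rw [← h1 u t, h, h1]) (by rw [← h2 u t, h, h2])
  have hsurj : Function.Surjective L := by
    refine (LinearMap.injective_iff_surjective_of_finrank_eq_finrank ?_).1 hinj
    rw [Module.finrank_prod, Module.finrank_self]
    exact hdim.symm
  obtain ⟨⟨u, t⟩, rfl⟩ := hsurj v
  rw [h1, h2, hL]

/-! ### The Gauss and Weingarten formulas -/

variable [IsContMDiffRiemannianBundle I ∞ E (fun x : M ↦ TangentSpace I x)]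
  [IsContMDiffRiemannianBundle I' ∞ E' (fun x : M' ↦ TangentSpace I' x)]
  {D : CovariantDerivative I E (TangentSpace I : M → Type _)}
  {D' : CovariantDerivative I' E' (TangentSpace I' : M' → Type _)}

theorem IsUnitNormal.mdiffAlongAt (hN : IsUnitNormal I I' f N) (x : M) :
    MDiffAlongAt I I' f N x :=
  (hN.smooth x).mdifferentiableAt (by simp)

theorem covAlong_normal (hdim : Module.finrank ℝ E' = Module.finrank ℝ E + 1)
    (hD' : IsLeviCivita D') (hf : IsIsometricImmersion I I' f)
    (hN : IsUnitNormal I I' f N) (x : M) (u : TangentSpace I x) :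
    covAlong D' f N x u = -mfderiv I I' f x (shapeOperator I D' f N x u) := by
  have h1 := mvfderiv_inner_along hD' (hN.mdiffAlongAt x) (hN.mdiffAlongAt x) u
  simp only [inner_normal_self hN] at h1
  rw [mvfderiv_const, real_inner_comm] at h1
  have h2 : (inner ℝ (covAlong D' f N x u) (N x) : ℝ) = 0 := by
    rw [real_inner_comm]
    have h3 : (0 : ℝ) = _ := h1
    linarith
  have h4 := mfderiv_tangentialPart_add hdim hf hN x (covAlong D' f N x u)
  rw [h2, zero_smul, add_zero] at h4
  rw [← map_neg, ← h4]
  simp [shapeOperator]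

variable [I.Boundaryless] [I'.Boundaryless]

theorem inner_covAlong_mfderiv_normal (hD' : IsLeviCivita D') (hf : IsIsometricImmersion I I' f)
    (hN : IsUnitNormal I I' f N) {x : M} {Y : ∀ y : M, TangentSpace I y}
    (hY : MDifferentiableAt I I.tangent (fun y ↦ (⟨y, Y y⟩ : TangentBundle I M)) x)
    (u : TangentSpace I x) :
    (inner ℝ (covAlong D' f (fun y ↦ mfderiv I I' f y (Y y)) x u) (N x) : ℝ) =
      inner ℝ (shapeOperator I D' f N x u) (Y x) := by
  have h1 := mvfderiv_inner_along hD' (mdiffAlongAt_mfderiv hf.smooth hY) (hN.mdiffAlongAt x) u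
  simp only [hN.orthogonal] at h1
  rw [mvfderiv_const] at h1
  have h2 : (0 : ℝ) = _ := h1
  have h3 : (inner ℝ (shapeOperator I D' f N x u) (Y x) : ℝ) =
      -inner ℝ (mfderiv I I' f x (Y x)) (covAlong D' f N x u) := by
    rw [shapeOperator, neg_apply, inner_neg_left, real_inner_comm]
    rw [ContinuousLinearMap.comp_apply, inner_tangentialPart_right]
  rw [h3]
  linarith

/-- The tangential part of the connection of the target is the Levi-Civita connection of the
hypersurface. -/
theorem tangentialPart_covAlong_mfderiv (hD : IsLeviCivita D) (hD' : IsLeviCivita D')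
    (hf : IsIsometricImmersion I I' f) {x : M} {Y : ∀ y : M, TangentSpace I y}
    (hY : MDifferentiableAt I I.tangent (fun y ↦ (⟨y, Y y⟩ : TangentBundle I M)) x)
    (u : TangentSpace I x) :
    tangentialPart I I' f x (covAlong D' f (fun y ↦ mfderiv I I' f y (Y y)) x u) = D Y x u := by
  have : CompleteSpace E := FiniteDimensional.complete ℝ E
  -- the difference tensor is symmetric in its arguments, and skew-adjoint as the difference of two
  -- metric connections; so it vanishes
  let δ : (∀ y : M, TangentSpace I y) → (∀ y : M, TangentSpace I y) → TangentSpace I x :=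
    fun X Y ↦ tangentialPart I I' f x
      (covAlong D' f (fun y ↦ mfderiv I I' f y (Y y)) x (X x)) - D Y x (X x)
  have hsymm : ∀ {X Y : ∀ y : M, TangentSpace I y},
      MDifferentiableAt I I.tangent (fun y ↦ (⟨y, X y⟩ : TangentBundle I M)) x →
      MDifferentiableAt I I.tangent (fun y ↦ (⟨y, Y y⟩ : TangentBundle I M)) x →
      δ X Y = δ Y X := by
    intro X Y hX hY
    have h1 := covAlong_mfderiv_sub hD' hf.smooth hX hY
    have h2 := hD.sub_eq_mlieBracket hX hY
    have h3 := congrArg (tangentialPart I I' f x) h1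
    rw [map_sub, tangentialPart_mfderiv hf, ← h2, sub_eq_sub_iff_sub_eq_sub] at h3
    exact h3
  have hskew : ∀ {X Y Z : ∀ y : M, TangentSpace I y},
      MDifferentiableAt I I.tangent (fun y ↦ (⟨y, Y y⟩ : TangentBundle I M)) x →
      MDifferentiableAt I I.tangent (fun y ↦ (⟨y, Z y⟩ : TangentBundle I M)) x →
      (inner ℝ (δ X Y) (Z x) : ℝ) = -inner ℝ (δ X Z) (Y x) := by
    intro X Y Z hY hZ
    have h1 := mvfderiv_inner_along hD' (mdiffAlongAt_mfderiv hf.smooth hY)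
      (mdiffAlongAt_mfderiv hf.smooth hZ) (X x)
    simp only [hf.inner_map] at h1
    rw [hD.mvfderiv_inner hY hZ, real_inner_comm _ (mfderiv I I' f x (Y x)),
      ← inner_tangentialPart_left, ← inner_tangentialPart_left, real_inner_comm _ (Y x)] at h1
    simp only [δ, inner_sub_left]
    linarith
  have hzero : ∀ {X Y Z : ∀ y : M, TangentSpace I y},
      MDifferentiableAt I I.tangent (fun y ↦ (⟨y, X y⟩ : TangentBundle I M)) x →
      MDifferentiableAt I I.tangent (fun y ↦ (⟨y, Y y⟩ : TangentBundle I M)) x →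
      MDifferentiableAt I I.tangent (fun y ↦ (⟨y, Z y⟩ : TangentBundle I M)) x →
      (inner ℝ (δ X Y) (Z x) : ℝ) = 0 := by
    intro X Y Z hX hY hZ
    have e1 := hskew (X := X) hY hZ
    have e2 := hskew (X := Z) hX hY
    have e3 := hskew (X := Y) hZ hX
    rw [hsymm hX hZ] at e1
    rw [hsymm hZ hY] at e2
    rw [hsymm hY hX] at e3
    linarith
  have hX := mdifferentiableAt_extend I E u
  have h : δ (extend E u) Y = 0 := by
    refine ext_inner_right ℝ fun w ↦ ?_
    have hw := hzero hX hY (mdifferentiableAt_extend I E w)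
    rwa [extend_apply_self, ← inner_zero_left (𝕜 := ℝ) w] at hw
  simp only [δ, extend_apply_self] at h
  exact sub_eq_zero.1 h

/-- The Gauss formula. -/
theorem covAlong_mfderiv (hdim : Module.finrank ℝ E' = Module.finrank ℝ E + 1)
    (hD : IsLeviCivita D) (hD' : IsLeviCivita D')
    (hf : IsIsometricImmersion I I' f) (hN : IsUnitNormal I I' f N) {x : M}
    {Y : ∀ y : M, TangentSpace I y}
    (hY : MDifferentiableAt I I.tangent (fun y ↦ (⟨y, Y y⟩ : TangentBundle I M)) x)
    (u : TangentSpace I x) :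
    covAlong D' f (fun y ↦ mfderiv I I' f y (Y y)) x u =
      mfderiv I I' f x (D Y x u) + (inner ℝ (shapeOperator I D' f N x u) (Y x) : ℝ) • N x := by
  rw [← tangentialPart_covAlong_mfderiv hD hD' hf hY, ← inner_covAlong_mfderiv_normal hD' hf hN hY,
    mfderiv_tangentialPart_add hdim hf hN]

theorem inner_shapeOperator_comm (hD' : IsLeviCivita D')
    (hf : IsIsometricImmersion I I' f) (hN : IsUnitNormal I I' f N) (x : M)
    (u v : TangentSpace I x) :
    (inner ℝ (shapeOperator I D' f N x u) v : ℝ) = inner ℝ u (shapeOperator I D' f N x v) := by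
  have hu := mdifferentiableAt_extend I E u
  have hv := mdifferentiableAt_extend I E v
  have h1 := inner_covAlong_mfderiv_normal hD' hf hN hv u
  have h2 := inner_covAlong_mfderiv_normal hD' hf hN hu v
  have h3 := congrArg (fun z ↦ (inner ℝ z (N x) : ℝ)) (covAlong_mfderiv_sub hD' hf.smooth hu hv)
  simp only [extend_apply_self, inner_sub_left, hN.orthogonal] at h1 h2 h3
  rw [h1, h2] at h3
  rw [real_inner_comm _ u]
  linarith

/-! ### Tangential parts of vector fields along the hypersurface -/

variable (I I') in
/-- The vector field `V` along `f` is smooth. -/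
def IsSmoothAlong (f : M → M') (V : ∀ y : M, TangentSpace I' (f y)) : Prop :=
  ContMDiff I I'.tangent ∞ (fun y ↦ (⟨f y, V y⟩ : TangentBundle I' M'))

theorem IsSmoothAlong.mdiffAlongAt {V : ∀ y : M, TangentSpace I' (f y)}
    (hV : IsSmoothAlong I I' f V) (x : M) : MDiffAlongAt I I' f V x :=
  (hV x).mdifferentiableAt (by simp)

theorem IsSmoothAlong.inner {V W : ∀ y : M, TangentSpace I' (f y)}
    (hV : IsSmoothAlong I I' f V) (hW : IsSmoothAlong I I' f W) :
    ContMDiff I 𝓘(ℝ, ℝ) ∞ fun y ↦ (inner ℝ (V y) (W y) : ℝ) :=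
  ContMDiff.inner_bundle (F := E') (E := fun x : M' ↦ TangentSpace I' x) hV hW

theorem IsSmoothAlong.apply_endo
    {A : ∀ z : M', TangentSpace I' z →L[ℝ] TangentSpace I' z} (hA : IsSmoothEndo A)
    (hf : ContMDiff I I' ∞ f) {V : ∀ y : M, TangentSpace I' (f y)}
    (hV : IsSmoothAlong I I' f V) : IsSmoothAlong I I' f fun y ↦ A (f y) (V y) :=
  ContMDiff.clm_bundle_apply (F₁ := E') (F₂ := E') (ContMDiff.comp hA hf) hV

theorem IsSmoothAlong.apply_bilin
    {B : ∀ z : M', TangentSpace I' z →L[ℝ] TangentSpace I' z →L[ℝ] TangentSpace I' z}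
    (hB : IsSmoothBilin B) (hf : ContMDiff I I' ∞ f) {V W : ∀ y : M, TangentSpace I' (f y)}
    (hV : IsSmoothAlong I I' f V) (hW : IsSmoothAlong I I' f W) :
    IsSmoothAlong I I' f fun y ↦ B (f y) (V y) (W y) :=
  ContMDiff.clm_bundle_apply₂ (F₁ := E') (F₂ := E') (F₃ := E') (ContMDiff.comp hB hf) hV hW

theorem isSmoothAlong_mfderiv (hf : ContMDiff I I' ∞ f) {Y : ∀ y : M, TangentSpace I y}
    (hY : IsSmoothVectorField Y) : IsSmoothAlong I I' f fun y ↦ mfderiv I I' f y (Y y) :=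
  ContMDiff.comp (hf.contMDiff_tangentMap (m := ∞) (by simp)) hY

theorem IsSmoothAlong.tangentialPart [T2Space M] (hf : ContMDiff I I' ∞ f)
    {V : ∀ y : M, TangentSpace I' (f y)} (hV : IsSmoothAlong I I' f V) :
    IsSmoothVectorField fun y ↦ tangentialPart I I' f y (V y) := by
  refine isSmoothVectorField_of_inner fun Y hY ↦ ?_
  simp only [inner_tangentialPart_left]
  exact hV.inner (isSmoothAlong_mfderiv hf hY)

theorem cov_tangentialPart [T2Space M] (hdim : Module.finrank ℝ E' = Module.finrank ℝ E + 1)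
    (hD : IsLeviCivita D) (hD' : IsLeviCivita D')
    (hf : IsIsometricImmersion I I' f) (hN : IsUnitNormal I I' f N)
    {V : ∀ y : M, TangentSpace I' (f y)} (hV : IsSmoothAlong I I' f V) (x : M)
    (u : TangentSpace I x) :
    D (fun y ↦ tangentialPart I I' f y (V y)) x u = tangentialPart I I' f x (covAlong D' f V x u) +
      (inner ℝ (V x) (N x) : ℝ) • shapeOperator I D' f N x u := by
  have hP := (hV.tangentialPart hf.smooth).mdifferentiableAt x
  have hg : MDifferentiableAt I 𝓘(ℝ, ℝ) (fun y ↦ (inner ℝ (V y) (N y) : ℝ)) x :=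
    MDiffAlongAt.inner (I := I) (hV.mdiffAlongAt x) (hN.mdiffAlongAt x)
  have h1 : covAlong (I := I) D' f V x = covAlong D' f (fun y ↦
      mfderiv I I' f y (tangentialPart I I' f y (V y)) + (inner ℝ (V y) (N y) : ℝ) • N y) x :=
    covAlong_congr D' (Filter.Eventually.of_forall fun y ↦
      (mfderiv_tangentialPart_add hdim hf hN y (V y)).symm)
  rw [h1, covAlong_add D' (mdiffAlongAt_mfderiv hf.smooth hP) ((hN.mdiffAlongAt x).smul hg),
    add_apply, covAlong_smul D' hg (hN.mdiffAlongAt x), map_add, map_add, map_smul, map_smul,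
    tangentialPart_normal hN, tangentialPart_covAlong_mfderiv hD hD' hf hP,
    covAlong_normal hdim hD' hf hN, map_neg, tangentialPart_mfderiv hf]
  module

end HypersurfaceGeometry

/-! ### Triples of almost contact structures -/

section ContactAlgebra

variable {V : Type*} [NormedAddCommGroup V] [InnerProductSpace ℝ V]

local notation "⟪" x ", " y "⟫" => inner ℝ x y

/-- Three almost contact metric structures with the same Reeb vector `ξ`, which on the orthogonal
complement of `ξ` multiply like the imaginary quaternions. -/
structure IsContactTriple (ξ : V) (φ₁ φ₂ φ₃ : V →L[ℝ] V) : Prop where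
  inner_self : ⟪ξ, ξ⟫ = 1
  skew₁ : ∀ u v, ⟪φ₁ u, v⟫ = -⟪u, φ₁ v⟫
  skew₂ : ∀ u v, ⟪φ₂ u, v⟫ = -⟪u, φ₂ v⟫
  skew₃ : ∀ u v, ⟪φ₃ u, v⟫ = -⟪u, φ₃ v⟫
  apply₁ : φ₁ ξ = 0
  apply₂ : φ₂ ξ = 0
  apply₃ : φ₃ ξ = 0
  sq₁ : ∀ u, φ₁ (φ₁ u) = -u + ⟪ξ, u⟫ • ξ
  sq₂ : ∀ u, φ₂ (φ₂ u) = -u + ⟪ξ, u⟫ • ξ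
  sq₃ : ∀ u, φ₃ (φ₃ u) = -u + ⟪ξ, u⟫ • ξ
  mul₂₁ : ∀ u, φ₂ (φ₁ u) = φ₃ u

namespace IsContactTriple

variable {ξ : V} {φ₁ φ₂ φ₃ : V →L[ℝ] V} (h : IsContactTriple ξ φ₁ φ₂ φ₃)
include h

theorem inner₁ (u : V) : ⟪ξ, φ₁ u⟫ = 0 := by
  rw [← neg_eq_zero, ← h.skew₁, h.apply₁, inner_zero_left]

theorem inner₂ (u : V) : ⟪ξ, φ₂ u⟫ = 0 := by
  rw [← neg_eq_zero, ← h.skew₂, h.apply₂, inner_zero_left]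

theorem inner₃ (u : V) : ⟪ξ, φ₃ u⟫ = 0 := by
  rw [← neg_eq_zero, ← h.skew₃, h.apply₃, inner_zero_left]

theorem inner₁' (u : V) : ⟪φ₁ u, ξ⟫ = 0 := by rw [real_inner_comm, h.inner₁]

theorem inner₂' (u : V) : ⟪φ₂ u, ξ⟫ = 0 := by rw [real_inner_comm, h.inner₂]

theorem inner₃' (u : V) : ⟪φ₃ u, ξ⟫ = 0 := by rw [real_inner_comm, h.inner₃]

theorem mul₁₂ (u : V) : φ₁ (φ₂ u) = -φ₃ u := by
  refine ext_inner_right ℝ fun v ↦ ?_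
  rw [h.skew₁, h.skew₂, h.mul₂₁, inner_neg_left, h.skew₃]

theorem mul₁₃ (u : V) : φ₁ (φ₃ u) = φ₂ u := by
  rw [← neg_neg (φ₃ u), ← h.mul₁₂, map_neg, h.sq₁, h.inner₂, zero_smul, add_zero, neg_neg]

theorem mul₃₁ (u : V) : φ₃ (φ₁ u) = -φ₂ u := by
  rw [← h.mul₂₁, h.sq₁, map_add, map_neg, map_smul, h.apply₂, smul_zero, add_zero]

theorem mul₂₃ (u : V) : φ₂ (φ₃ u) = -φ₁ u := by
  rw [← h.mul₂₁, h.sq₂, h.inner₁, zero_smul, add_zero]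

theorem mul₃₂ (u : V) : φ₃ (φ₂ u) = φ₁ u := by
  rw [← h.mul₂₁, h.mul₁₂, map_neg, h.mul₂₃, neg_neg]

end IsContactTriple

end ContactAlgebra

/-! ### The almost contact structures of a hypersurface -/

section HypersurfaceContact

open Set VectorField Topology

variable {E : Type*} [NormedAddCommGroup E] [NormedSpace ℝ E] [FiniteDimensional ℝ E]
  {H : Type*} [TopologicalSpace H] {I : ModelWithCorners ℝ E H}
  {M : Type*} [TopologicalSpace M] [ChartedSpace H M] [IsManifold I ∞ M]
  {E' : Type*} [NormedAddCommGroup E'] [NormedSpace ℝ E'] [FiniteDimensional ℝ E']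
  {H' : Type*} [TopologicalSpace H'] {I' : ModelWithCorners ℝ E' H'}
  {M' : Type*} [TopologicalSpace M'] [ChartedSpace H' M'] [IsManifold I' ∞ M']
  [RiemannianBundle (fun x : M ↦ TangentSpace I x)]
  [RiemannianBundle (fun x : M' ↦ TangentSpace I' x)]
  [IsContMDiffRiemannianBundle I ∞ E (fun x : M ↦ TangentSpace I x)]
  [IsContMDiffRiemannianBundle I' ∞ E' (fun x : M' ↦ TangentSpace I' x)]
  {D : CovariantDerivative I E (TangentSpace I : M → Type _)}
  {D' : CovariantDerivative I' E' (TangentSpace I' : M' → Type _)}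
  {J : ∀ x : M', TangentSpace I' x →L[ℝ] TangentSpace I' x} {hJ : IsAlmostHermitian J}
  {f : M → M'} {N : ∀ x : M, TangentSpace I' (f x)}

theorem mfderiv_tangentialPart_of_inner_eq_zero
    (hdim : Module.finrank ℝ E' = Module.finrank ℝ E + 1)
    (hf : IsIsometricImmersion I I' f) (hN : IsUnitNormal I I' f N) {x : M}
    {v : TangentSpace I' (f x)} (hv : (inner ℝ v (N x) : ℝ) = 0) :
    mfderiv I I' f x (tangentialPart I I' f x v) = v := by
  have h := mfderiv_tangentialPart_add hdim hf hN x v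
  rwa [hv, zero_smul, add_zero] at h

theorem mfderiv_reebField (hJ : IsAlmostHermitian J)
    (hdim : Module.finrank ℝ E' = Module.finrank ℝ E + 1)
    (hf : IsIsometricImmersion I I' f) (hN : IsUnitNormal I I' f N) (x : M) :
    mfderiv I I' f x (reebField I J f N x) = -J (f x) (N x) := by
  refine mfderiv_tangentialPart_of_inner_eq_zero hdim hf hN ?_
  have := hJ.skew (f x) (N x) (N x)
  rw [real_inner_comm] at this
  rw [inner_neg_left, neg_eq_zero, real_inner_comm]
  linarith [real_inner_comm (N x) (J (f x) (N x))]

theorem phiOne_apply (hN : IsUnitNormal I I' f N) (x : M) (u : TangentSpace I x) :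
    phiOne I J f N x u = tangentialPart I I' f x (J (f x) (mfderiv I I' f x u)) := by
  simp [phiOne, tangentialPart_normal hN]

theorem inner_J_mfderiv_normal (hJ : IsAlmostHermitian J)
    (hdim : Module.finrank ℝ E' = Module.finrank ℝ E + 1)
    (hf : IsIsometricImmersion I I' f) (hN : IsUnitNormal I I' f N) (x : M)
    (u : TangentSpace I x) :
    (inner ℝ (J (f x) (mfderiv I I' f x u)) (N x) : ℝ) = inner ℝ (reebField I J f N x) u := by
  rw [hJ.skew, ← inner_neg_right, ← mfderiv_reebField hJ hdim hf hN, hf.inner_map, real_inner_comm]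

theorem mfderiv_phiOne (hJ : IsAlmostHermitian J)
    (hdim : Module.finrank ℝ E' = Module.finrank ℝ E + 1)
    (hf : IsIsometricImmersion I I' f) (hN : IsUnitNormal I I' f N) (x : M)
    (u : TangentSpace I x) :
    mfderiv I I' f x (phiOne I J f N x u) = J (f x) (mfderiv I I' f x u) -
      (inner ℝ (reebField I J f N x) u : ℝ) • N x := by
  have h := mfderiv_tangentialPart_add hdim hf hN x (J (f x) (mfderiv I I' f x u))
  rw [phiOne_apply hN, ← inner_J_mfderiv_normal hJ hdim hf hN, eq_sub_iff_add_eq, h]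

theorem mfderiv_phiThree (halg : ∀ x, IsNearlyKahlerAlgebra (J x) (nablaJ D' hJ x))
    (hdim : Module.finrank ℝ E' = Module.finrank ℝ E + 1)
    (hf : IsIsometricImmersion I I' f) (hN : IsUnitNormal I I' f N) (x : M)
    (u : TangentSpace I x) :
    mfderiv I I' f x (phiThree I D' hJ f N x u) =
      nablaJ D' hJ (f x) (N x) (mfderiv I I' f x u) :=
  mfderiv_tangentialPart_of_inner_eq_zero hdim hf hN ((halg _).inner_self _ _)

theorem mfderiv_phiTwo (halg : ∀ x, IsNearlyKahlerAlgebra (J x) (nablaJ D' hJ x))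
    (hdim : Module.finrank ℝ E' = Module.finrank ℝ E + 1)
    (hf : IsIsometricImmersion I I' f) (hN : IsUnitNormal I I' f N) (x : M)
    (u : TangentSpace I x) :
    mfderiv I I' f x (phiTwo I D' hJ f N x u) =
      J (f x) (nablaJ D' hJ (f x) (N x) (mfderiv I I' f x u)) := by
  have h : nablaJ D' hJ (f x) (mfderiv I I' f x (reebField I J f N x)) (mfderiv I I' f x u) =
      J (f x) (nablaJ D' hJ (f x) (N x) (mfderiv I I' f x u)) := by
    rw [mfderiv_reebField hJ hdim hf hN, map_neg, neg_apply, (halg _).map_J_left, neg_neg]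
  rw [← h]
  refine mfderiv_tangentialPart_of_inner_eq_zero hdim hf hN ?_
  refine (congrArg (fun v ↦ (inner ℝ v (N x) : ℝ)) h).trans ?_
  rw [(halg _).J_skew, (halg _).inner_J_left, neg_zero]

theorem mfderiv_injective (hf : IsIsometricImmersion I I' f) (x : M) :
    Function.Injective (mfderiv I I' f x) := fun u v h ↦ by
  rw [← tangentialPart_mfderiv hf x u, h, tangentialPart_mfderiv hf]

theorem isContactTriple (halg : ∀ x, IsNearlyKahlerAlgebra (J x) (nablaJ D' hJ x))
    (hdim : Module.finrank ℝ E' = Module.finrank ℝ E + 1)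
    (hf : IsIsometricImmersion I I' f) (hN : IsUnitNormal I I' f N) (x : M) :
    IsContactTriple (reebField I J f N x) (phiOne I J f N x) (phiTwo I D' hJ f N x)
      (phiThree I D' hJ f N x) := by
  have hξ := mfderiv_reebField hJ hdim hf hN x
  have h1 := mfderiv_phiOne hJ hdim hf hN x
  have h2 := mfderiv_phiTwo halg hdim hf hN x
  have h3 := mfderiv_phiThree halg hdim hf hN x
  have hinj := mfderiv_injective hf x
  have hNN := inner_normal_self hN x
  have hJN : J (f x) (N x) = -mfderiv I I' f x (reebField I J f N x) := by rw [hξ, neg_neg]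
  have hNu : ∀ u, (inner ℝ (N x) (mfderiv I I' f x u) : ℝ) = 0 := fun u ↦ by
    rw [real_inner_comm, hN.orthogonal]
  have hηφ : ∀ u, (inner ℝ (reebField I J f N x) (phiOne I J f N x u) : ℝ) = 0 := by
    intro u
    rw [← hf.inner_map, hξ, h1, inner_neg_left, inner_sub_right, hJ.inner_map, hNu,
      inner_smul_right, (halg _).inner_J_self]
    simp
  have hGG : ∀ u, nablaJ D' hJ (f x) (N x) (nablaJ D' hJ (f x) (N x) (mfderiv I I' f x u)) =
      mfderiv I I' f x (-u + (inner ℝ (reebField I J f N x) u : ℝ) • reebField I J f N x) := by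
    intro u
    rw [(halg _).G_G, hNN, hNu, real_inner_comm _ (N x), real_inner_comm _ (N x),
      (halg _).inner_J_self, inner_J_mfderiv_normal hJ hdim hf hN, map_add, map_neg, map_smul, hξ]
    module
  refine ⟨?_, ?_, ?_, ?_, ?_, ?_, ?_, ?_, ?_, ?_, ?_⟩
  · rw [← hf.inner_map, hξ, inner_neg_neg, hJ.inner_map, hNN]
  · intro u v
    rw [← hf.inner_map, ← hf.inner_map x u, h1, h1, inner_sub_left, inner_sub_right,
      inner_smul_left, inner_smul_right, hNu, hN.orthogonal, hJ.skew]
    simp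
  · intro u v
    rw [← hf.inner_map, ← hf.inner_map x u, h2, h2, hJ.skew, (halg _).inner_skew, (halg _).map_J,
      inner_neg_right, neg_neg]
  · intro u v
    rw [← hf.inner_map, ← hf.inner_map x u, h3, h3, (halg _).inner_skew]
  · apply hinj
    rw [h1, hξ, map_neg, hJ.sq, neg_neg, map_zero, ← hf.inner_map, hξ, inner_neg_neg,
      hJ.inner_map, hNN, one_smul, sub_self]
  · apply hinj
    rw [h2, hξ, map_neg, (halg _).self_J, neg_zero, map_zero, map_zero]
  · apply hinj
    rw [h3, hξ, map_neg, (halg _).self_J, neg_zero, map_zero]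
  · intro u
    apply hinj
    rw [h1, hηφ, zero_smul, sub_zero, h1, map_sub, hJ.sq, map_smul, hJN, map_add, map_neg,
      map_smul]
    module
  · intro u
    apply hinj
    rw [h2, h2, (halg _).map_J, map_neg, hJ.sq, neg_neg, hGG]
  · intro u
    apply hinj
    rw [h3, h3, hGG]
  · intro u
    apply hinj
    rw [h2, h1, h3, map_sub, map_smul, (halg _).self, smul_zero, sub_zero, (halg _).map_J,
      map_neg, hJ.sq, neg_neg]

/-- The tangential part of `G` on tangent vectors. For vectors orthogonal to `ξ` it has only a
`ξ`-component, since the complex line of the normal contains `G(x, y)` for `x` and `y` orthogonal to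
it. -/
theorem tangentialPart_nablaJ (halg : ∀ x, IsNearlyKahlerAlgebra (J x) (nablaJ D' hJ x))
    (hdim : Module.finrank ℝ E' = Module.finrank ℝ E + 1) (hdim' : Module.finrank ℝ E' = 6)
    (hf : IsIsometricImmersion I I' f) (hN : IsUnitNormal I I' f N) (x : M)
    (u v : TangentSpace I x) :
    tangentialPart I I' f x
        (nablaJ D' hJ (f x) (mfderiv I I' f x u) (mfderiv I I' f x v)) =
      (inner ℝ (reebField I J f N x) u : ℝ) • phiTwo I D' hJ f N x v -
        (inner ℝ (reebField I J f N x) v : ℝ) • phiTwo I D' hJ f N x u +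
        (inner ℝ (phiTwo I D' hJ f N x u) v : ℝ) • reebField I J f N x := by
  have hc := isContactTriple halg hdim hf hN x
  have h2 := mfderiv_phiTwo halg hdim hf hN x
  have hξ := mfderiv_reebField hJ hdim hf hN x
  have hortho : ∀ u v : TangentSpace I x, (inner ℝ (reebField I J f N x) u : ℝ) = 0 →
      (inner ℝ (reebField I J f N x) v : ℝ) = 0 → tangentialPart I I' f x
        (nablaJ D' hJ (f x) (mfderiv I I' f x u) (mfderiv I I' f x v)) =
        (inner ℝ (phiTwo I D' hJ f N x u) v : ℝ) • reebField I J f N x := by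
    intro u v hu hv
    have hJu : ∀ w : TangentSpace I x, (inner ℝ (reebField I J f N x) w : ℝ) = 0 →
        (inner ℝ (J (f x) (N x)) (mfderiv I I' f x w) : ℝ) = 0 := by
      intro w hw
      rw [← neg_eq_zero, ← inner_neg_left, ← hξ, hf.inner_map, hw]
    have h := (halg (f x)).G_apply_of_orthogonal hdim' (e := N x) (hN.norm_eq x)
      (by rw [real_inner_comm, hN.orthogonal]) (hJu u hu)
      (by rw [real_inner_comm, hN.orthogonal]) (hJu v hv)
    rw [h, map_add, map_smul, map_smul, tangentialPart_normal hN, smul_zero, zero_add,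
      (halg _).map_J_left, ← h2, inner_neg_left, hf.inner_map, neg_smul, ← smul_neg, ← map_neg]
    rfl
  set ξ := reebField I J f N x with hξdef
  have hξξ := hc.inner_self
  have hG : ∀ w, tangentialPart I I' f x
      (nablaJ D' hJ (f x) (mfderiv I I' f x ξ) (mfderiv I I' f x w)) = phiTwo I D' hJ f N x w :=
    fun w ↦ rfl
  have hG' : ∀ w, tangentialPart I I' f x
      (nablaJ D' hJ (f x) (mfderiv I I' f x w) (mfderiv I I' f x ξ)) =
      -phiTwo I D' hJ f N x w := by
    intro w
    rw [(halg _).skew, map_neg, hG]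
  have h := hortho (u - (inner ℝ ξ u : ℝ) • ξ) (v - (inner ℝ ξ v : ℝ) • ξ)
    (by rw [inner_sub_right, inner_smul_right, hξξ]; ring)
    (by rw [inner_sub_right, inner_smul_right, hξξ]; ring)
  simp only [map_sub, map_smul, sub_apply, smul_apply, hG, hG', hc.apply₂, smul_zero, sub_zero,
    inner_sub_right, inner_smul_right, hc.inner₂', mul_zero] at h
  rw [← h]
  module

end HypersurfaceContact

/-! ### The structure equations -/

section StructureEquations

open Set VectorField Topology

variable {E : Type*} [NormedAddCommGroup E] [NormedSpace ℝ E] [FiniteDimensional ℝ E]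
  {H : Type*} [TopologicalSpace H] {I : ModelWithCorners ℝ E H}
  {M : Type*} [TopologicalSpace M] [ChartedSpace H M] [IsManifold I ∞ M]
  [RiemannianBundle (fun x : M ↦ TangentSpace I x)]
  [IsContMDiffRiemannianBundle I ∞ E (fun x : M ↦ TangentSpace I x)]
  {D : CovariantDerivative I E (TangentSpace I : M → Type _)}

/-- The structure equations of a hypersurface, with shape operator `S`, of a six-dimensional
strict nearly Kähler manifold of constant type one. They involve the ambient manifold through
`ξ`, `φ₁`, `φ₂`, `φ₃` and `S` only. -/
structure IsNearlyKahlerHypersurface (D : CovariantDerivative I E (TangentSpace I : M → Type _))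
    (S : ∀ x : M, TangentSpace I x →L[ℝ] TangentSpace I x) (ξ : ∀ x : M, TangentSpace I x)
    (φ₁ φ₂ φ₃ : ∀ x : M, TangentSpace I x →L[ℝ] TangentSpace I x) : Prop where
  triple : ∀ x, IsContactTriple (ξ x) (φ₁ x) (φ₂ x) (φ₃ x)
  shape_comm : ∀ x (u v : TangentSpace I x), (inner ℝ (S x u) v : ℝ) = inner ℝ u (S x v)
  smooth_reeb : IsSmoothVectorField ξ
  smooth₁ : IsSmoothEndo φ₁
  smooth₂ : IsSmoothEndo φ₂
  smooth₃ : IsSmoothEndo φ₃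
  cov_reeb : ∀ x (u : TangentSpace I x), D ξ x u = φ₃ x u + φ₁ x (S x u)
  cov₁ : ∀ x (u v : TangentSpace I x), covDerivEndo D smooth₁ x u v =
    (inner ℝ (ξ x) u : ℝ) • φ₂ x v - (inner ℝ (ξ x) v : ℝ) • φ₂ x u +
      (inner ℝ (φ₂ x u) v : ℝ) • ξ x - (inner ℝ (S x u) v : ℝ) • ξ x +
      (inner ℝ (ξ x) v : ℝ) • S x u
  cov₃ : ∀ x (u v : TangentSpace I x), covDerivEndo D smooth₃ x u v =
    (inner ℝ (ξ x) v : ℝ) • u - (inner ℝ u v : ℝ) • ξ x -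
      ((inner ℝ (ξ x) (S x u) : ℝ) • φ₂ x v - (inner ℝ (ξ x) v : ℝ) • φ₂ x (S x u) +
        (inner ℝ (φ₂ x (S x u)) v : ℝ) • ξ x)

variable
  {E' : Type*} [NormedAddCommGroup E'] [NormedSpace ℝ E'] [FiniteDimensional ℝ E']
  {H' : Type*} [TopologicalSpace H'] {I' : ModelWithCorners ℝ E' H'}
  {M' : Type*} [TopologicalSpace M'] [ChartedSpace H' M'] [IsManifold I' ∞ M']
  [RiemannianBundle (fun x : M' ↦ TangentSpace I' x)]
  [IsContMDiffRiemannianBundle I' ∞ E' (fun x : M' ↦ TangentSpace I' x)]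
  {D' : CovariantDerivative I' E' (TangentSpace I' : M' → Type _)}
  {J : ∀ x : M', TangentSpace I' x →L[ℝ] TangentSpace I' x} {hJ : IsAlmostHermitian J}
  {f : M → M'} {N : ∀ x : M, TangentSpace I' (f x)}

/-- The equations for `∇ξ`, `∇φ₁` and `∇φ₃` follow by taking tangential parts in the product rules
for `J N`, `J X` and `G(N, X)`, with the Gauss and Weingarten formulas and the formula for `∇G`. -/
theorem isNearlyKahlerHypersurface [T2Space M] [T2Space M'] [I.Boundaryless] [I'.Boundaryless]
    (hdim : Module.finrank ℝ E' = Module.finrank ℝ E + 1) (hdim' : Module.finrank ℝ E' = 6)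
    (hD : IsLeviCivita D) (hD' : IsLeviCivita D') (hNK : IsStrictNearlyKahler D' hJ)
    (htype : HasConstantType D' hJ 1)
    (hf : IsIsometricImmersion I I' f) (hN : IsUnitNormal I I' f N) :
    IsNearlyKahlerHypersurface D (shapeOperator I D' f N) (reebField I J f N) (phiOne I J f N)
      (phiTwo I D' hJ f N) (phiThree I D' hJ f N) := by
  have halg := isNearlyKahlerAlgebra hD' hNK htype
  have hc := isContactTriple halg hdim hf hN
  have hG := isSmoothBilin_nablaJ (hJ := hJ) hD'
  have hNs : IsSmoothAlong I I' f N := hN.smooth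
  have hJN : IsSmoothAlong I I' f fun y ↦ J (f y) (N y) := hNs.apply_endo hJ.smooth hf.smooth
  have hξ : reebField I J f N = fun y ↦ -tangentialPart I I' f y (J (f y) (N y)) := by
    funext y
    rw [reebField, map_neg]
  have hξs : IsSmoothVectorField (reebField I J f N) := by
    rw [hξ]
    exact ContMDiff.neg_section (hJN.tangentialPart hf.smooth)
  have hJs : ∀ {X : ∀ y : M, TangentSpace I y}, IsSmoothVectorField X →
      IsSmoothAlong I I' f fun y ↦ J (f y) (mfderiv I I' f y (X y)) := fun hX ↦
    (isSmoothAlong_mfderiv hf.smooth hX).apply_endo hJ.smooth hf.smooth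
  have hGs : ∀ {X : ∀ y : M, TangentSpace I y}, IsSmoothVectorField X →
      IsSmoothAlong I I' f fun y ↦ nablaJ D' hJ (f y) (N y) (mfderiv I I' f y (X y)) := fun hX ↦
    hNs.apply_bilin hG hf.smooth (isSmoothAlong_mfderiv hf.smooth hX)
  have h1s : IsSmoothEndo (phiOne I J f N) := by
    refine isSmoothEndo_of_apply fun X hX ↦ ?_
    simp only [phiOne_apply hN]
    exact (hJs hX).tangentialPart hf.smooth
  have h3s : IsSmoothEndo (phiThree I D' hJ f N) :=
    isSmoothEndo_of_apply fun X hX ↦ (hGs hX).tangentialPart hf.smooth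
  have h2s : IsSmoothEndo (phiTwo I D' hJ f N) := by
    refine isSmoothEndo_of_apply fun X hX ↦ ?_
    simp only [← (hc _).mul₁₃]
    exact h1s.apply (h3s.apply hX)
  have hPG : ∀ x u v, _ := tangentialPart_nablaJ halg hdim hdim' hf hN
  have hPJN : ∀ x, tangentialPart I I' f x (J (f x) (N x)) = -reebField I J f N x := by
    intro x
    rw [hξ, neg_neg]
  refine ⟨hc, inner_shapeOperator_comm hD' hf hN, hξs, h1s, h2s, h3s, ?_, ?_, ?_⟩
  · intro x u
    rw [hξ, cov_neg D ((hJN.tangentialPart hf.smooth).mdifferentiableAt x), neg_apply,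
      cov_tangentialPart hdim hD hD' hf hN hJN, (halg _).inner_J_self, zero_smul, add_zero,
      covAlong_apply_endo hJ.smooth (hN.mdiffAlongAt x), covAlong_normal hdim hD' hf hN, map_neg,
      map_add, map_neg, phiOne_apply hN, neg_add, neg_neg, ← map_neg]
    congr 2
    exact congrArg (tangentialPart I I' f x) (neg_eq_iff_eq_neg.2 ((halg (f x)).skew _ _))
  · intro x u v
    obtain ⟨Y, hY, rfl⟩ := exists_isSmoothVectorField_apply_eq v
    have hYx := hY.mdifferentiableAt x
    have h2 : covDerivEndo D' hJ.smooth = nablaJ D' hJ := rfl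
    rw [covDerivEndo_apply D h1s x u hYx]
    simp only [phiOne_apply hN]
    rw [cov_tangentialPart hdim hD hD' hf hN (hJs hY),
      covAlong_apply_endo hJ.smooth (mdiffAlongAt_mfderiv hf.smooth hYx),
      covAlong_mfderiv hdim hD hD' hf hN hYx, inner_J_mfderiv_normal hJ hdim hf hN, map_add,
      map_add, map_add, map_smul, map_smul, hPJN, h2, hPG]
    module
  · intro x u v
    obtain ⟨Y, hY, rfl⟩ := exists_isSmoothVectorField_apply_eq v
    have hYx := hY.mdifferentiableAt x
    have hB := covAlong_apply_bilin (D := D') (x := x) hG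
      (B' := covDerivBilin D' hG (f x)) (fun Y Z hY hZ w ↦ cov_bilin_apply D' hG (f x) hY hZ w)
      (hN.mdiffAlongAt x) (mdiffAlongAt_mfderiv hf.smooth hYx) u
    have h3 : ∀ (y : M) w, phiThree I D' hJ f N y w = tangentialPart I I' f y
      (nablaJ D' hJ (f y) (N y) (mfderiv I I' f y w)) := fun y w ↦ rfl
    have hJY : (inner ℝ (N x) (J (f x) (mfderiv I I' f x (Y x))) : ℝ) =
        inner ℝ (reebField I J f N x) (Y x) := by
      rw [real_inner_comm, inner_J_mfderiv_normal hJ hdim hf hN]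
    rw [covDerivEndo_apply D h3s x u hYx]
    simp only [h3]
    rw [cov_tangentialPart hdim hD hD' hf hN (hGs hY), (halg _).inner_self, zero_smul, add_zero,
      hB, covDerivBilin_nablaJ hdim' hD' hNK htype, covAlong_mfderiv hdim hD hD' hf hN hYx,
      covAlong_normal hdim hD' hf hN, hJY, hf.inner_map, hN.orthogonal, zero_smul, sub_zero]
    simp only [map_add, map_smul, map_neg, neg_apply, tangentialPart_mfderiv hf, hPJN, hPG,
      (halg _).self, smul_zero, add_zero]
    module

end StructureEquations

/-! ### Pointwise consequences of the nearly Sasakian and nearly cosymplectic conditions -/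

section Pointwise

variable {V : Type*} [NormedAddCommGroup V] [InnerProductSpace ℝ V]

local notation "⟪" x ", " y "⟫" => inner ℝ x y

namespace IsContactTriple

variable {ξ : V} {φ₁ φ₂ φ₃ : V →L[ℝ] V} (h : IsContactTriple ξ φ₁ φ₂ φ₃)
include h

theorem inner_self₁ (u : V) : ⟪φ₁ u, u⟫ = 0 := by
  have := h.skew₁ u u
  rw [real_inner_comm] at this
  linarith [real_inner_comm u (φ₁ u)]

theorem inner_self₂ (u : V) : ⟪φ₂ u, u⟫ = 0 := by
  have := h.skew₂ u u
  rw [real_inner_comm] at this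
  linarith [real_inner_comm u (φ₂ u)]

theorem inner_self₃ (u : V) : ⟪φ₃ u, u⟫ = 0 := by
  have := h.skew₃ u u
  rw [real_inner_comm] at this
  linarith [real_inner_comm u (φ₃ u)]

theorem inner₁₂ (u : V) : ⟪φ₁ u, φ₂ u⟫ = 0 := by
  rw [h.skew₁, h.mul₁₂, inner_neg_right, neg_neg, real_inner_comm, h.inner_self₃]

theorem inner₁₃ (u : V) : ⟪φ₁ u, φ₃ u⟫ = 0 := by
  rw [h.skew₁, h.mul₁₃, real_inner_comm, h.inner_self₂, neg_zero]

theorem inner₂₃ (u : V) : ⟪φ₂ u, φ₃ u⟫ = 0 := by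
  rw [h.skew₂, h.mul₂₃, inner_neg_right, neg_neg, real_inner_comm, h.inner_self₁]

theorem inner_map₁ (u v : V) : ⟪φ₁ u, φ₁ v⟫ = ⟪u, v⟫ - ⟪ξ, u⟫ * ⟪ξ, v⟫ := by
  rw [h.skew₁, h.sq₁, inner_add_right, inner_neg_right, inner_smul_right, real_inner_comm ξ u]
  ring

theorem inner_map₂ (u v : V) : ⟪φ₂ u, φ₂ v⟫ = ⟪u, v⟫ - ⟪ξ, u⟫ * ⟪ξ, v⟫ := by
  rw [h.skew₂, h.sq₂, inner_add_right, inner_neg_right, inner_smul_right, real_inner_comm ξ u]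
  ring

theorem inner_map₃ (u v : V) : ⟪φ₃ u, φ₃ v⟫ = ⟪u, v⟫ - ⟪ξ, u⟫ * ⟪ξ, v⟫ := by
  rw [h.skew₃, h.sq₃, inner_add_right, inner_neg_right, inner_smul_right, real_inner_comm ξ u]
  ring

/-- A nonzero vector orthogonal to `ξ` and its images under the three structures are linearly
independent. -/
theorem eq_zero_of_combination {e : V} (he : e ≠ 0) (hξe : ⟪ξ, e⟫ = 0) {r r₁ r₂ r₃ : ℝ}
    (hr : r • e + r₁ • φ₁ e + r₂ • φ₂ e + r₃ • φ₃ e = 0) : r = 0 ∧ r₁ = 0 ∧ r₂ = 0 ∧ r₃ = 0 := by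
  have h21 : ⟪φ₂ e, φ₁ e⟫ = 0 := by rw [real_inner_comm, h.inner₁₂]
  have h31 : ⟪φ₃ e, φ₁ e⟫ = 0 := by rw [real_inner_comm, h.inner₁₃]
  have h32 : ⟪φ₃ e, φ₂ e⟫ = 0 := by rw [real_inner_comm, h.inner₂₃]
  have k1 : ⟪e, φ₁ e⟫ = 0 := by rw [real_inner_comm, h.inner_self₁]
  have k2 : ⟪e, φ₂ e⟫ = 0 := by rw [real_inner_comm, h.inner_self₂]
  have k3 : ⟪e, φ₃ e⟫ = 0 := by rw [real_inner_comm, h.inner_self₃]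
  have key : ∀ w, r * ⟪e, w⟫ + r₁ * ⟪φ₁ e, w⟫ + r₂ * ⟪φ₂ e, w⟫ + r₃ * ⟪φ₃ e, w⟫ = 0 := by
    intro w
    have := congrArg (fun v ↦ ⟪v, w⟫) hr
    simpa only [inner_add_left, inner_smul_left, RCLike.conj_to_real, inner_zero_left] using this
  have e0 := key e
  have e1 := key (φ₁ e)
  have e2 := key (φ₂ e)
  have e3 := key (φ₃ e)
  simp only [h.inner_self₁, h.inner_self₂, h.inner_self₃, k1, k2, k3, h.inner₁₂, h.inner₁₃,
    h.inner₂₃, h21, h31, h32, h.inner_map₁, h.inner_map₂, h.inner_map₃, hξe, mul_zero, add_zero,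
    zero_add, sub_zero, mul_eq_zero, inner_self_eq_zero, he, or_false] at e0 e1 e2 e3
  exact ⟨e0, e1, e2, e3⟩

variable {S : V →L[ℝ] V} {a b c ε : ℝ} {da db dc : V →L[ℝ] ℝ} {F : V → V → V}

/-- If `F u v = (∇_u φ) v` satisfies the nearly Sasakian (`ε = 1`) or nearly cosymplectic (`ε = 0`)
identity, then `S` is diagonal and the derivatives of the coefficients of `φ` are determined. -/
theorem shape_of_nearly {e : V} (he : e ≠ 0) (hξe : ⟪ξ, e⟫ = 0)
    (hS : ∀ u v, ⟪S u, v⟫ = ⟪u, S v⟫) (habc : a ^ 2 + b ^ 2 + c ^ 2 = 1)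
    (hF : ∀ u v, F u v = da u • φ₁ v + db u • φ₂ v + dc u • φ₃ v +
      a • (⟪ξ, u⟫ • φ₂ v - ⟪ξ, v⟫ • φ₂ u + ⟪φ₂ u, v⟫ • ξ - ⟪S u, v⟫ • ξ + ⟪ξ, v⟫ • S u) +
      b • (-(⟪ξ, u⟫ • φ₁ v) - ⟪φ₁ u, v⟫ • ξ + ⟪ξ, v⟫ • φ₁ u + ⟪ξ, S u⟫ • φ₃ v -
        ⟪ξ, v⟫ • φ₃ (S u) + ⟪φ₃ (S u), v⟫ • ξ) +
      c • (⟪ξ, v⟫ • u - ⟪u, v⟫ • ξ -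
        (⟪ξ, S u⟫ • φ₂ v - ⟪ξ, v⟫ • φ₂ (S u) + ⟪φ₂ (S u), v⟫ • ξ)))
    (hnearly : ∀ u v, F u v + F v u = ε • (⟪ξ, v⟫ • u + ⟪ξ, u⟫ • v - (2 * ⟪u, v⟫) • ξ)) :
    ∃ σ μ : ℝ, (∀ u, S u = σ • u + ((μ - σ) * ⟪ξ, u⟫) • ξ) ∧ a * σ = ε - c ∧
      (∀ u, da u = 0) ∧ (∀ u, db u = c * (μ - σ) * ⟪ξ, u⟫) ∧
      ∀ u, dc u = -(b * (μ - σ) * ⟪ξ, u⟫) := by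
  have hξξ := h.inner_self
  -- the Reeb vector is an eigenvector
  obtain ⟨μ, hμ⟩ : ∃ μ : ℝ, S ξ = μ • ξ := by
    refine ⟨⟪S ξ, ξ⟫, ?_⟩
    set w := S ξ - ⟪S ξ, ξ⟫ • ξ with hw
    have h1 := hnearly ξ ξ
    have hwξ : ⟪ξ, w⟫ = 0 := by
      rw [hw, inner_sub_right, inner_smul_right, hξξ, real_inner_comm]
      ring
    have hSξ : S ξ = w + ⟪S ξ, ξ⟫ • ξ := by rw [hw]; abel
    have h2 : a • w - b • φ₃ w + c • φ₂ w = 0 := by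
      rw [hF, hSξ] at h1
      simp only [map_add, map_smul, h.apply₁, h.apply₂, h.apply₃, hξξ, inner_zero_left, smul_zero,
        h.inner₂', h.inner₃', add_zero, inner_add_left, inner_add_right, inner_smul_left,
        inner_smul_right, hwξ, real_inner_comm ξ w] at h1
      have h3 : (2 : ℝ) • (a • w - b • φ₃ w + c • φ₂ w) = 0 := by
        rw [← sub_eq_zero] at h1
        rw [← h1]
        simp
        module
      exact (smul_eq_zero.1 h3).resolve_left two_ne_zero
    have h4 : ∀ v, a * ⟪w, v⟫ - b * ⟪φ₃ w, v⟫ + c * ⟪φ₂ w, v⟫ = 0 := by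
      intro v
      have := congrArg (fun z ↦ ⟪z, v⟫) h2
      simpa only [inner_add_left, inner_sub_left, inner_smul_left, RCLike.conj_to_real,
        inner_zero_left] using this
    have e0 := h4 w
    have e2 := h4 (φ₂ w)
    have e3 := h4 (φ₃ w)
    rw [h.inner_self₂, h.inner_self₃] at e0
    rw [real_inner_comm, h.inner_self₂, real_inner_comm, h.inner₂₃, h.inner_map₂, hwξ] at e2
    rw [real_inner_comm, h.inner_self₃, h.inner₂₃, h.inner_map₃, hwξ] at e3
    have hww : ⟪w, w⟫ = 0 := by
      linear_combination (-⟪w, w⟫) * habc + a * e0 - b * e3 + c * e2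
    rw [hSξ, inner_self_eq_zero.1 hww, zero_add, inner_smul_left, hξξ]
    simp
  have hηS : ∀ X, ⟪ξ, S X⟫ = μ * ⟪ξ, X⟫ := by
    intro X
    rw [← hS, hμ, inner_smul_left]
    simp
  -- the identity for `X` orthogonal to `ξ`, and `ξ`
  have hX : ∀ X, ⟪ξ, X⟫ = 0 → a • S X - b • φ₃ (S X) + c • φ₂ (S X) + (c - ε) • X +
      da ξ • φ₁ X + (db ξ - c * μ) • φ₂ X + (dc ξ + b * μ) • φ₃ X = 0 := by
    intro X hX
    have h1 := hnearly X ξ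
    have hX' : ⟪X, ξ⟫ = 0 := by rw [real_inner_comm, hX]
    have hSX : ⟪S X, ξ⟫ = 0 := by rw [hS, hμ, inner_smul_right, hX', mul_zero]
    rw [hF, hF] at h1
    simp only [hμ, map_smul, h.apply₁, h.apply₂, h.apply₃, hξξ, hX, hX', hSX, h.inner₁', h.inner₂',
      h.inner₃', inner_smul_right, hηS, inner_zero_left,
      inner_smul_left, mul_zero, smul_zero, zero_smul] at h1
    rw [← sub_eq_zero] at h1
    rw [← h1]
    simp
    module
  have hSX : ∀ X, ⟪ξ, X⟫ = 0 → S X = -(a * (c - ε) - μ * (b ^ 2 + c ^ 2) - b * dc ξ + c * db ξ) •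
      X - (a * da ξ + b * db ξ + c * dc ξ) • φ₁ X -
      (a * db ξ - a * μ * c - b * da ξ - c * (c - ε)) • φ₂ X -
      (a * dc ξ + a * μ * b + b * (c - ε) - c * da ξ) • φ₃ X := by
    intro X hX₀
    have h1 := hX X hX₀
    have h2 : ⟪ξ, S X⟫ = 0 := by rw [hηS, hX₀, mul_zero]
    have h3 := congrArg φ₃ h1
    have h4 := congrArg φ₂ h1
    simp only [map_add, map_sub, map_smul, map_zero, h.sq₂, h.sq₃, h.mul₂₃, h.mul₃₂, h.mul₂₁,
      h.mul₃₁, h2, hX₀, zero_smul, add_zero] at h3 h4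
    -- multiply by the conjugate `a + b φ₃ - c φ₂` of the unit quaternion `a - b φ₃ + c φ₂`
    have h5 : S X = (a ^ 2 + b ^ 2 + c ^ 2) • S X := by rw [habc, one_smul]
    rw [h5]
    linear_combination (norm := module) a • h1 + b • h3 - c • h4
  -- symmetry of `S` kills the imaginary part
  have himag : ∀ {σ r₁ r₂ r₃ : ℝ}, (∀ X, ⟪ξ, X⟫ = 0 →
      S X = σ • X - r₁ • φ₁ X - r₂ • φ₂ X - r₃ • φ₃ X) → ∀ X, ⟪ξ, X⟫ = 0 → S X = σ • X := by
    intro σ r₁ r₂ r₃ hr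
    have hee : ⟪e, e⟫ ≠ 0 := inner_self_ne_zero.2 he
    have h21 : ⟪φ₂ e, φ₁ e⟫ = 0 := by rw [real_inner_comm, h.inner₁₂]
    have h31 : ⟪φ₃ e, φ₁ e⟫ = 0 := by rw [real_inner_comm, h.inner₁₃]
    have h32 : ⟪φ₃ e, φ₂ e⟫ = 0 := by rw [real_inner_comm, h.inner₂₃]
    have k1 : ⟪e, φ₁ e⟫ = 0 := by rw [real_inner_comm, h.inner_self₁]
    have k2 : ⟪e, φ₂ e⟫ = 0 := by rw [real_inner_comm, h.inner_self₂]
    have k3 : ⟪e, φ₃ e⟫ = 0 := by rw [real_inner_comm, h.inner_self₃]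
    have e1 := hS e (φ₁ e)
    have e2 := hS e (φ₂ e)
    have e3 := hS e (φ₃ e)
    rw [hr e hξe, hr _ (h.inner₁ e)] at e1
    rw [hr e hξe, hr _ (h.inner₂ e)] at e2
    rw [hr e hξe, hr _ (h.inner₃ e)] at e3
    simp only [h.sq₁, h.sq₂, h.sq₃, h.mul₁₂, h.mul₂₁, h.mul₁₃, h.mul₃₁, h.mul₂₃, h.mul₃₂,
      inner_sub_left, inner_sub_right, inner_add_right, inner_neg_right, inner_smul_left,
      inner_smul_right, RCLike.conj_to_real, h.inner₁₂, h.inner₁₃, h.inner₂₃, h21, h31, h32, k1,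
      k2, k3, h.inner_map₁, h.inner_map₂, h.inner_map₃, hξe] at e1 e2 e3
    have r1 : r₁ = 0 := (mul_eq_zero.1 (show r₁ * ⟪e, e⟫ = 0 by linarith)).resolve_right hee
    have r2 : r₂ = 0 := (mul_eq_zero.1 (show r₂ * ⟪e, e⟫ = 0 by linarith)).resolve_right hee
    have r3 : r₃ = 0 := (mul_eq_zero.1 (show r₃ * ⟪e, e⟫ = 0 by linarith)).resolve_right hee
    intro X hX
    rw [hr X hX, r1, r2, r3]
    simp
  set σ := -(a * (c - ε) - μ * (b ^ 2 + c ^ 2) - b * dc ξ + c * db ξ) with hσ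
  have hSD := himag hSX
  have hSu : ∀ u, S u = σ • u + ((μ - σ) * ⟪ξ, u⟫) • ξ := by
    intro u
    have h1 := hSD (u - ⟪ξ, u⟫ • ξ) (by rw [inner_sub_right, inner_smul_right, hξξ]; ring)
    rw [map_sub, map_smul, hμ, sub_eq_iff_eq_add] at h1
    rw [h1]
    module
  obtain ⟨r0, r1, r2, r3⟩ := h.eq_zero_of_combination he hξe (r := a * σ + (c - ε)) (r₁ := da ξ)
    (r₂ := db ξ - c * μ + c * σ) (r₃ := dc ξ + b * μ - b * σ) (by
      rw [← hX e hξe, hSD e hξe, map_smul, map_smul]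
      module)
  have hD : ∀ X, ⟪ξ, X⟫ = 0 → da X = 0 ∧ db X = 0 ∧ dc X = 0 := by
    intro X hX
    rcases eq_or_ne X 0 with rfl | hX0
    · simp
    have h1 := hnearly X X
    have h2 : a * σ + c = ε := by linarith
    rw [hF, hSD X hX, ← h2] at h1
    simp only [hX, map_smul, inner_smul_left, inner_smul_right, h.inner_self₁, h.inner_self₂,
      h.inner_self₃, RCLike.conj_to_real, mul_zero, zero_smul] at h1
    refine (h.eq_zero_of_combination hX0 hX (r := 0) (r₁ := da X) (r₂ := db X) (r₃ := dc X)
      ?_).2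
    linear_combination (norm := module) (1 / 2 : ℝ) • h1
  have hdec : ∀ (l : V →L[ℝ] ℝ), (∀ X, ⟪ξ, X⟫ = 0 → l X = 0) → ∀ u, l u = l ξ * ⟪ξ, u⟫ := by
    intro l hl u
    have h1 := hl (u - ⟪ξ, u⟫ • ξ) (by rw [inner_sub_right, inner_smul_right, hξξ]; ring)
    rw [map_sub, map_smul, sub_eq_zero] at h1
    rw [h1, smul_eq_mul, mul_comm]
  refine ⟨σ, μ, hSu, by linarith, fun u ↦ ?_, fun u ↦ ?_, fun u ↦ ?_⟩
  · rw [hdec da (fun X hX ↦ (hD X hX).1), r1, zero_mul]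
  · rw [hdec db (fun X hX ↦ (hD X hX).2.1)]
    linear_combination ⟪ξ, u⟫ * r2
  · rw [hdec dc (fun X hX ↦ (hD X hX).2.2)]
    linear_combination ⟪ξ, u⟫ * r3

end IsContactTriple

end Pointwise

/-! ### Linear combinations of the three structures -/

section Combinations

open Set VectorField Topology

variable {E : Type*} [NormedAddCommGroup E] [NormedSpace ℝ E] [FiniteDimensional ℝ E]
  {H : Type*} [TopologicalSpace H] {I : ModelWithCorners ℝ E H}
  {M : Type*} [TopologicalSpace M] [ChartedSpace H M] [IsManifold I ∞ M]
  (D : CovariantDerivative I E (TangentSpace I : M → Type _))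
  {A B : ∀ x : M, TangentSpace I x →L[ℝ] TangentSpace I x}

theorem IsSmoothEndo.add [T2Space M] (hA : IsSmoothEndo A) (hB : IsSmoothEndo B) :
    IsSmoothEndo fun x ↦ A x + B x :=
  isSmoothEndo_of_apply fun _ hX ↦ (hA.apply hX).add (hB.apply hX)

theorem IsSmoothEndo.smul [T2Space M] {g : M → ℝ} (hg : ContMDiff I 𝓘(ℝ, ℝ) ∞ g)
    (hA : IsSmoothEndo A) : IsSmoothEndo fun x ↦ g x • A x :=
  isSmoothEndo_of_apply fun _ hX ↦ (hA.apply hX).smul hg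

theorem covDerivEndo_add (hA : IsSmoothEndo A) (hB : IsSmoothEndo B)
    (hAB : IsSmoothEndo fun x ↦ A x + B x) (x : M) (u v : TangentSpace I x) :
    covDerivEndo D hAB x u v = covDerivEndo D hA x u v + covDerivEndo D hB x u v := by
  have hY := mdifferentiableAt_extend I E v
  have h := covDerivEndo_apply D hAB x u hY
  have h1 := covDerivEndo_apply D hA x u hY
  have h2 := covDerivEndo_apply D hB x u hY
  have h3 := D.isCovariantDerivativeOn.add (hA.mdifferentiableAt_apply hY)
    (hB.mdifferentiableAt_apply hY)
  rw [extend_apply_self] at h h1 h2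
  rw [h, h1, h2]
  refine (congrArg (fun L : TangentSpace I x →L[ℝ] TangentSpace I x ↦
    L u - (A x + B x) (D (extend E v) x u)) h3).trans ?_
  simp only [add_apply]
  abel

theorem covDerivEndo_smul {g : M → ℝ} (hg : ContMDiff I 𝓘(ℝ, ℝ) ∞ g) (hA : IsSmoothEndo A)
    (hgA : IsSmoothEndo fun x ↦ g x • A x) (x : M) (u v : TangentSpace I x) :
    covDerivEndo D hgA x u v = mvfderiv I g x u • A x v + g x • covDerivEndo D hA x u v := by
  have hY := mdifferentiableAt_extend I E v
  have h := covDerivEndo_apply D hgA x u hY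
  have h1 := covDerivEndo_apply D hA x u hY
  have h3 := D.isCovariantDerivativeOn.leibniz (hA.mdifferentiableAt_apply hY)
    ((hg x).mdifferentiableAt (by simp))
  rw [extend_apply_self] at h h1
  rw [h, h1]
  refine (congrArg (fun L : TangentSpace I x →L[ℝ] TangentSpace I x ↦
    L u - (g x • A x) (D (extend E v) x u)) h3).trans ?_
  simp [extend_apply_self]
  module

variable [RiemannianBundle (fun x : M ↦ TangentSpace I x)]
  [IsContMDiffRiemannianBundle I ∞ E (fun x : M ↦ TangentSpace I x)]
  {D : CovariantDerivative I E (TangentSpace I : M → Type _)}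

omit [IsContMDiffRiemannianBundle I ∞ E (fun x : M ↦ TangentSpace I x)] in
theorem exists_ne_zero_inner_eq_zero (hdim : 1 < Module.finrank ℝ E)
    (ξ : ∀ x : M, TangentSpace I x) (x : M) :
    ∃ e : TangentSpace I x, e ≠ 0 ∧ (inner ℝ (ξ x) e : ℝ) = 0 := by
  have h := LinearMap.ker_ne_bot_of_finrank_lt (f := (dualForm ξ x).toLinearMap) (by
    rw [Module.finrank_self]
    exact hdim)
  obtain ⟨e, he, he0⟩ := Submodule.exists_mem_ne_zero_of_ne_bot h
  exact ⟨e, he0, he⟩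

namespace IsNearlyKahlerHypersurface

variable {S : ∀ x : M, TangentSpace I x →L[ℝ] TangentSpace I x} {ξ : ∀ x : M, TangentSpace I x}
  {φ₁ φ₂ φ₃ φ : ∀ x : M, TangentSpace I x →L[ℝ] TangentSpace I x}
  (h : IsNearlyKahlerHypersurface D S ξ φ₁ φ₂ φ₃) {a b c : M → ℝ}
include h

/-- The equation for `∇φ₂` follows from the others and `φ₂ = φ₁ φ₃`. -/
theorem cov₂ [T2Space M] [I.Boundaryless] (x : M) (u v : TangentSpace I x) :
    covDerivEndo D h.smooth₂ x u v =
    -((inner ℝ (ξ x) u : ℝ) • φ₁ x v) - (inner ℝ (φ₁ x u) v : ℝ) • ξ x +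
      (inner ℝ (ξ x) v : ℝ) • φ₁ x u + (inner ℝ (ξ x) (S x u) : ℝ) • φ₃ x v -
      (inner ℝ (ξ x) v : ℝ) • φ₃ x (S x u) + (inner ℝ (φ₃ x (S x u)) v : ℝ) • ξ x := by
  obtain ⟨Y, hY, rfl⟩ := exists_isSmoothVectorField_apply_eq v
  have hYx := hY.mdifferentiableAt x
  have hc := h.triple x
  have e2 := cov_endo_apply D h.smooth₂ hYx u
  have e1 := cov_endo_apply D h.smooth₁ (h.smooth₃.mdifferentiableAt_apply hYx) u
  have e3 := cov_endo_apply D h.smooth₃ hYx u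
  have e : (fun y ↦ φ₁ y (φ₃ y (Y y))) = fun y ↦ φ₂ y (Y y) :=
    funext fun y ↦ (h.triple y).mul₁₃ (Y y)
  rw [e, e2, e3, h.cov₁, h.cov₃] at e1
  have hS : (inner ℝ (S x u) (φ₃ x (Y x)) : ℝ) = -inner ℝ (φ₃ x (S x u)) (Y x) := by
    rw [hc.skew₃, neg_neg]
  have h2 : (inner ℝ (φ₂ x u) (φ₃ x (Y x)) : ℝ) = -inner ℝ (φ₁ x u) (Y x) := by
    rw [hc.skew₂, hc.mul₂₃, inner_neg_right, neg_neg, ← neg_eq_iff_eq_neg, ← hc.skew₁]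
  have h3 : φ₁ x (φ₃ x (D Y x u)) = φ₂ x (D Y x u) := hc.mul₁₃ _
  simp only [map_add, map_sub, map_smul, hc.apply₁, smul_zero, hc.mul₁₂, hc.mul₂₃, hc.inner₃,
    hS, h2, h3, zero_smul, sub_zero, add_zero] at e1
  rw [← add_left_inj (φ₂ x (D Y x u)), e1]
  module

theorem smooth_combination [T2Space M] (ha : ContMDiff I 𝓘(ℝ, ℝ) ∞ a)
    (hb : ContMDiff I 𝓘(ℝ, ℝ) ∞ b) (hc : ContMDiff I 𝓘(ℝ, ℝ) ∞ c)
    (hφ : ∀ x, φ x = a x • φ₁ x + b x • φ₂ x + c x • φ₃ x) : IsSmoothEndo φ := by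
  rw [show φ = _ from funext hφ]
  exact ((h.smooth₁.smul ha).add (h.smooth₂.smul hb)).add (h.smooth₃.smul hc)

theorem covDerivEndo_combination [T2Space M] (ha : ContMDiff I 𝓘(ℝ, ℝ) ∞ a)
    (hb : ContMDiff I 𝓘(ℝ, ℝ) ∞ b) (hc : ContMDiff I 𝓘(ℝ, ℝ) ∞ c)
    (hφ : ∀ x, φ x = a x • φ₁ x + b x • φ₂ x + c x • φ₃ x) (hsφ : IsSmoothEndo φ)
    (x : M) (u v : TangentSpace I x) : covDerivEndo D hsφ x u v =
    mvfderiv I a x u • φ₁ x v + mvfderiv I b x u • φ₂ x v + mvfderiv I c x u • φ₃ x v +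
      a x • covDerivEndo D h.smooth₁ x u v + b x • covDerivEndo D h.smooth₂ x u v +
      c x • covDerivEndo D h.smooth₃ x u v := by
  obtain rfl : φ = _ := funext hφ
  have h1 := h.smooth₁.smul ha
  have h2 := h.smooth₂.smul hb
  have h3 := h.smooth₃.smul hc
  rw [covDerivEndo_add D (h1.add h2) h3, covDerivEndo_add D h1 h2,
    covDerivEndo_smul D ha h.smooth₁, covDerivEndo_smul D hb h.smooth₂,
    covDerivEndo_smul D hc h.smooth₃]
  abel

theorem isAlmostContactMetric [T2Space M] (ha : ContMDiff I 𝓘(ℝ, ℝ) ∞ a)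
    (hb : ContMDiff I 𝓘(ℝ, ℝ) ∞ b) (hc : ContMDiff I 𝓘(ℝ, ℝ) ∞ c)
    (habc : ∀ x, a x ^ 2 + b x ^ 2 + c x ^ 2 = 1)
    (hφ : ∀ x, φ x = a x • φ₁ x + b x • φ₂ x + c x • φ₃ x) : IsAlmostContactMetric ξ φ := by
  have hη : ∀ x (u : TangentSpace I x), dualForm ξ x u = inner ℝ (ξ x) u := fun x u ↦ rfl
  have hsq : ∀ x (u : TangentSpace I x), φ x (φ x u) = -u + dualForm ξ x u • ξ x := by
    intro x u
    have ht := h.triple x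
    rw [hη, hφ]
    simp only [add_apply, smul_apply, map_add, map_smul, ht.sq₁, ht.sq₂, ht.sq₃, ht.mul₁₂,
      ht.mul₂₁, ht.mul₁₃, ht.mul₃₁, ht.mul₂₃, ht.mul₃₂]
    have h1 : -u + (inner ℝ (ξ x) u : ℝ) • ξ x =
        (a x ^ 2 + b x ^ 2 + c x ^ 2) • (-u + (inner ℝ (ξ x) u : ℝ) • ξ x) := by
      rw [habc, one_smul]
    refine Eq.trans ?_ h1.symm
    module
  refine ⟨h.smooth_reeb, h.smooth_combination ha hb hc hφ, fun x ↦ ?_, fun x u v ↦ ?_, hsq⟩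
  · have := (h.triple x).inner_self
    rw [real_inner_self_eq_norm_sq] at this
    exact (pow_eq_one_iff_of_nonneg (norm_nonneg _) two_ne_zero).1 this
  · have ht := h.triple x
    have hskew : (inner ℝ (φ x u) (φ x v) : ℝ) = -inner ℝ u (φ x (φ x v)) := by
      rw [hφ]
      simp only [add_apply, smul_apply, inner_add_left, inner_add_right, inner_smul_left,
        inner_smul_right, ht.skew₁ u, ht.skew₂ u, ht.skew₃ u, RCLike.conj_to_real]
      simp only [map_add, map_smul, inner_add_right, inner_smul_right]
      ring
    rw [hskew, hsq, inner_add_right, inner_neg_right, inner_smul_right, hη, hη,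
      real_inner_comm (ξ x) u]
    ring

/-- For a nearly Sasakian (`ε = 1`) or nearly cosymplectic (`ε = 0`) structure, the shape operator
has an eigenvalue `σ` on `ξ^⊥` and an eigenvalue `μ` on `ξ`, and the coefficients `b` and `c` vary
along `ξ` at a rate proportional to `μ - σ`. -/
theorem exists_shape_eq [T2Space M] [I.Boundaryless] (ha : ContMDiff I 𝓘(ℝ, ℝ) ∞ a)
    (hb : ContMDiff I 𝓘(ℝ, ℝ) ∞ b) (hc : ContMDiff I 𝓘(ℝ, ℝ) ∞ c)
    (hφ : ∀ x, φ x = a x • φ₁ x + b x • φ₂ x + c x • φ₃ x) (hsφ : IsSmoothEndo φ)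
    (hdim : 1 < Module.finrank ℝ E) (habc : ∀ x, a x ^ 2 + b x ^ 2 + c x ^ 2 = 1) {ε : ℝ}
    (hnearly : ∀ x (u v : TangentSpace I x),
      covDerivEndo D hsφ x u v + covDerivEndo D hsφ x v u =
        ε • ((inner ℝ (ξ x) v : ℝ) • u + (inner ℝ (ξ x) u : ℝ) • v -
          (2 * inner ℝ u v : ℝ) • ξ x)) (x : M) :
    ∃ σ μ : ℝ, (∀ u, S x u = σ • u + ((μ - σ) * inner ℝ (ξ x) u) • ξ x) ∧ a x * σ = ε - c x ∧
      (∀ u : TangentSpace I x, mvfderiv I a x u = 0) ∧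
      (∀ u : TangentSpace I x, mvfderiv I b x u = c x * (μ - σ) * inner ℝ (ξ x) u) ∧
      ∀ u : TangentSpace I x, mvfderiv I c x u = -(b x * (μ - σ) * inner ℝ (ξ x) u) := by
  obtain ⟨e, he, hξe⟩ := exists_ne_zero_inner_eq_zero hdim ξ x
  refine (h.triple x).shape_of_nearly he hξe (h.shape_comm x) (habc x)
    (F := fun u v ↦ covDerivEndo D hsφ x u v) (fun u v ↦ ?_) (hnearly x)
  rw [h.covDerivEndo_combination ha hb hc hφ hsφ, h.cov₁, h.cov₂, h.cov₃]

end IsNearlyKahlerHypersurface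

end Combinations

/-! ### The Sasakian and co-Kähler conditions -/

section Sasakian

open Set VectorField Topology

variable {E : Type*} [NormedAddCommGroup E] [NormedSpace ℝ E] [FiniteDimensional ℝ E]
  {H : Type*} [TopologicalSpace H] {I : ModelWithCorners ℝ E H} [I.Boundaryless]
  {M : Type*} [TopologicalSpace M] [T2Space M] [ChartedSpace H M] [IsManifold I ∞ M]
  [RiemannianBundle (fun x : M ↦ TangentSpace I x)]
  [IsContMDiffRiemannianBundle I ∞ E (fun x : M ↦ TangentSpace I x)]
  {D : CovariantDerivative I E (TangentSpace I : M → Type _)}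

namespace IsNearlyKahlerHypersurface

variable {S : ∀ x : M, TangentSpace I x →L[ℝ] TangentSpace I x} {ξ : ∀ x : M, TangentSpace I x}
  {φ₁ φ₂ φ₃ φ : ∀ x : M, TangentSpace I x →L[ℝ] TangentSpace I x}
  (h : IsNearlyKahlerHypersurface D S ξ φ₁ φ₂ φ₃) {a b c : M → ℝ}
  (hdim : 1 < Module.finrank ℝ E) (ha : ContMDiff I 𝓘(ℝ, ℝ) ∞ a)
  (hb : ContMDiff I 𝓘(ℝ, ℝ) ∞ b) (hc : ContMDiff I 𝓘(ℝ, ℝ) ∞ c)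
  (habc : ∀ x, a x ^ 2 + b x ^ 2 + c x ^ 2 = 1)
  (hφ : ∀ x, φ x = a x • φ₁ x + b x • φ₂ x + c x • φ₃ x)
include h hdim ha hb hc habc hφ

/-- The Sasakian (`ε = 1`) or co-Kähler (`ε = 0`) equation is stronger than the nearly Sasakian or
nearly cosymplectic one by two scalar equations, the `ξ`-components of `(∇_u φ) (φ₁ u)` and
`(∇_u φ) (φ₂ u)` for `u` orthogonal to `ξ`. -/
theorem coeff_of_covDerivEndo_eq (hsφ : IsSmoothEndo φ) {ε : ℝ}
    (hcov : ∀ x (u v : TangentSpace I x), covDerivEndo D hsφ x u v =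
      ε • ((inner ℝ (ξ x) v : ℝ) • u - (inner ℝ u v : ℝ) • ξ x)) (x : M) :
    b x = 0 ∧ ∃ σ μ : ℝ, (∀ u, S x u = σ • u + ((μ - σ) * inner ℝ (ξ x) u) • ξ x) ∧
      a x * σ = ε - c x ∧ a x = c x * σ ∧
      ∀ u : TangentSpace I x, mvfderiv I b x u = c x * (μ - σ) * inner ℝ (ξ x) u := by
  obtain ⟨σ, μ, hS, hσ, -, hdb, -⟩ := h.exists_shape_eq ha hb hc hφ hsφ hdim habc (ε := ε)
    (fun x u v ↦ by
      rw [hcov, hcov, real_inner_comm u v]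
      module) x
  obtain ⟨e, he, hξe⟩ := exists_ne_zero_inner_eq_zero hdim ξ x
  have ht := h.triple x
  have hee : (inner ℝ e e : ℝ) ≠ 0 := inner_self_ne_zero.2 he
  have hSe : S x e = σ • e := by rw [hS, hξe, mul_zero, zero_smul, add_zero]
  have key : ∀ v, (inner ℝ (ξ x) v : ℝ) = 0 →
      a x * (inner ℝ (φ₂ x e) v - σ * inner ℝ e v) +
        b x * (-inner ℝ (φ₁ x e) v + σ * inner ℝ (φ₃ x e) v) -
        c x * (inner ℝ e v + σ * inner ℝ (φ₂ x e) v) = -ε * inner ℝ e v := by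
    intro v hv
    have h1 := congrArg (fun w ↦ (inner ℝ (ξ x) w : ℝ)) (hcov x e v)
    simp only [h.covDerivEndo_combination ha hb hc hφ hsφ, h.cov₁, h.cov₂, h.cov₃, hv, hSe, hξe,
      inner_add_right, inner_sub_right, inner_neg_right, inner_smul_right, inner_smul_left,
      map_smul, ht.inner₁, ht.inner₂, ht.inner₃, ht.inner_self, RCLike.conj_to_real, mul_zero] at h1
    linear_combination h1
  have k1 := key _ (ht.inner₁ e)
  have k2 := key _ (ht.inner₂ e)
  have h21 : (inner ℝ (φ₂ x e) (φ₁ x e) : ℝ) = 0 := by rw [real_inner_comm, ht.inner₁₂]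
  have h31 : (inner ℝ (φ₃ x e) (φ₁ x e) : ℝ) = 0 := by rw [real_inner_comm, ht.inner₁₃]
  have h32 : (inner ℝ (φ₃ x e) (φ₂ x e) : ℝ) = 0 := by rw [real_inner_comm, ht.inner₂₃]
  have h01 : (inner ℝ e (φ₁ x e) : ℝ) = 0 := by rw [real_inner_comm, ht.inner_self₁]
  have h02 : (inner ℝ e (φ₂ x e) : ℝ) = 0 := by rw [real_inner_comm, ht.inner_self₂]
  rw [h21, h31, h01, ht.inner_map₁, hξe] at k1
  rw [h32, h02, ht.inner_map₂, ht.inner₁₂, hξe] at k2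
  refine ⟨(mul_eq_zero.1 (show b x * inner ℝ e e = 0 by linarith)).resolve_right hee,
    σ, μ, hS, hσ, ?_, hdb⟩
  have := (mul_eq_zero.1 (show (a x - c x * σ) * inner ℝ e e = 0 by linarith)).resolve_right hee
  linarith

theorem isSasakian_iff : IsSasakian D ξ φ ↔ (∀ x, S x = 0) ∧ ∀ x, φ x = φ₃ x := by
  have hη : ∀ x (u : TangentSpace I x), dualForm ξ x u = inner ℝ (ξ x) u := fun x u ↦ rfl
  have hacm := h.isAlmostContactMetric ha hb hc habc hφ
  constructor
  · intro hS
    have hcoeff := h.coeff_of_covDerivEndo_eq hdim ha hb hc habc hφ hS.smooth_tensor (ε := 1)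
      (fun x u v ↦ by rw [hS.nabla_eq, one_smul, hη])
    -- `b` vanishes identically, and so does its derivative `c (μ - σ) η`
    have hb0 : b = fun _ ↦ 0 := funext fun x ↦ (hcoeff x).1
    have hx : ∀ x, S x = 0 ∧ φ x = φ₃ x := by
      intro x
      obtain ⟨hbx, σ, μ, hSx, h1, h2, hdb⟩ := hcoeff x
      have h3 := habc x
      have hc1 : c x = 1 := by
        rw [hbx] at h3
        linear_combination h3 - c x * h1 - a x * h2
      have hσ : σ = 0 := by
        have : σ * σ = 0 := by
          rw [h2, hc1] at h1
          linarith
        exact mul_self_eq_zero.1 this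
      have hμ : μ = 0 := by
        have h4 := hdb (ξ x)
        rw [hb0, mvfderiv_const, hc1, hσ, (h.triple x).inner_self] at h4
        have h5 : (0 : ℝ) = 1 * (μ - 0) * 1 := h4
        linarith
      constructor
      · ext1 u
        rw [hSx, hσ, hμ]
        simp
      · rw [hφ, h2, hbx, hσ, hc1]
        simp
    exact ⟨fun x ↦ (hx x).1, fun x ↦ (hx x).2⟩
  · rintro ⟨hS, h3⟩
    obtain rfl : φ = φ₃ := funext h3
    refine ⟨hacm, fun x u v ↦ ?_⟩
    have h4 := h.cov₃ x u v
    rw [hη]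
    rw [hS] at h4
    simpa using h4

theorem not_isCoKahler [Nonempty M] : ¬ IsCoKahler D ξ φ := by
  intro hK
  obtain ⟨x⟩ := ‹Nonempty M›
  obtain ⟨hbx, σ, μ, -, h1, h2, -⟩ := h.coeff_of_covDerivEndo_eq hdim ha hb hc habc hφ
    hK.smooth_tensor (ε := 0) (fun x u v ↦ by rw [hK.nabla_eq, zero_smul]) x
  have h3 := habc x
  rw [hbx] at h3
  have hc0 : c x * (1 + σ ^ 2) = 0 := by rw [h2] at h1; linarith
  have hc0 : c x = 0 := (mul_eq_zero.1 hc0).resolve_right (by positivity)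
  rw [h2, hc0] at h3
  norm_num at h3

end IsNearlyKahlerHypersurface

end Sasakian

/-! ### Closed two-forms and constant functions -/

section Closed

open Set VectorField Topology

variable {E : Type*} [NormedAddCommGroup E] [NormedSpace ℝ E]
  {H : Type*} [TopologicalSpace H] {I : ModelWithCorners ℝ E H} [I.Boundaryless]
  {M : Type*} [TopologicalSpace M] [ChartedSpace H M] [IsManifold I ∞ M]

/-- A function with vanishing derivative on a connected manifold is constant. -/
theorem apply_eq_of_mvfderiv_eq_zero [PreconnectedSpace M] {F : Type*} [NormedAddCommGroup F]
    [NormedSpace ℝ F] {g : M → F} (hg : ContMDiff I 𝓘(ℝ, F) ∞ g)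
    (hdg : ∀ x (u : TangentSpace I x), mvfderiv I g x u = 0) (x y : M) : g x = g y := by
  refine IsLocallyConstant.apply_eq_of_preconnectedSpace
    ((IsLocallyConstant.iff_eventually_eq g).2 fun x ↦ ?_) x y
  have : IsManifold I 1 M := IsManifold.of_le (n := ∞) (by norm_cast)
  have ht : (extChartAt I x).target ∈ 𝓝 (extChartAt I x x) := extChartAt_target_mem_nhds x
  obtain ⟨r, hr, hball⟩ := Metric.mem_nhds_iff.1 ht
  have hd : ∀ z ∈ (extChartAt I x).target,
      HasFDerivAt (g ∘ (extChartAt I x).symm) (0 : E →L[ℝ] F) z := by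
    intro z hz
    have hsd : MDifferentiableAt 𝓘(ℝ, E) I (extChartAt I x).symm z := by
      have := mdifferentiableWithinAt_extChartAt_symm (I := I) hz
      rwa [I.range_eq_univ, mdifferentiableWithinAt_univ] at this
    have hgz : MDifferentiableAt I 𝓘(ℝ, F) g ((extChartAt I x).symm z) :=
      (hg _).mdifferentiableAt (by simp)
    have h1 : DifferentiableAt ℝ (g ∘ (extChartAt I x).symm) z :=
      (hgz.comp z hsd).differentiableAt
    have h2 : fderiv ℝ (g ∘ (extChartAt I x).symm) z = 0 := by
      ext w
      rw [← mvfderiv_eq_fderiv, mvfderiv_comp_apply_eq (I := 𝓘(ℝ, E)) (I' := I) hgz hsd rfl w, hdg]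
      rfl
    exact h2 ▸ h1.hasFDerivAt
  have hconst := fun y (hy : extChartAt I x y ∈ Metric.ball (extChartAt I x x) r) ↦
    (convex_ball (extChartAt I x x) r).is_const_of_fderivWithin_eq_zero (𝕜 := ℝ)
    (f := g ∘ (extChartAt I x).symm)
    (fun z hz ↦ (hd z (hball hz)).differentiableAt.differentiableWithinAt)
    (fun z hz ↦ by
      rw [fderivWithin_of_isOpen Metric.isOpen_ball hz]
      exact (hd z (hball hz)).fderiv) hy (Metric.mem_ball_self hr)
  filter_upwards [(continuousAt_extChartAt (I := I) x).preimage_mem_nhds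
    (Metric.ball_mem_nhds _ hr), extChartAt_source_mem_nhds (I := I) x] with y hy hys
  have := hconst y hy
  simpa only [Function.comp_apply, (extChartAt I x).left_inv hys, extChartAt_to_inv] using this

variable [FiniteDimensional ℝ E] [T2Space M] [RiemannianBundle (fun x : M ↦ TangentSpace I x)]
  [IsContMDiffRiemannianBundle I ∞ E (fun x : M ↦ TangentSpace I x)]
  {D : CovariantDerivative I E (TangentSpace I : M → Type _)}

/-- If `K = ∇ξ` is skew-symmetric, then `2 g(K · , ·)` is the exterior derivative of the one-form
dual to `ξ`, and is therefore closed. -/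
theorem IsLeviCivita.inner_covDerivEndo_cyclic (hD : IsLeviCivita D)
    {ξ : ∀ x : M, TangentSpace I x} (hξ : IsSmoothVectorField ξ)
    {K : ∀ x : M, TangentSpace I x →L[ℝ] TangentSpace I x} (hK : IsSmoothEndo K)
    (hskew : ∀ x (u v : TangentSpace I x), (inner ℝ (K x u) v : ℝ) = -inner ℝ u (K x v))
    (hξK : ∀ x (u : TangentSpace I x), D ξ x u = K x u) (x : M) (u v w : TangentSpace I x) :
    (inner ℝ (covDerivEndo D hK x u v) w : ℝ) + inner ℝ (covDerivEndo D hK x v w) u +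
      inner ℝ (covDerivEndo D hK x w u) v = 0 := by
  have : CompleteSpace E := FiniteDimensional.complete ℝ E
  obtain ⟨X, hX, hXx, hcomm⟩ := exists_commuting_fields (I := I) x
  -- `q p r` is the derivative of `η (X r)` in the direction of `X p`
  set q : TangentSpace I x → TangentSpace I x → M → ℝ :=
    fun p r y ↦ mvfderiv I (fun z ↦ (inner ℝ (ξ z) (X r z) : ℝ)) y (X p y) with hq
  have hqe : ∀ p r, q p r = fun y ↦ (inner ℝ (K y (X p y)) (X r y) : ℝ) +
      inner ℝ (ξ y) (D (X r) y (X p y)) := by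
    intro p r
    funext y
    rw [hq, ← hξK]
    exact hD.mvfderiv_inner (hξ.mdifferentiableAt y) ((hX r).mdifferentiableAt y) _
  have hqd : ∀ p r, MDifferentiableAt I 𝓘(ℝ, ℝ) (q p r) x := by
    intro p r
    rw [hqe]
    exact ((((hK.apply (hX p)).inner (hX r)).add
      (hξ.inner (hD.isSmoothVectorField_cov (hX p) (hX r)))) x).mdifferentiableAt (by simp)
  have hqq : ∀ p r s, mvfderiv I (q r s) x p = mvfderiv I (q p s) x r := by
    intro p r s
    have h := mvfderiv_mvfderiv_sub (((hξ.inner (hX s)) x).of_le (by norm_cast))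
      ((hX p).mdifferentiableAt x) ((hX r).mdifferentiableAt x)
    rw [(hcomm p r).self_of_nhds, map_zero, hXx, hXx] at h
    exact sub_eq_zero.1 h
  have hKq : ∀ p r s, mvfderiv I (fun y ↦ (inner ℝ (K y (X p y)) (X r y) : ℝ)) x s =
      (mvfderiv I (q p r) x s - mvfderiv I (q r p) x s) / 2 := by
    intro p r s
    have h : (fun y ↦ (inner ℝ (K y (X p y)) (X r y) : ℝ)) =ᶠ[𝓝 x]
        (fun _ ↦ (1 / 2 : ℝ)) * (q p r - q r p) := by
      filter_upwards [hcomm p r] with y hy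
      have h1 := hD.sub_eq_mlieBracket ((hX p).mdifferentiableAt y) ((hX r).mdifferentiableAt y)
      rw [hy, sub_eq_zero] at h1
      have h2 : (inner ℝ (K y (X r y)) (X p y) : ℝ) = -inner ℝ (K y (X p y)) (X r y) := by
        rw [hskew, real_inner_comm]
      rw [Pi.mul_apply, Pi.sub_apply, hqe, hqe]
      simp only [h1, h2]
      ring
    rw [mvfderiv_congr h, mvfderiv_mul mdifferentiableAt_const ((hqd p r).sub (hqd r p)),
      mvfderiv_sub (hqd p r) (hqd r p), mvfderiv_const]
    simp
    ring
  have h := mvfderiv_inner_endo_cyclic hD hK hskew (hX u) (hX v) (hX w)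
    (hcomm u v).self_of_nhds (hcomm v w).self_of_nhds (hcomm w u).self_of_nhds
  simp only [hXx] at h
  rw [← h, hKq, hKq, hKq, hqq u v w, hqq v w u, hqq w u v]
  ring

end Closed

/-! ### The shape operator is a constant multiple of the identity -/

section Umbilical

open Set VectorField Topology

variable {E : Type*} [NormedAddCommGroup E] [NormedSpace ℝ E] [FiniteDimensional ℝ E]
  {H : Type*} [TopologicalSpace H] {I : ModelWithCorners ℝ E H} [I.Boundaryless]
  {M : Type*} [TopologicalSpace M] [T2Space M] [ChartedSpace H M] [IsManifold I ∞ M]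
  [RiemannianBundle (fun x : M ↦ TangentSpace I x)]
  [IsContMDiffRiemannianBundle I ∞ E (fun x : M ↦ TangentSpace I x)]
  {D : CovariantDerivative I E (TangentSpace I : M → Type _)}

namespace IsNearlyKahlerHypersurface

variable {S : ∀ x : M, TangentSpace I x →L[ℝ] TangentSpace I x} {ξ : ∀ x : M, TangentSpace I x}
  {φ₁ φ₂ φ₃ φ : ∀ x : M, TangentSpace I x →L[ℝ] TangentSpace I x}
  (h : IsNearlyKahlerHypersurface D S ξ φ₁ φ₂ φ₃) (hdim : 1 < Module.finrank ℝ E)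
  {σ μ : M → ℝ}
  (hS : ∀ x (u : TangentSpace I x),
    S x u = σ x • u + ((μ x - σ x) * inner ℝ (ξ x) u : ℝ) • ξ x)
include h hdim hS

omit hdim in
theorem cov_reeb_eq (x : M) (u : TangentSpace I x) :
    D ξ x u = φ₃ x u + σ x • φ₁ x u := by
  rw [h.cov_reeb, hS, map_add, map_smul, map_smul, (h.triple x).apply₁, smul_zero, add_zero]

/-- The eigenvalue `σ` is smooth, because `σ φ₁ = ∇ξ - φ₃` is. -/
theorem contMDiff_eigenvalue (hD : IsLeviCivita D) : ContMDiff I 𝓘(ℝ, ℝ) ∞ σ := by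
  intro x
  obtain ⟨e, he, hξe⟩ := exists_ne_zero_inner_eq_zero hdim ξ x
  obtain ⟨Z, hZ, rfl⟩ := exists_isSmoothVectorField_apply_eq e
  have hφZ := h.smooth₁.apply hZ
  have hW : IsSmoothVectorField fun y ↦ D ξ y (Z y) - φ₃ y (Z y) :=
    (hD.isSmoothVectorField_cov hZ h.smooth_reeb).sub (h.smooth₃.apply hZ)
  have hden : (inner ℝ (φ₁ x (Z x)) (φ₁ x (Z x)) : ℝ) ≠ 0 := by
    rw [(h.triple x).inner_map₁, hξe, zero_mul, sub_zero]
    exact inner_self_ne_zero.2 he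
  have hq := ((hW.inner hφZ) x).div₀ ((hφZ.inner hφZ) x) hden
  refine hq.congr_of_eventuallyEq ?_
  filter_upwards [((hφZ.inner hφZ).continuous.continuousAt).eventually_ne hden] with y hy
  rw [Pi.div_apply]
  rw [h.cov_reeb_eq hS, add_sub_cancel_left, inner_smul_left, RCLike.conj_to_real,
    mul_div_cancel_right₀ _ hy]

/-- If the shape operator has the eigenvalue `σ` on `ξ^⊥` and `μ` on `ξ`, then `μ = σ` is locally
constant: the two-form `g(∇ξ · , ·)` is exact, and its exterior derivative is the cyclic sum of
`(σ - μ) η ⊗ g(φ₂ · , ·) + dσ ⊗ g(φ₁ · , ·)`. -/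
theorem eigenvalue_eq_and_mvfderiv_eq_zero (hD : IsLeviCivita D) (x : M) :
    μ x = σ x ∧ ∀ u : TangentSpace I x, mvfderiv I σ x u = 0 := by
  have hσ := h.contMDiff_eigenvalue hdim hS hD
  have hs := h.smooth₁.smul hσ
  have hK := h.smooth₃.add hs
  have key := hD.inner_covDerivEndo_cyclic h.smooth_reeb hK (fun x u v ↦ by
    simp only [add_apply, smul_apply, inner_add_left, inner_add_right, inner_smul_left,
      inner_smul_right, (h.triple x).skew₁ u, (h.triple x).skew₃ u, RCLike.conj_to_real]
    ring) (fun x u ↦ h.cov_reeb_eq hS x u) x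
  have ht := h.triple x
  have hcyc : ∀ u v w : TangentSpace I x,
      (σ x - μ x) * (inner ℝ (ξ x) u * inner ℝ (φ₂ x v) w + inner ℝ (ξ x) v * inner ℝ (φ₂ x w) u +
        inner ℝ (ξ x) w * inner ℝ (φ₂ x u) v) + mvfderiv I σ x u * inner ℝ (φ₁ x v) w +
        mvfderiv I σ x v * inner ℝ (φ₁ x w) u + mvfderiv I σ x w * inner ℝ (φ₁ x u) v = 0 := by
    intro u v w
    have h1 := key u v w
    have k : ∀ p r : TangentSpace I x,
        (inner ℝ (φ₂ x p) r : ℝ) = -inner ℝ (φ₂ x r) p := by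
      intro p r
      rw [ht.skew₂, real_inner_comm]
    simp only [covDerivEndo_add D h.smooth₃ hs, covDerivEndo_smul D hσ h.smooth₁, h.cov₁, h.cov₃,
      hS, map_add, map_smul, ht.apply₂, inner_add_left, inner_sub_left, inner_smul_left,
      inner_add_right, inner_smul_right, ht.inner_self, RCLike.conj_to_real, smul_zero,
      add_zero] at h1
    rw [real_inner_comm u v, real_inner_comm v w, real_inner_comm u w, k v u,
      k w v, k u w] at h1
    linear_combination h1
  have hzero : ∀ X, X ≠ 0 → (inner ℝ (ξ x) X : ℝ) = 0 →
      μ x = σ x ∧ mvfderiv I σ x (ξ x) = 0 ∧ mvfderiv I σ x X = 0 := by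
    intro X hX hξX
    have hXX : (inner ℝ X X : ℝ) ≠ 0 := inner_self_ne_zero.2 hX
    have h21 : (inner ℝ (φ₂ x X) (φ₁ x X) : ℝ) = 0 := by rw [real_inner_comm, ht.inner₁₂]
    have h1 := hcyc X (φ₂ x X) (ξ x)
    have h2 := hcyc X (φ₁ x X) (ξ x)
    have h3 := hcyc X (φ₂ x X) (φ₃ x X)
    simp only [ht.inner_self, ht.inner₁, ht.inner₂, ht.inner₃, ht.inner₁', ht.inner₂', ht.inner₃',
      ht.apply₁,
      ht.apply₂, ht.inner₁₂, h21, ht.inner_map₁, ht.inner_map₂, ht.inner_map₃, ht.mul₁₂, ht.mul₁₃,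
      ht.inner_self₂, hξX, inner_zero_left, inner_neg_left] at h1 h2 h3
    refine ⟨?_, ?_, ?_⟩
    · have := (mul_eq_zero.1 (show (σ x - μ x) * inner ℝ X X = 0 by linarith)).resolve_right hXX
      linarith
    · exact (mul_eq_zero.1 (show mvfderiv I σ x (ξ x) * inner ℝ X X = 0 by
        linarith)).resolve_right hXX
    · exact (mul_eq_zero.1 (show mvfderiv I σ x X * inner ℝ X X = 0 by
        linarith)).resolve_right hXX
  obtain ⟨e, he, hξe⟩ := exists_ne_zero_inner_eq_zero hdim ξ x
  obtain ⟨h1, h2, -⟩ := hzero e he hξe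
  refine ⟨h1, fun u ↦ ?_⟩
  have h4 : mvfderiv I σ x (u - (inner ℝ (ξ x) u : ℝ) • ξ x) = 0 := by
    by_cases hX : u - (inner ℝ (ξ x) u : ℝ) • ξ x = 0
    · rw [hX, map_zero]
    · refine (hzero _ hX ?_).2.2
      rw [inner_sub_right, inner_smul_right, ht.inner_self, mul_one, sub_self]
  rwa [map_sub, map_smul, h2, smul_zero, sub_zero] at h4

end IsNearlyKahlerHypersurface

end Umbilical

/-! ### Classification -/

section Classification

open Set VectorField Topology

variable {E : Type*} [NormedAddCommGroup E] [NormedSpace ℝ E] [FiniteDimensional ℝ E]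
  {H : Type*} [TopologicalSpace H] {I : ModelWithCorners ℝ E H} [I.Boundaryless]
  {M : Type*} [TopologicalSpace M] [T2Space M] [ChartedSpace H M] [IsManifold I ∞ M]
  [RiemannianBundle (fun x : M ↦ TangentSpace I x)]
  [IsContMDiffRiemannianBundle I ∞ E (fun x : M ↦ TangentSpace I x)]
  {D : CovariantDerivative I E (TangentSpace I : M → Type _)}

theorem exists_cos_sin_eq {a b : ℝ} (h : a ^ 2 + b ^ 2 = 1) :
    ∃ t : ℝ, a = Real.cos t ∧ b = Real.sin t := by
  have hn : ‖(⟨a, b⟩ : ℂ)‖ = 1 := by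
    rw [Complex.norm_def, Complex.normSq_mk, Real.sqrt_eq_one]
    linarith
  have h0 : (⟨a, b⟩ : ℂ) ≠ 0 := by
    intro h0
    rw [h0, norm_zero] at hn
    exact zero_ne_one hn
  refine ⟨Complex.arg ⟨a, b⟩, ?_, ?_⟩
  · rw [Complex.cos_arg h0, hn, div_one]
  · rw [Complex.sin_arg, hn, div_one]

namespace IsNearlyKahlerHypersurface

variable {S : ∀ x : M, TangentSpace I x →L[ℝ] TangentSpace I x} {ξ : ∀ x : M, TangentSpace I x}
  {φ₁ φ₂ φ₃ φ : ∀ x : M, TangentSpace I x →L[ℝ] TangentSpace I x}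
  (h : IsNearlyKahlerHypersurface D S ξ φ₁ φ₂ φ₃) (hD : IsLeviCivita D) {a b c : M → ℝ}
  (hdim : 1 < Module.finrank ℝ E) (ha : ContMDiff I 𝓘(ℝ, ℝ) ∞ a)
  (hb : ContMDiff I 𝓘(ℝ, ℝ) ∞ b) (hc : ContMDiff I 𝓘(ℝ, ℝ) ∞ c)
  (habc : ∀ x, a x ^ 2 + b x ^ 2 + c x ^ 2 = 1)
  (hφ : ∀ x, φ x = a x • φ₁ x + b x • φ₂ x + c x • φ₃ x)
include h hD hdim ha hb hc habc hφ

/-- For a nearly Sasakian (`ε = 1`) or nearly cosymplectic (`ε = 0`) structure, `S` is a locally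
constant multiple of the identity, and the coefficients of `φ` are locally constant. -/
theorem exists_shape_eq_smul_id (hsφ : IsSmoothEndo φ) {ε : ℝ}
    (hnearly : ∀ x (u v : TangentSpace I x),
      covDerivEndo D hsφ x u v + covDerivEndo D hsφ x v u =
        ε • ((inner ℝ (ξ x) v : ℝ) • u + (inner ℝ (ξ x) u : ℝ) • v -
          (2 * inner ℝ u v : ℝ) • ξ x)) :
    ∃ σ : M → ℝ, ContMDiff I 𝓘(ℝ, ℝ) ∞ σ ∧ (∀ x, S x = σ x • ContinuousLinearMap.id ℝ _) ∧
      (∀ x, a x * σ x = ε - c x) ∧ (∀ x (u : TangentSpace I x), mvfderiv I σ x u = 0) ∧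
      (∀ x (u : TangentSpace I x), mvfderiv I a x u = 0) ∧
      (∀ x (u : TangentSpace I x), mvfderiv I b x u = 0) ∧
      ∀ x (u : TangentSpace I x), mvfderiv I c x u = 0 := by
  choose σ μ hS hσ hda hdb hdc using
    h.exists_shape_eq ha hb hc hφ hsφ hdim habc hnearly
  have hμ := h.eigenvalue_eq_and_mvfderiv_eq_zero hdim hS hD
  refine ⟨σ, h.contMDiff_eigenvalue hdim hS hD, fun x ↦ ?_, hσ, fun x ↦ (hμ x).2, hda,
    fun x u ↦ ?_, fun x u ↦ ?_⟩
  · ext1 u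
    rw [hS, (hμ x).1]
    simp
  · rw [hdb, (hμ x).1]
    ring
  · rw [hdc, (hμ x).1]
    ring

omit h hD hdim ha hb hc habc hφ in
theorem isQuasiUmbilical_of_eq_smul_id {σ : M → ℝ} (hσ : ContMDiff I 𝓘(ℝ, ℝ) ∞ σ)
    (hS : ∀ x, S x = σ x • ContinuousLinearMap.id ℝ _) (θ : ∀ x : M, TangentSpace I x →L[ℝ] ℝ) :
    IsQuasiUmbilical S θ := by
  refine ⟨σ, fun _ ↦ 0, hσ, contMDiff_const, fun x u v ↦ ?_⟩
  rw [hS]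
  simp [inner_smul_left]

/-- The coefficients `a`, `b`, `c` and the eigenvalue `σ` are constants with `a σ = 1 - c`. The
three alternatives are `a = 0`; `a ≠ 0` and `c = 0`; `a ≠ 0` and `c ≠ 0`. -/
theorem nearlySasakian_classification (hφS : IsNearlySasakian D ξ φ) :
    IsQuasiUmbilical S (dualForm ξ) ∧ (PreconnectedSpace M → Nonempty M →
      ((∃ l : ℝ, ∀ x, S x = l • ContinuousLinearMap.id ℝ _ ∧ φ x = φ₃ x) ∨
        (∃ t : ℝ, Real.cos t ≠ 0 ∧ ∀ x,
          S x = (1 / Real.cos t) • ContinuousLinearMap.id ℝ _ ∧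
          φ x = Real.cos t • φ₁ x + Real.sin t • φ₂ x) ∨
        ((∃ a₀ : ℝ, ∀ x, a x = a₀) ∧ ∀ x, a x ≠ 0 ∧ c x ≠ 0 ∧
          (∀ u : TangentSpace I x, mvfderiv I b x u = 0 ∧ mvfderiv I c x u = 0) ∧
          S x = ((1 - c x) / a x) • ContinuousLinearMap.id ℝ _))) := by
  obtain ⟨σ, hσ, hS, haσ, hdσ, hda, hdb, hdc⟩ :=
    h.exists_shape_eq_smul_id hD hdim ha hb hc habc hφ hφS.smooth_tensor (ε := 1)
      (fun x u v ↦ by rw [hφS.nabla_eq, one_smul]; rfl)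
  refine ⟨isQuasiUmbilical_of_eq_smul_id hσ hS _, fun _ ⟨p⟩ ↦ ?_⟩
  have hσp : ∀ x, σ x = σ p := fun x ↦ apply_eq_of_mvfderiv_eq_zero hσ hdσ x p
  have hap : ∀ x, a x = a p := fun x ↦ apply_eq_of_mvfderiv_eq_zero ha hda x p
  have hbp : ∀ x, b x = b p := fun x ↦ apply_eq_of_mvfderiv_eq_zero hb hdb x p
  have hcp : ∀ x, c x = c p := fun x ↦ apply_eq_of_mvfderiv_eq_zero hc hdc x p
  have haσp := haσ p
  have habcp := habc p
  by_cases ha0 : a p = 0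
  · left
    rw [ha0, zero_mul] at haσp
    have hc1 : c p = 1 := by linarith
    have hb0 : b p = 0 := by
      rw [ha0, hc1] at habcp
      exact pow_eq_zero_iff two_ne_zero |>.1 (by linarith)
    refine ⟨σ p, fun x ↦ ⟨by rw [hS, hσp], ?_⟩⟩
    rw [hφ, hap, hbp, hcp, ha0, hb0, hc1]
    simp
  right
  by_cases hc0 : c p = 0
  · left
    rw [hc0, sub_zero] at haσp
    obtain ⟨t, hat, hbt⟩ := exists_cos_sin_eq (a := a p) (b := b p) (by
      rw [← habcp, hc0]
      ring)
    refine ⟨t, hat ▸ ha0, fun x ↦ ⟨?_, ?_⟩⟩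
    · rw [hS, hσp, ← hat, eq_div_of_mul_eq ha0 ((mul_comm _ _).trans haσp)]
    · rw [hφ, hap, hbp, hcp, hc0, ← hat, ← hbt]
      simp
  right
  refine ⟨⟨a p, hap⟩, fun x ↦ ⟨hap x ▸ ha0, hcp x ▸ hc0, fun u ↦ ⟨hdb x u, hdc x u⟩, ?_⟩⟩
  rw [hS, eq_div_of_mul_eq (hap x ▸ ha0) ((mul_comm _ _).trans (haσ x))]

/-- The coefficients `a`, `b`, `c` and the eigenvalue `σ` are constants with `a σ = -c`. The three
alternatives are `a = 0`; `a ≠ 0` and `c = 0`; `a ≠ 0` and `c ≠ 0`. -/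
theorem nearlyCosymplectic_classification (hφC : IsNearlyCosymplectic D ξ φ) :
    IsQuasiUmbilical S (dualForm ξ) ∧ (PreconnectedSpace M → Nonempty M →
      ((∃ l : ℝ, (∀ x, S x = l • ContinuousLinearMap.id ℝ _) ∧
          ((∀ x, φ x = φ₂ x) ∨ ∀ x, φ x = -φ₂ x)) ∨
        (∃ t : ℝ, ∀ x, S x = 0 ∧ φ x = Real.cos t • φ₁ x + Real.sin t • φ₂ x) ∨
        ((∃ a₀ : ℝ, ∀ x, a x = a₀) ∧ ∀ x, a x ≠ 0 ∧ c x ≠ 0 ∧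
          (∀ u : TangentSpace I x, mvfderiv I b x u = 0 ∧ mvfderiv I c x u = 0) ∧
          S x = (-(c x / a x)) • ContinuousLinearMap.id ℝ _))) := by
  obtain ⟨σ, hσ, hS, haσ, hdσ, hda, hdb, hdc⟩ :=
    h.exists_shape_eq_smul_id hD hdim ha hb hc habc hφ hφC.smooth_tensor (ε := 0)
      (fun x u v ↦ by rw [hφC.nabla_eq, zero_smul])
  refine ⟨isQuasiUmbilical_of_eq_smul_id hσ hS _, fun _ ⟨p⟩ ↦ ?_⟩
  have hσp : ∀ x, σ x = σ p := fun x ↦ apply_eq_of_mvfderiv_eq_zero hσ hdσ x p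
  have hap : ∀ x, a x = a p := fun x ↦ apply_eq_of_mvfderiv_eq_zero ha hda x p
  have hbp : ∀ x, b x = b p := fun x ↦ apply_eq_of_mvfderiv_eq_zero hb hdb x p
  have hcp : ∀ x, c x = c p := fun x ↦ apply_eq_of_mvfderiv_eq_zero hc hdc x p
  have haσp := haσ p
  have habcp := habc p
  by_cases ha0 : a p = 0
  · left
    rw [ha0, zero_mul] at haσp
    have hc0 : c p = 0 := by linarith
    refine ⟨σ p, fun x ↦ by rw [hS, hσp], ?_⟩
    have hb1 : b p = 1 ∨ b p = -1 := by
      rw [ha0, hc0] at habcp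
      exact mul_self_eq_one_iff.1 (by linarith)
    refine hb1.imp (fun hb1 x ↦ ?_) (fun hb1 x ↦ ?_)
    all_goals
      rw [hφ, hap, hbp, hcp, ha0, hb1, hc0]
      simp
  right
  by_cases hc0 : c p = 0
  · left
    have hσ0 : σ p = 0 := by
      rw [hc0, sub_zero] at haσp
      exact (mul_eq_zero.1 haσp).resolve_left ha0
    obtain ⟨t, hat, hbt⟩ := exists_cos_sin_eq (a := a p) (b := b p) (by
      rw [← habcp, hc0]
      ring)
    refine ⟨t, fun x ↦ ⟨by rw [hS, hσp, hσ0, zero_smul], ?_⟩⟩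
    rw [hφ, hap, hbp, hcp, hc0, ← hat, ← hbt]
    simp
  right
  refine ⟨⟨a p, hap⟩, fun x ↦ ⟨hap x ▸ ha0, hcp x ▸ hc0, fun u ↦ ⟨hdb x u, hdc x u⟩, ?_⟩⟩
  rw [hS, eq_div_of_mul_eq (hap x ▸ ha0) ((mul_comm _ _).trans (haσ x)), zero_sub, neg_div]

end IsNearlyKahlerHypersurface

end Classification

end

theorem theoremB
    -- the ambient six-dimensional Riemannian manifold with its Levi-Civita connection
    {M' : Type*} [TopologicalSpace M'] [T2Space M'] [ChartedSpace (EuclideanSpace ℝ (Fin 6)) M']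
    [IsManifold (𝓡 6) ∞ M']
    [RiemannianBundle (fun x : M' ↦ TangentSpace (𝓡 6) x)]
    [IsContMDiffRiemannianBundle (𝓡 6) ∞ (EuclideanSpace ℝ (Fin 6))
      (fun x : M' ↦ TangentSpace (𝓡 6) x)]
    (D' : CovariantDerivative (𝓡 6) (EuclideanSpace ℝ (Fin 6))
      (TangentSpace (𝓡 6) : M' → Type _))
    (hD' : IsLeviCivita D')
    -- the strict nearly Kähler structure of type one
    (J : ∀ x : M', TangentSpace (𝓡 6) x →L[ℝ] TangentSpace (𝓡 6) x)
    (hJ : IsAlmostHermitian J)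
    (hNK : IsStrictNearlyKahler D' hJ)
    (htype : HasConstantType D' hJ 1)
    -- the isometrically immersed hypersurface with its Levi-Civita connection
    {M : Type*} [TopologicalSpace M] [T2Space M] [Nonempty M]
    [ChartedSpace (EuclideanSpace ℝ (Fin 5)) M]
    [IsManifold (𝓡 5) ∞ M]
    [RiemannianBundle (fun x : M ↦ TangentSpace (𝓡 5) x)]
    [IsContMDiffRiemannianBundle (𝓡 5) ∞ (EuclideanSpace ℝ (Fin 5))
      (fun x : M ↦ TangentSpace (𝓡 5) x)]
    (D : CovariantDerivative (𝓡 5) (EuclideanSpace ℝ (Fin 5))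
      (TangentSpace (𝓡 5) : M → Type _))
    (hD : IsLeviCivita D)
    (f : M → M') (hf : IsIsometricImmersion (𝓡 5) (𝓡 6) f)
    (N : ∀ x : M, TangentSpace (𝓡 6) (f x)) (hN : IsUnitNormal (𝓡 5) (𝓡 6) f N)
    -- the shape operator, the vector field `ξ`, the one-form `η` and the three basic structures
    (S : ∀ x : M, TangentSpace (𝓡 5) x →L[ℝ] TangentSpace (𝓡 5) x)
    (hS : S = shapeOperator (𝓡 5) D' f N)
    (ξ : ∀ x : M, TangentSpace (𝓡 5) x) (hξ : ξ = reebField (𝓡 5) J f N)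
    (η : ∀ x : M, TangentSpace (𝓡 5) x →L[ℝ] ℝ) (hη : η = dualForm ξ)
    (φ₁ φ₂ φ₃ : ∀ x : M, TangentSpace (𝓡 5) x →L[ℝ] TangentSpace (𝓡 5) x)
    (hφ₁ : φ₁ = phiOne (𝓡 5) J f N) (hφ₂ : φ₂ = phiTwo (𝓡 5) D' hJ f N)
    (hφ₃ : φ₃ = phiThree (𝓡 5) D' hJ f N)
    -- the structure `φ = a φ₁ + b φ₂ + c φ₃`
    (a b c : M → ℝ) (ha : ContMDiff (𝓡 5) 𝓘(ℝ, ℝ) ∞ a) (hb : ContMDiff (𝓡 5) 𝓘(ℝ, ℝ) ∞ b)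
    (hc : ContMDiff (𝓡 5) 𝓘(ℝ, ℝ) ∞ c) (habc : ∀ x, a x ^ 2 + b x ^ 2 + c x ^ 2 = 1)
    (φ : ∀ x : M, TangentSpace (𝓡 5) x →L[ℝ] TangentSpace (𝓡 5) x)
    (hφ : ∀ x, φ x = a x • φ₁ x + b x • φ₂ x + c x • φ₃ x) :
    IsAlmostContactMetric ξ φ ∧
    (IsSasakian D ξ φ ↔ (∀ x, S x = 0) ∧ ∀ x, φ x = φ₃ x) ∧
    ¬ IsCoKahler D ξ φ ∧
    (IsNearlySasakian D ξ φ →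
      IsQuasiUmbilical S η ∧
      (PreconnectedSpace M →
        ((∃ l : ℝ, ∀ x, S x = ContinuousLinearMap.id ℝ _ + (l - 1) • (η x).smulRight (ξ x) ∧
            φ x = φ₁ x) ∨
          (∃ l : ℝ, ∀ x, S x = l • ContinuousLinearMap.id ℝ _ ∧ φ x = φ₃ x) ∨
          (∃ t : ℝ, Real.cos t ≠ 0 ∧ ∀ x,
            S x = (1 / Real.cos t) • ContinuousLinearMap.id ℝ _ ∧
            φ x = Real.cos t • φ₁ x + Real.sin t • φ₂ x) ∨
          ((∃ a₀ : ℝ, ∀ x, a x = a₀) ∧ ∀ x, a x ≠ 0 ∧ c x ≠ 0 ∧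
            (∀ u : TangentSpace (𝓡 5) x, η x u = 0 →
              mvfderiv (𝓡 5) b x u = 0 ∧ mvfderiv (𝓡 5) c x u = 0) ∧
            S x = ((1 - c x) / a x) • ContinuousLinearMap.id ℝ _ +
              (1 / c x * mvfderiv (𝓡 5) b x (ξ x)) • (η x).smulRight (ξ x))))) ∧
    (IsNearlyCosymplectic D ξ φ →
      IsQuasiUmbilical S η ∧
      (PreconnectedSpace M →
        ((∃ l : ℝ, (∀ x, S x = l • ContinuousLinearMap.id ℝ _) ∧
            ((∀ x, φ x = φ₂ x) ∨ ∀ x, φ x = -φ₂ x)) ∨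
          (∃ l : ℝ, ∀ x, S x = l • (η x).smulRight (ξ x) ∧ φ x = φ₁ x) ∨
          (∃ t : ℝ, ∀ x, S x = 0 ∧ φ x = Real.cos t • φ₁ x + Real.sin t • φ₂ x) ∨
          ((∃ a₀ : ℝ, ∀ x, a x = a₀) ∧ ∀ x, a x ≠ 0 ∧ c x ≠ 0 ∧
            (∀ u : TangentSpace (𝓡 5) x, η x u = 0 →
              mvfderiv (𝓡 5) b x u = 0 ∧ mvfderiv (𝓡 5) c x u = 0) ∧
            S x = (-(c x / a x)) • ContinuousLinearMap.id ℝ _ +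
              (1 / c x * mvfderiv (𝓡 5) b x (ξ x)) • (η x).smulRight (ξ x))))) := by
  subst hS hξ hη hφ₁ hφ₂ hφ₃
  have h := isNearlyKahlerHypersurface (by simp) (by simp) hD hD' hNK htype hf hN
  have hdim : 1 < Module.finrank ℝ (EuclideanSpace ℝ (Fin 5)) := by simp
  refine ⟨h.isAlmostContactMetric ha hb hc habc hφ, h.isSasakian_iff hdim ha hb hc habc hφ,
    h.not_isCoKahler hdim ha hb hc habc hφ, fun hφS ↦ ?_, fun hφC ↦ ?_⟩
  · obtain ⟨hq, hcl⟩ := h.nearlySasakian_classification hD hdim ha hb hc habc hφ hφS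
    -- here `S = Id + (λ - 1) η ⊗ ξ`, `φ = φ₁` forces `λ = 1`, the case `t = 0` of the third family
    refine ⟨hq, fun hM ↦ Or.inr ?_⟩
    refine (hcl hM inferInstance).imp_right (Or.imp_right ?_)
    rintro ⟨h1, h2⟩
    refine ⟨h1, fun x ↦ ?_⟩
    obtain ⟨hax, hcx, hd, hSx⟩ := h2 x
    exact ⟨hax, hcx, fun u _ ↦ hd u, by rw [hSx, (hd _).1, mul_zero, zero_smul, add_zero]⟩
  · obtain ⟨hq, hcl⟩ := h.nearlyCosymplectic_classification hD hdim ha hb hc habc hφ hφC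
    -- here `S = λ η ⊗ ξ`, `φ = φ₁` forces `λ = 0`, the case `t = 0` of the third family
    refine ⟨hq, fun hM ↦ ?_⟩
    refine (hcl hM inferInstance).imp_right fun h' ↦ Or.inr (h'.imp_right ?_)
    rintro ⟨h1, h2⟩
    refine ⟨h1, fun x ↦ ?_⟩
    obtain ⟨hax, hcx, hd, hSx⟩ := h2 x
    exact ⟨hax, hcx, fun u _ ↦ hd u, by rw [hSx, (hd _).1, mul_zero, zero_smul, add_zero]⟩
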